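/- **Notation.** For an interval $J\subset[0,1]$ and an integrable $g:[0,1]\to\mathbb C$ put $(\mathcal E_Jg)(x)=\int_J g(\xi)e^{2\pi i(\xi x_1+\xi^2x_2)}\,d\xi$, $x\in\mathbb R^2$. For an axis-parallel square $B=B(c,R)\subset\mathbb R^2$ with centre $c$ and side length $R$ let $w_B(x)=(1+|x-c|/R)^{-100}$, $\|f\|_{L^p(w_B)}=(\int_{\mathbb R^2}|f|^pw_B)^{1/p}$ and $\|f\|_{L^p_\#(w_B)}=(|B|^{-1}\int_{\mathbb R^2}|f|^pw_B)^{1/p}$. $P_\ell(I)$ and $P_\ell(B)$ denote the partitions of an interval $I$ into intervals of length $\ell$ and of a square $B$ into squares of side length $\ell$; $\mathbb N^{-1}=\{1/n:n\ge1\}$. For $\delta\in\mathbb N^{-1}$, $D(\delta)$ is the best (smallest) constant such that $$\|\mathcal E_{[0,1]}g\|_{L^6(B)}\le D(\delta)\Big(\sum_{J\in P_\delta([0,1])}\|\mathcal E_Jg\|_{L^6(w_B)}^2\Big)^{1/2}$$ for all integrable $g:[0,1]\to\mathbb C$ and all squares $B$ of side length $\delta^{-2}$. For an integer $b\ge1$,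 a real $s\in[2,3]$, $\delta\in\mathbb N^{-1}$ and $\nu\in\mathbb N^{-1}\cap(0,1/100)$ with $\nu^b\delta^{-1}\in\mathbb N$, $\mathbf M_b^{(s)}(\delta,\nu)$ is the best constant such that $$\frac1{|P_{\nu^{-b}}(B)|}\sum_{\Delta\in P_{\nu^{-b}}(B)}\Big(\sum_{J\in P_{\nu^b}(I)}\|\mathcal E_Jg\|_{L^2_\#(w_\Delta)}^2\Big)^{\frac s2}\Big(\sum_{J'\in P_{\nu^b}(I')}\|\mathcal E_{J'}g\|_{L^2_\#(w_\Delta)}^2\Big)^{\frac{6-s}2}$$ $$\le\ \mathbf M_b^{(s)}(\delta,\nu)^6\Big(\sum_{J\in P_\delta(I)}\|\mathcal E_Jg\|_{L^6_\#(w_B)}^2\Big)^{\frac s2}\Big(\sum_{J'\in P_\delta(I')}\|\mathcal E_{J'}g\|_{L^6_\#(w_B)}^2\Big)^{\frac{6-s}2}$$ for all squares $B$ of side length $\delta^{-2}$, all integrable $g:[0,1]\to\mathbb C$ and all $I,I'\in P_\nu([0,1])$ with $d(I,I')\ge\nu$. **Lemma 5.4.** For every $\varepsilon>0$ there is a constant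 $C_\varepsilon>0$, depending only on $\varepsilon$, such that for all real $s\in[2,3]$, all integers $b\ge1$, and all $\delta\in\mathbb N^{-1}$, $\nu\in\mathbb N^{-1}\cap(0,1/100)$ with $\nu^{2b}\delta^{-1}\in\mathbb N$, $$\mathbf M_b^{(s)}(\delta,\nu)\ \le\ C_\varepsilon\,\nu^{-\frac16(1+b\varepsilon)}\,\mathbf M_{2b}^{(s)}(\delta,\nu)^{1/2}\,D\Big(\frac{\delta}{\nu^b}\Big)^{1/2}.$$ -/

import Mathlib

open MeasureTheory
open scoped ENNReal

namespace ParabolaDecoupling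

noncomputable section

/-- `t ∈ ℕ⁻¹`, that is, `t = 1 / n` for a positive integer `n`. -/
def IsUnitFraction (t : ℝ) : Prop := ∃ n : ℕ, 0 < n ∧ t = 1 / (n : ℝ)

/-- The extension operator for the parabola on the interval `J = [a, a + ℓ]`:
`(E_J g)(x) = ∫_J g(ξ) exp(2πi (ξ x₁ + ξ² x₂)) dξ`. -/
def extend (a ℓ : ℝ) (g : ℝ → ℂ) (x : ℝ × ℝ) : ℂ :=
  ∫ ξ in Set.Icc a (a + ℓ),
    g ξ * Complex.exp (2 * (Real.pi : ℂ) * Complex.I * ((ξ * x.1 + ξ ^ 2 * x.2 : ℝ) : ℂ))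

/-- The axis-parallel square `B(c, R)` in the plane with centre `c` and side length `R`. -/
def square (c : ℝ × ℝ) (R : ℝ) : Set (ℝ × ℝ) :=
  Set.Icc (c.1 - R / 2) (c.1 + R / 2) ×ˢ Set.Icc (c.2 - R / 2) (c.2 + R / 2)

/-- The weight `w_B(x) = (1 + |x - c| / R)⁻¹⁰⁰` of the square `B = B(c, R)`, where `|x - c|` is the
Euclidean distance (written out, since the norm of `ℝ × ℝ` is the maximum norm). -/
def weight (c : ℝ × ℝ) (R : ℝ) (x : ℝ × ℝ) : ℝ :=
  ((1 + Real.sqrt ((x.1 - c.1) ^ 2 + (x.2 - c.2) ^ 2) / R) ^ 100)⁻¹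

/-- The weighted norm `‖f‖_{L^p(w_B)} = (∫ |f|^p w_B)^{1/p}` for `B = B(c, R)`. -/
def weightedNorm (p : ℝ) (c : ℝ × ℝ) (R : ℝ) (f : ℝ × ℝ → ℂ) : ℝ≥0∞ :=
  (∫⁻ x, ‖f x‖ₑ ^ p * ENNReal.ofReal (weight c R x)) ^ (1 / p)

/-- The normalised weighted norm `‖f‖_{L^p_#(w_B)} = (|B|⁻¹ ∫ |f|^p w_B)^{1/p}` for
`B = B(c, R)`, so that `|B| = R²`. -/
def weightedAvgNorm (p : ℝ) (c : ℝ × ℝ) (R : ℝ) (f : ℝ × ℝ → ℂ) : ℝ≥0∞ :=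
  (ENNReal.ofReal (R ^ 2)⁻¹ * ∫⁻ x, ‖f x‖ₑ ^ p * ENNReal.ofReal (weight c R x)) ^ (1 / p)

/-- The number `L / ℓ` of intervals of length `ℓ` in the partition of an interval of length `L`
(used only when `L / ℓ` is a natural number). -/
def numCells (L ℓ : ℝ) : ℕ := ⌊L / ℓ⌋₊

/-- `∑_{J ∈ P_ℓ(I)} ‖E_J g‖²_{L^p_#(w_B)}` for `I = [a, a + L]` and `B = B(c, R)`; the members of
`P_ℓ(I)` are the intervals `[a + kℓ, a + (k + 1)ℓ]` with `0 ≤ k < L / ℓ`. -/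
def squareSum (p a L ℓ : ℝ) (c : ℝ × ℝ) (R : ℝ) (g : ℝ → ℂ) : ℝ≥0∞ :=
  ∑ k ∈ Finset.range (numCells L ℓ), weightedAvgNorm p c R (extend (a + k * ℓ) ℓ g) ^ 2

/-- The centre of the cell with index `(i, j)` in the partition `P_ℓ(B)` of `B = B(c, R)` into
squares of side length `ℓ`. -/
def cellCenter (c : ℝ × ℝ) (R ℓ : ℝ) (i j : ℕ) : ℝ × ℝ :=
  (c.1 - R / 2 + ((i : ℝ) + 1 / 2) * ℓ, c.2 - R / 2 + ((j : ℝ) + 1 / 2) * ℓ)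

/-- The average over the squares `Δ ∈ P_ℓ(B)`, where `B = B(c, R)`, of a quantity `F` that is given
as a function of the centre of `Δ`. -/
def avgCells (c : ℝ × ℝ) (R ℓ : ℝ) (F : ℝ × ℝ → ℝ≥0∞) : ℝ≥0∞ :=
  ((numCells R ℓ : ℝ≥0∞) ^ 2)⁻¹ *
    ∑ i ∈ Finset.range (numCells R ℓ), ∑ j ∈ Finset.range (numCells R ℓ),
      F (cellCenter c R ℓ i j)

/-- The linear decoupling constant `D(δ)`: the best `A ∈ [0, ∞]` such that
`‖E_{[0,1]} g‖_{L⁶(B)} ≤ A (∑_{J ∈ P_δ([0,1])} ‖E_J g‖²_{L⁶(w_B)})^{1/2}`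
for all integrable `g` on `[0, 1]` and all squares `B` of side length `δ⁻²`. -/
def linearConst (δ : ℝ) : ℝ≥0∞ :=
  sInf {A : ℝ≥0∞ | ∀ (g : ℝ → ℂ), IntegrableOn g (Set.Icc 0 1) → ∀ c : ℝ × ℝ,
    (∫⁻ x in square c (δ ^ 2)⁻¹, ‖extend 0 1 g x‖ₑ ^ (6 : ℝ)) ^ (1 / 6 : ℝ) ≤
      A * (∑ k ∈ Finset.range (numCells 1 δ),
        weightedNorm 6 c (δ ^ 2)⁻¹ (extend (k * δ) δ g) ^ 2) ^ (1 / 2 : ℝ)}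

/-- The intervals `[a, a + ℓ]` and `[a', a' + ℓ]` are at distance at least `r`. -/
def Separated (r a a' ℓ : ℝ) : Prop :=
  ∀ x ∈ Set.Icc a (a + ℓ), ∀ y ∈ Set.Icc a' (a' + ℓ), r ≤ |x - y|

/-- The bilinear constant `M_b^{(s)}(δ, ν)`: the best `A ∈ [0, ∞]` such that
`Avg_{Δ ∈ P_{ν^{-b}}(B)} (∑_{J ∈ P_{ν^b}(I)} ‖E_J g‖²_{L²_#(w_Δ)})^{s/2}
    (∑_{J' ∈ P_{ν^b}(I')} ‖E_{J'} g‖²_{L²_#(w_Δ)})^{(6-s)/2}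
  ≤ A⁶ (∑_{J ∈ P_δ(I)} ‖E_J g‖²_{L⁶_#(w_B)})^{s/2}
    (∑_{J' ∈ P_δ(I')} ‖E_{J'} g‖²_{L⁶_#(w_B)})^{(6-s)/2}`
for all integrable `g` on `[0, 1]`, all squares `B` of side length `δ⁻²`, and all `ν`-separated
intervals `I = [mν, (m + 1)ν]` and `I' = [m'ν, (m' + 1)ν]` in `P_ν([0, 1])`. -/
def bilinearConst (s : ℝ) (b : ℕ) (δ ν : ℝ) : ℝ≥0∞ :=
  sInf {A : ℝ≥0∞ | ∀ (g : ℝ → ℂ), IntegrableOn g (Set.Icc 0 1) → ∀ c : ℝ × ℝ,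
    ∀ m < numCells 1 ν, ∀ m' < numCells 1 ν, Separated ν (m * ν) (m' * ν) ν →
      avgCells c (δ ^ 2)⁻¹ (ν ^ b)⁻¹ (fun z =>
          squareSum 2 (m * ν) ν (ν ^ b) z (ν ^ b)⁻¹ g ^ (s / 2) *
          squareSum 2 (m' * ν) ν (ν ^ b) z (ν ^ b)⁻¹ g ^ ((6 - s) / 2)) ≤
        A ^ 6 * (squareSum 6 (m * ν) ν δ c (δ ^ 2)⁻¹ g ^ (s / 2) *
          squareSum 6 (m' * ν) ν δ c (δ ^ 2)⁻¹ g ^ ((6 - s) / 2))}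

end

end ParabolaDecoupling

/-!
Put `σ = ν ^ b`, and partition a square of side length `δ⁻²` first into squares `Δ'` of side length
`σ⁻²` and then each `Δ'` into squares `Δ` of side length `σ⁻¹`. The averages over the `Δ ⊂ Δ'` of the
products of `L²` square functions are estimated in four moves.

* *Ball inflation* (`exists_ball_inflation`). On `Δ'` the average of the product is at most `C / ν`
  times the product of the square functions built from the `L^s` and `L^(6-s)` moments on `Δ'`.
  Minkowski's inequality, applied once for each factor (`sum_mul_le_of_pairwise`), reduces this to a
  single pair of intervals of length `σ`. The moduli of the two extensions are essentially constant
  on translates of the boxes dual to the two arcs (`exists_locally_constant`), and boxes for arcs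
  whose directions differ by `h` meet in about `1 / h` of the small squares
  (`exists_transversal_sum_le`). No pigeonholing is involved, so nothing is lost beyond `C / ν`; this
  is why the final estimate holds with the power `ν ^ (-1/6)`, and `ε` only gives room to spare.
* *Interpolation* (`sum_moment_le`). Hölder's inequality between the exponents `2` and `6`.
* *Orthogonality* (`exists_local_orthogonality`, `exists_sum_moment_two_le`). On `Δ'`, of side length
  `σ⁻²`, the `L²` square function for intervals of length `σ` is controlled by the one for intervals
  of length `σ²`.
* *Rescaled linear decoupling* (`exists_average_cube_le`). The averages over `Δ'` of the cubes of the
  `L⁶` square functions for intervals of length `σ` are controlled by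
  `linearConst (δ / σ) ^ 6` and the square functions for intervals of length `δ`.

By the Cauchy–Schwarz inequality in `Δ'`, one factor is the bilinear average at scale `ν ^ (2 * b)`
with the two intervals interchanged, and the other one is controlled by the fourth move; this is
`exists_bilinear_step`. Taking sixth roots gives the theorem.

The fourth move needs more than the definition of `linearConst` gives directly. Covering the plane
by squares and summing the weights `weight q R` over the squares produces a weight that decays more
slowly than `weight`. So the decoupling inequality is first proved on a square with weights that
decay much faster (`exists_linear_decoupling_prodDec`). To this end `extend 0 1 g` is multiplied, at
each time `y`, by a band-limited bump in the space variable. The product is the extension at time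
`y` of another function on the line, to which the definition of `linearConst` applies, and
averaging over `y` against a rapidly decaying kernel recovers `extend 0 1 g`
(`Localizer.η_mul_extend_eq`). The bump enlarges the frequency intervals by `1 / R = δ²`; the
resulting errors are absorbed because `linearConst` is bounded below (`exists_one_le_linearConst`).
The rapidly decaying weights can then be integrated against any slowly varying weight
(`exists_linear_decoupling_weight`), in particular against the image of `weight` under parabolic
rescaling (`exists_rescaled_decoupling`).
-/

open scoped NNReal

namespace ParabolaDecoupling

noncomputable section

/-! ### Hölder, Jensen and Minkowski inequalities with values in `[0, ∞]` -/

/-- Jensen's inequality for the measure with density `k`. -/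
theorem lintegral_mul_rpow_le {α : Type*} [MeasurableSpace α] {μ : Measure α} {p : ℝ} (hp : 1 ≤ p)
    {f k : α → ℝ≥0∞} (hf : AEMeasurable f μ) (hk : AEMeasurable k μ) :
    (∫⁻ x, f x * k x ∂μ) ^ p ≤ (∫⁻ x, k x ∂μ) ^ (p - 1) * ∫⁻ x, f x ^ p * k x ∂μ := by
  have hp0 : 0 < p := by linarith
  have hq : 0 ≤ 1 - p⁻¹ := sub_nonneg.2 (inv_le_one_of_one_le₀ hp)
  have h := ENNReal.lintegral_mul_norm_pow_le (μ := μ) (f := fun x => f x ^ p * k x) (g := k)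
    ((hf.pow_const p).mul hk) hk (p := p⁻¹) (q := 1 - p⁻¹) (by positivity) hq (by ring)
  have e : ∀ x, (f x ^ p * k x) ^ p⁻¹ * k x ^ (1 - p⁻¹) = f x * k x := fun x => by
    rw [ENNReal.mul_rpow_of_nonneg _ _ (by positivity), ← ENNReal.rpow_mul,
      mul_inv_cancel₀ hp0.ne', ENNReal.rpow_one, mul_assoc,
      ← ENNReal.rpow_add_of_nonneg _ _ (by positivity) hq]
    simp
  simp only [e] at h
  calc _ ≤ _ := ENNReal.rpow_le_rpow h hp0.le
    _ = _ := by
      rw [ENNReal.mul_rpow_of_nonneg _ _ hp0.le, ← ENNReal.rpow_mul, ← ENNReal.rpow_mul,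
        inv_mul_cancel₀ hp0.ne', ENNReal.rpow_one, mul_comm, sub_mul, inv_mul_cancel₀ hp0.ne',
        one_mul]

/-- Minkowski's inequality for finite sums, in `p`-th powers. -/
theorem lintegral_sum_rpow_le {α ι : Type*} [MeasurableSpace α] {μ : Measure α} {p : ℝ}
    (hp : 1 ≤ p) (s : Finset ι) {f : ι → α → ℝ≥0∞} (hf : ∀ i ∈ s, AEMeasurable (f i) μ) :
    ∫⁻ x, (∑ i ∈ s, f i x) ^ p ∂μ ≤ (∑ i ∈ s, (∫⁻ x, f i x ^ p ∂μ) ^ (1 / p)) ^ p := by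
  have hp0 : 0 < p := by linarith
  have key : (∫⁻ x, (∑ i ∈ s, f i x) ^ p ∂μ) ^ (1 / p) ≤
      ∑ i ∈ s, (∫⁻ x, f i x ^ p ∂μ) ^ (1 / p) := by
    classical
    induction s using Finset.induction_on with
    | empty => simp [ENNReal.zero_rpow_of_pos hp0, ENNReal.zero_rpow_of_pos (inv_pos.2 hp0)]
    | insert a s ha ih =>
      simp only [Finset.sum_insert ha]
      have hs := fun i hi => hf i (Finset.mem_insert_of_mem hi)
      refine le_trans ?_ (add_le_add le_rfl (ih hs))
      exact ENNReal.lintegral_Lp_add_le (f := f a) (g := fun x => ∑ i ∈ s, f i x)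
        (hf a (Finset.mem_insert_self a s)) (Finset.aemeasurable_fun_sum s hs) hp
  calc _ = ((∫⁻ x, (∑ i ∈ s, f i x) ^ p ∂μ) ^ (1 / p)) ^ p := by
        rw [← ENNReal.rpow_mul, one_div_mul_cancel hp0.ne', ENNReal.rpow_one]
    _ ≤ _ := ENNReal.rpow_le_rpow key hp0.le

/-- Minkowski's inequality in `L³` for the cube roots of the functions `b i`. -/
theorem lintegral_sum_cubeRoot_le {α ι : Type*} [MeasurableSpace α] {μ : Measure α}
    (s : Finset ι) {b : ι → α → ℝ≥0∞} (hb : ∀ i ∈ s, AEMeasurable (b i) μ) :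
    ∫⁻ x, (∑ i ∈ s, b i x ^ (1 / 3 : ℝ)) ^ (3 : ℝ) ∂μ ≤
      (∑ i ∈ s, (∫⁻ x, b i x ∂μ) ^ (1 / 3 : ℝ)) ^ (3 : ℝ) := by
  have h := lintegral_sum_rpow_le (μ := μ) (p := 3) (by norm_num) s
    (f := fun i x => b i x ^ (1 / 3 : ℝ)) (fun i hi => (hb i hi).pow_const _)
  have e : ∀ y : ℝ≥0∞, (y ^ (1 / 3 : ℝ)) ^ (3 : ℝ) = y := fun y => by
    rw [← ENNReal.rpow_mul]; norm_num
  simpa only [e] using h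

/-- Sums over a finite set as integrals, to transfer inequalities between integrals to sums. -/
theorem exists_lintegral_eq_sum {ι : Type*} (s : Finset ι) :
    ∃ (_ : MeasurableSpace ι) (μ : Measure ι), (∀ f : ι → ℝ≥0∞, AEMeasurable f μ) ∧
      ∀ f : ι → ℝ≥0∞, ∫⁻ i, f i ∂μ = ∑ i ∈ s, f i := by
  let _ : MeasurableSpace ι := ⊤
  refine ⟨⊤, ∑ i ∈ s, Measure.dirac i, fun f => (measurable_from_top).aemeasurable, fun f => ?_⟩
  rw [lintegral_finsetSum_measure]
  exact Finset.sum_congr rfl fun i _ => lintegral_dirac' _ measurable_from_top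

theorem sum_rpow_mul_rpow_le {ι : Type*} (s : Finset ι) (f g : ι → ℝ≥0∞) {p q : ℝ} (hp : 0 ≤ p)
    (hq : 0 ≤ q) (hpq : p + q = 1) :
    ∑ i ∈ s, f i ^ p * g i ^ q ≤ (∑ i ∈ s, f i) ^ p * (∑ i ∈ s, g i) ^ q := by
  obtain ⟨_, μ, hm, hμ⟩ := exists_lintegral_eq_sum s
  simpa only [hμ] using ENNReal.lintegral_mul_norm_pow_le (hm f) (hm g) hp hq hpq

theorem sum_sum_rpow_le {ι κ : Type*} (t : Finset κ) (s : Finset ι) (f : ι → κ → ℝ≥0∞) {p : ℝ}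
    (hp : 1 ≤ p) :
    ∑ j ∈ t, (∑ i ∈ s, f i j) ^ p ≤ (∑ i ∈ s, (∑ j ∈ t, f i j ^ p) ^ (1 / p)) ^ p := by
  obtain ⟨_, μ, hm, hμ⟩ := exists_lintegral_eq_sum t
  simpa only [hμ] using lintegral_sum_rpow_le (μ := μ) hp s fun i _ => hm (f i)

theorem sum_mul_sum_rpow_le {ι κ : Type*} (t : Finset κ) (s : Finset ι) (f : ι → κ → ℝ≥0∞)
    (h : κ → ℝ≥0∞) {p : ℝ} (hp : 1 ≤ p) :
    ∑ j ∈ t, (∑ i ∈ s, f i j) ^ p * h j ≤ (∑ i ∈ s, (∑ j ∈ t, f i j ^ p * h j) ^ (1 / p)) ^ p := by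
  have hp0 : 0 < p := by linarith
  have := sum_sum_rpow_le t s (fun i j => f i j * h j ^ (1 / p)) hp
  simpa [← Finset.sum_mul, ENNReal.mul_rpow_of_nonneg _ _ hp0.le, ← ENNReal.rpow_mul,
    inv_mul_cancel₀ hp0.ne'] using this

/-- A bilinear estimate for single functions passes to square functions: two applications of
Minkowski's inequality, one in each factor. -/
theorem sum_mul_le_of_pairwise {ι ι' κ : Type*} (t : Finset κ) (s : Finset ι) (s' : Finset ι')
    (G : ι → κ → ℝ≥0∞) (G' : ι' → κ → ℝ≥0∞) (P : ι → ℝ≥0∞) (P' : ι' → ℝ≥0∞) (K : ℝ≥0∞) {α β : ℝ}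
    (hα : 1 ≤ α) (hβ : 1 ≤ β)
    (h : ∀ i ∈ s, ∀ i' ∈ s', ∑ j ∈ t, G i j ^ α * G' i' j ^ β ≤ K * (P i ^ α * P' i' ^ β)) :
    ∑ j ∈ t, (∑ i ∈ s, G i j) ^ α * (∑ i' ∈ s', G' i' j) ^ β ≤
      K * ((∑ i ∈ s, P i) ^ α * (∑ i' ∈ s', P' i') ^ β) := by
  have hα0 : 0 < α := by linarith
  have hβ0 : 0 < β := by linarith
  have inner : ∀ i ∈ s, ∑ j ∈ t, G i j ^ α * (∑ i' ∈ s', G' i' j) ^ β ≤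
      K * (∑ i' ∈ s', P' i') ^ β * P i ^ α := by
    intro i hi
    have h1 := sum_mul_sum_rpow_le t s' G' (fun j => G i j ^ α) hβ
    calc _ = ∑ j ∈ t, (∑ i' ∈ s', G' i' j) ^ β * G i j ^ α := by simp only [mul_comm]
      _ ≤ _ := h1
      _ ≤ (∑ i' ∈ s', (K * P i ^ α) ^ (1 / β) * P' i') ^ β := by
        gcongr with i' hi'
        calc _ ≤ (K * (P i ^ α * P' i' ^ β)) ^ (1 / β) := by
              gcongr; simpa only [mul_comm] using h i hi i' hi'
          _ = _ := by
              rw [← mul_assoc, ENNReal.mul_rpow_of_nonneg _ _ (by positivity),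
                ← ENNReal.rpow_mul (P' i'), mul_one_div_cancel hβ0.ne', ENNReal.rpow_one]
      _ = _ := by
        rw [← Finset.mul_sum, ENNReal.mul_rpow_of_nonneg _ _ hβ0.le, ← ENNReal.rpow_mul,
          one_div_mul_cancel hβ0.ne', ENNReal.rpow_one]; ring
  calc _ ≤ _ := sum_mul_sum_rpow_le t s G (fun j => (∑ i' ∈ s', G' i' j) ^ β) hα
    _ ≤ (∑ i ∈ s, (K * (∑ i' ∈ s', P' i') ^ β) ^ (1 / α) * P i) ^ α := by
      gcongr with i hi
      calc _ ≤ (K * (∑ i' ∈ s', P' i') ^ β * P i ^ α) ^ (1 / α) := by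
            gcongr; exact inner i hi
        _ = _ := by
            rw [ENNReal.mul_rpow_of_nonneg _ _ (by positivity), ← ENNReal.rpow_mul (P i),
              mul_one_div_cancel hα0.ne', ENNReal.rpow_one]
    _ = _ := by
      rw [← Finset.mul_sum, ENNReal.mul_rpow_of_nonneg _ _ hα0.le, ← ENNReal.rpow_mul,
        one_div_mul_cancel hα0.ne', ENNReal.rpow_one]; ring

/-! ### Oscillatory factors and auxiliary Schwartz functions -/

/-- The character `t ↦ exp (2πit)` of the real line. -/
def osc (t : ℝ) : ℂ := Complex.exp (2 * (Real.pi : ℂ) * Complex.I * (t : ℂ))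

theorem osc_eq (t : ℝ) : osc t = Complex.exp (((2 * Real.pi * t : ℝ) : ℂ) * Complex.I) := by
  rw [osc]; congr 1; push_cast; ring

@[simp] theorem norm_osc (t : ℝ) : ‖osc t‖ = 1 := by
  rw [osc_eq]; exact Complex.norm_exp_ofReal_mul_I _

@[simp] theorem enorm_osc (t : ℝ) : ‖osc t‖ₑ = 1 := by
  rw [← ofReal_norm, norm_osc, ENNReal.ofReal_one]

@[simp] theorem osc_zero : osc 0 = 1 := by simp [osc]

theorem osc_add (s t : ℝ) : osc (s + t) = osc s * osc t := by
  rw [osc, osc, osc, ← Complex.exp_add]; congr 1; push_cast; ring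

theorem conj_osc (t : ℝ) : (starRingEnd ℂ) (osc t) = osc (-t) := by
  rw [osc_eq, osc_eq, ← Complex.exp_conj, map_mul, Complex.conj_ofReal, Complex.conj_I]
  congr 1; push_cast; ring

@[fun_prop] theorem continuous_osc : Continuous osc := by unfold osc; fun_prop

theorem norm_osc_sub_one_le (t : ℝ) : ‖osc t - 1‖ ≤ 2 * Real.pi * |t| := by
  have h := Real.norm_exp_I_mul_ofReal_sub_one_le (x := 2 * Real.pi * t)
  rw [osc_eq, mul_comm _ Complex.I]
  refine h.trans (le_of_eq ?_)
  rw [Real.norm_eq_abs, abs_mul, abs_of_pos (by positivity)]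

theorem hasDerivAt_osc (t : ℝ) : HasDerivAt osc (2 * Real.pi * Complex.I * osc t) t := by
  have h : HasDerivAt (fun t : ℝ => 2 * (Real.pi : ℂ) * Complex.I * (t : ℂ))
      (2 * (Real.pi : ℂ) * Complex.I) t := by
    simpa using (Complex.ofRealCLM.hasDerivAt (x := t)).const_mul (2 * (Real.pi : ℂ) * Complex.I)
  refine h.cexp.congr_deriv ?_
  rw [osc]; ring

theorem integrable_mul_osc {α : Type*} [MeasurableSpace α] [TopologicalSpace α]
    [OpensMeasurableSpace α] {μ : Measure α} {f : α → ℂ} (hf : Integrable f μ) {φ : α → ℝ}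
    (hφ : Continuous φ) : Integrable (fun x => f x * osc (φ x)) μ := by
  refine hf.mul_bdd (c := 1) ?_ (Filter.Eventually.of_forall fun x => by simp)
  exact (continuous_osc.comp hφ).aestronglyMeasurable

theorem fourier_eq_osc (f : ℝ → ℂ) (w : ℝ) :
    FourierTransform.fourier f w = ∫ v, f v * osc (-(v * w)) := by
  rw [Real.fourier_real_eq_integral_exp_smul]
  refine integral_congr_ae (Filter.Eventually.of_forall fun v => ?_)
  simp only [smul_eq_mul, osc_eq]
  rw [mul_comm]; congr 3; push_cast; ring

theorem fourierInv_eq_osc (f : ℝ → ℂ) (w : ℝ) :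
    FourierTransformInv.fourierInv f w = ∫ v, f v * osc (v * w) := by
  rw [Real.fourierInv_eq_fourier_neg, fourier_eq_osc]; simp

/-- A bound by every negative power of `1 + |x|`. -/
def RapidDecay (f : ℝ → ℂ) : Prop :=
  ∀ m : ℕ, ∃ C : ℝ, 0 < C ∧ ∀ x, ‖f x‖ ≤ C * ((1 + |x|) ^ m)⁻¹

theorem rapidDecay_schwartz (f : SchwartzMap ℝ ℂ) : RapidDecay f := by
  intro m
  refine ⟨2 ^ m * ((Finset.Iic (m, 0)).sup fun m => SchwartzMap.seminorm ℝ m.1 m.2) f + 1,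
    by positivity, fun x => ?_⟩
  have h := SchwartzMap.one_add_le_sup_seminorm_apply (𝕜 := ℝ) (m := (m, 0)) (k := m) (n := 0)
    le_rfl le_rfl f x
  rw [norm_iteratedFDeriv_zero, Real.norm_eq_abs] at h
  have hp : 0 < (1 + |x|) ^ m := by positivity
  rw [← div_eq_mul_inv, le_div_iff₀ hp]
  linarith [mul_comm ‖f x‖ ((1 + |x|) ^ m)]

theorem exists_schwartz_bump (r : ℝ) (hr : 0 < r) :
    ∃ χ : SchwartzMap ℝ ℂ, ∀ s, |s| ≤ r → χ s = 1 := by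
  let b : ContDiffBump (0 : ℝ) := ⟨r, r + 1, hr, by linarith⟩
  have h1 : HasCompactSupport (fun x => (b x : ℂ)) :=
    b.hasCompactSupport.comp_left (g := fun x : ℝ => (x : ℂ)) (by simp)
  have h2 : ContDiff ℝ (↑(⊤ : ℕ∞)) (fun x => (b x : ℂ)) :=
    Complex.ofRealCLM.contDiff.comp b.contDiff
  refine ⟨h1.toSchwartzMap h2, fun s hs => ?_⟩
  have : b s = 1 := b.one_of_mem_closedBall (by simpa [Real.dist_eq] using hs)
  simp [this]

/-- A rapidly decaying kernel whose Fourier transform equals `1` on `[-r, r]`, so that convolution with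
it reproduces functions with frequencies in `[-r, r]`. -/
theorem exists_reproducing (r : ℝ) (hr : 0 < r) :
    ∃ ψ : ℝ → ℂ, Continuous ψ ∧ Integrable ψ ∧ RapidDecay ψ ∧
      ∀ s, |s| ≤ r → ∫ v, ψ v * osc (-(v * s)) = 1 := by
  obtain ⟨χ, hχ⟩ := exists_schwartz_bump r hr
  refine ⟨FourierTransformInv.fourierInv χ, SchwartzMap.continuous _, SchwartzMap.integrable _,
    rapidDecay_schwartz _, fun s hs => ?_⟩
  rw [← hχ s hs, ← fourier_eq_osc, ← SchwartzMap.fourier_coe]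
  simp

/-- A Schwartz function with Fourier transform `m` supported near the origin, bounded below on the
unit interval. -/
theorem exists_bandlimited :
    ∃ (η m : ℝ → ℂ), Continuous η ∧ Integrable η ∧ RapidDecay η ∧ Continuous m ∧ Integrable m ∧
      (∀ t, 1 / 4 ≤ |t| → m t = 0) ∧ (∀ x, |x| ≤ 1 → 1 / 2 ≤ ‖η x‖) ∧
      (∀ x, η x = ∫ t, m t * osc (t * x)) ∧ (∀ t, m t = ∫ x, η x * osc (-(x * t))) ∧
      ∀ t, 1 / 2 ≤ |t| → ∫ x, (‖η x‖ ^ 2 : ℝ) * osc (x * t) = 0 := by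
  let b : ContDiffBump (0 : ℝ) := ⟨1 / 32, 1 / 16, by norm_num, by norm_num⟩
  let p : ℝ → ℝ := b.normed volume
  have h1 : HasCompactSupport (fun x => (p x : ℂ)) :=
    b.hasCompactSupport_normed.comp_left (g := fun x : ℝ => (x : ℂ)) (by simp)
  have h2 : ContDiff ℝ (↑(⊤ : ℕ∞)) (fun x => (p x : ℂ)) :=
    Complex.ofRealCLM.contDiff.comp b.contDiff_normed
  let M : SchwartzMap ℝ ℂ := h1.toSchwartzMap h2
  have hM : ∀ x, M x = (p x : ℂ) := fun x => rfl
  have hp0 : ∀ x, 0 ≤ p x := fun x => b.nonneg_normed x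
  have hpz : ∀ t, 1 / 16 ≤ |t| → p t = 0 := fun t ht => by
    have : t ∉ Function.support p := by
      rw [b.support_normed_eq]; simpa [Real.dist_eq, b] using ht
    simpa using this
  have hpi : Integrable p := b.integrable_normed
  let η : SchwartzMap ℝ ℂ := FourierTransformInv.fourierInv M
  have hη : ∀ x, η x = ∫ t, M t * osc (t * x) := fun x => by
    rw [← fourierInv_eq_osc, ← SchwartzMap.fourierInv_coe]
  have hinv : ∀ t, M t = ∫ x, η x * osc (-(x * t)) := fun t => by
    rw [← fourier_eq_osc, ← SchwartzMap.fourier_coe]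
    simp [η]
  refine ⟨η, M, η.continuous, η.integrable, rapidDecay_schwartz η, M.continuous, M.integrable,
    fun t ht => ?_, fun x hx => ?_, hη, hinv, fun t ht => ?_⟩
  · rw [hM, hpz t (by linarith)]; simp
  -- Since `M` has integral `1` and lives near `0`, the bump `η` is close to `1` on `[-1, 1]`.
  · have e1 : ∫ t, M t = 1 := by
      simp only [hM]; rw [integral_complex_ofReal, b.integral_normed]; simp
    have hd : ‖η x - 1‖ ≤ 1 / 2 := by
      calc ‖η x - 1‖ = ‖∫ t, M t * (osc (t * x) - 1)‖ := by
            simp only [mul_sub, mul_one]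
            rw [integral_sub (integrable_mul_osc M.integrable (by fun_prop)) M.integrable, e1, hη]
        _ ≤ ∫ t, p t * (1 / 2) := by
            refine norm_integral_le_of_norm_le (hpi.mul_const _) (Filter.Eventually.of_forall
              fun t => ?_)
            rw [norm_mul, hM, Complex.norm_real, Real.norm_of_nonneg (hp0 t)]
            rcases le_or_gt (1 / 16) |t| with h | h
            · simp [hpz t h]
            · refine mul_le_mul_of_nonneg_left ((norm_osc_sub_one_le _).trans ?_) (hp0 t)
              have : |t * x| ≤ 1 / 16 := by
                rw [abs_mul]; nlinarith [abs_nonneg t, abs_nonneg x]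
              nlinarith [Real.pi_lt_four, Real.pi_pos]
        _ = 1 / 2 := by
            rw [integral_mul_const]; simp only [p]; rw [b.integral_normed]; simp
    have h3 : ‖(1 : ℂ)‖ ≤ ‖η x‖ + ‖η x - 1‖ := by
      calc ‖(1 : ℂ)‖ = ‖η x - (η x - 1)‖ := by congr 1; ring
        _ ≤ _ := norm_sub_le _ _
    rw [norm_one] at h3; linarith
  · -- Parseval turns the integral into a correlation of two functions with disjoint supports.
    have hconj : ∀ x, (starRingEnd ℂ) (η x) = ∫ s, M s * osc (-(s * x)) := fun x => by
      rw [hη, ← integral_conj]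
      refine integral_congr_ae (Filter.Eventually.of_forall fun s => ?_)
      simp [hM, conj_osc]
    have e : ∀ x, ((‖η x‖ ^ 2 : ℝ) : ℂ) * osc (x * t) =
        ∫ s, M s * η x * osc (x * t - s * x) := fun x => by
      have : ((‖η x‖ ^ 2 : ℝ) : ℂ) = (starRingEnd ℂ) (η x) * η x := by
        rw [Complex.conj_mul']; simp
      rw [this, hconj, mul_assoc, ← integral_mul_const]
      refine integral_congr_ae (Filter.Eventually.of_forall fun s => ?_)
      simp only [sub_eq_add_neg, osc_add]; ring
    simp only [e]
    rw [integral_integral_swap]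
    · have : ∀ s, ∫ x, M s * η x * osc (x * t - s * x) = M s * M (s - t) := fun s => by
        rw [hinv (s - t), ← integral_const_mul]
        refine integral_congr_ae (Filter.Eventually.of_forall fun x => ?_)
        simp only [mul_assoc]
        congr 3; ring
      simp only [this]
      have : ∀ s, M s * M (s - t) = 0 := fun s => by
        rcases le_or_gt (1 / 16) |s| with h | h
        · simp [hM, hpz s h]
        · have : 1 / 16 ≤ |s - t| := by
            have := abs_sub_abs_le_abs_sub t s
            rw [abs_sub_comm] at this; linarith
          simp [hM, hpz _ this]
      simp [this]
    · refine integrable_mul_osc ?_ (by fun_prop)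
      simpa [mul_comm, Function.uncurry] using η.integrable.mul_prod M.integrable

/-- The kernel of the one-dimensional Schrödinger evolution with a smooth frequency cutoff decays in
`v`, with polynomial dependence on the time `T`: two integrations by parts. -/
theorem exists_chirp_bound (χ : SchwartzMap ℝ ℂ) :
    ∃ C : ℝ, 0 < C ∧ ∀ T v : ℝ, ‖∫ θ, χ θ * osc (θ * v + θ ^ 2 * T)‖ ≤
      C * (1 + |T|) ^ 2 * ((1 + |v|) ^ 2)⁻¹ := by
  -- `f1` and `f2` are the first two derivatives of `f θ = χ θ * exp (2πi θ² T)`; the second one is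
  -- bounded by `(1 + |T|) ^ 2 * u`, with `u` integrable.
  let D1 := SchwartzMap.derivCLM ℝ ℂ χ
  let D2 := SchwartzMap.derivCLM ℝ ℂ D1
  have hD1 : ∀ x, HasDerivAt χ (D1 x) x := fun x => by
    rw [SchwartzMap.derivCLM_apply]; exact χ.differentiableAt.hasDerivAt
  have hD2 : ∀ x, HasDerivAt D1 (D2 x) x := fun x => by
    rw [SchwartzMap.derivCLM_apply]; exact D1.differentiableAt.hasDerivAt
  let u : ℝ → ℝ := fun θ => ‖D2 θ‖ + 8 * Real.pi * (‖θ‖ ^ 1 * ‖D1 θ‖) +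
    (4 * Real.pi * ‖χ θ‖ + 16 * Real.pi ^ 2 * (‖θ‖ ^ 2 * ‖χ θ‖))
  have hu : Integrable u := ((D2.integrable.norm).add
    ((D1.integrable_pow_mul volume 1).const_mul _)).add
    ((χ.integrable.norm.const_mul _).add ((χ.integrable_pow_mul volume 2).const_mul _))
  have hu0 : ∀ θ, 0 ≤ u θ := fun θ => by positivity
  let v0 : ℝ → ℝ := fun θ => ‖D1 θ‖ + 4 * Real.pi * (‖θ‖ ^ 1 * ‖χ θ‖)
  have hv0 : Integrable v0 := (D1.integrable.norm).add
    ((χ.integrable_pow_mul volume 1).const_mul _)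
  let A := ∫ θ, ‖χ θ‖
  let B := ∫ θ, u θ
  have hA : 0 ≤ A := integral_nonneg fun _ => norm_nonneg _
  have hB : 0 ≤ B := integral_nonneg hu0
  refine ⟨2 * A + B + 1, by positivity, fun T v => ?_⟩
  let c : ℂ := 4 * Real.pi * Complex.I * T
  have hc : ‖c‖ = 4 * Real.pi * |T| := by
    simp [c, abs_of_pos Real.pi_pos]
  let E : ℝ → ℂ := fun θ => osc (θ ^ 2 * T)
  have hE : ∀ θ, HasDerivAt E (c * θ * E θ) θ := fun θ => by
    have h1 : HasDerivAt (fun θ : ℝ => θ ^ 2 * T) (2 * θ * T) θ := by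
      simpa using (hasDerivAt_pow 2 θ).mul_const T
    have h2 := HasDerivAt.scomp θ (hasDerivAt_osc (θ ^ 2 * T)) h1
    refine h2.congr_deriv ?_
    simp only [E, c, Complex.real_smul]; push_cast; ring
  let f : ℝ → ℂ := fun θ => χ θ * E θ
  let f1 : ℝ → ℂ := fun θ => (D1 θ + c * θ * χ θ) * E θ
  let f2 : ℝ → ℂ := fun θ => (D2 θ + 2 * c * θ * D1 θ + (c + c ^ 2 * θ ^ 2) * χ θ) * E θ
  have hf : ∀ θ, HasDerivAt f (f1 θ) θ := fun θ => by
    refine ((hD1 θ).mul (hE θ)).congr_deriv ?_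
    simp only [f1]; ring
  have hid : ∀ θ : ℝ, HasDerivAt (fun θ : ℝ => c * (θ : ℂ)) c θ := fun θ => by
    simpa using (Complex.ofRealCLM.hasDerivAt (x := θ)).const_mul c
  have hf1 : ∀ θ, HasDerivAt f1 (f2 θ) θ := fun θ => by
    refine (((hD2 θ).add ((hid θ).mul (hD1 θ))).mul (hE θ)).congr_deriv ?_
    simp only [f2, Pi.add_apply, Pi.mul_apply]; ring
  have hnE : ∀ θ, ‖E θ‖ = 1 := fun θ => norm_osc _
  have hfi : Integrable f := integrable_mul_osc χ.integrable (by fun_prop)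
  have hf1i : Integrable f1 := by
    refine (hv0.const_mul (1 + |T|)).mono'
      (by fun_prop) (Filter.Eventually.of_forall fun θ => ?_)
    simp only [f1, norm_mul, hnE, mul_one]
    refine (norm_add_le _ _).trans ?_
    rw [norm_mul, norm_mul, hc, Complex.norm_real]
    simp only [v0, pow_one]
    have h1 := mul_nonneg (abs_nonneg T) (norm_nonneg (D1 θ))
    have h2 : 0 ≤ 4 * Real.pi * (‖θ‖ * ‖χ θ‖) := by positivity
    nlinarith
  have hf2b : ∀ θ, ‖f2 θ‖ ≤ (1 + |T|) ^ 2 * u θ := fun θ => by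
    simp only [f2, norm_mul, hnE, mul_one]
    have h1 : ‖2 * c * (θ : ℂ) * D1 θ‖ = 8 * Real.pi * (‖θ‖ * ‖D1 θ‖) * |T| := by
      rw [norm_mul, norm_mul, norm_mul, hc, Complex.norm_real]; norm_num; ring
    have h2 : ‖(c + c ^ 2 * (θ : ℂ) ^ 2) * χ θ‖ ≤
        4 * Real.pi * ‖χ θ‖ * |T| + 16 * Real.pi ^ 2 * (‖θ‖ ^ 2 * ‖χ θ‖) * |T| ^ 2 := by
      rw [norm_mul]
      have : ‖c + c ^ 2 * (θ : ℂ) ^ 2‖ ≤ 4 * Real.pi * |T| + (4 * Real.pi * |T|) ^ 2 * ‖θ‖ ^ 2 := by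
        refine (norm_add_le _ _).trans ?_
        rw [norm_mul (c ^ 2), norm_pow, norm_pow, hc, Complex.norm_real]
      calc _ ≤ _ := mul_le_mul_of_nonneg_right this (norm_nonneg _)
        _ = _ := by ring
    have hT := abs_nonneg T
    have i1 : ‖D2 θ‖ ≤ (1 + |T|) ^ 2 * ‖D2 θ‖ :=
      le_mul_of_one_le_left (norm_nonneg _) (by nlinarith)
    have i2 : 8 * Real.pi * (‖θ‖ * ‖D1 θ‖) * |T| ≤ (1 + |T|) ^ 2 * (8 * Real.pi * (‖θ‖ * ‖D1 θ‖)) := by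
      rw [mul_comm]; gcongr; nlinarith
    have i3 : 4 * Real.pi * ‖χ θ‖ * |T| ≤ (1 + |T|) ^ 2 * (4 * Real.pi * ‖χ θ‖) := by
      rw [mul_comm]; gcongr; nlinarith
    have i4 : 16 * Real.pi ^ 2 * (‖θ‖ ^ 2 * ‖χ θ‖) * |T| ^ 2 ≤
        (1 + |T|) ^ 2 * (16 * Real.pi ^ 2 * (‖θ‖ ^ 2 * ‖χ θ‖)) := by
      rw [mul_comm]; gcongr; linarith
    calc _ ≤ ‖D2 θ‖ + ‖2 * c * (θ : ℂ) * D1 θ‖ + ‖(c + c ^ 2 * (θ : ℂ) ^ 2) * χ θ‖ :=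
          norm_add₃_le
      _ ≤ _ := by simp only [u, pow_one, mul_add]; linarith
  have hf2i : Integrable f2 :=
    (hu.const_mul ((1 + |T|) ^ 2)).mono' (by fun_prop) (Filter.Eventually.of_forall hf2b)
  have hd : deriv f = f1 := funext fun θ => (hf θ).deriv
  have hd1 : deriv f1 = f2 := funext fun θ => (hf1 θ).deriv
  have F1 := Real.fourier_deriv hfi (fun θ => (hf θ).differentiableAt) (by rwa [hd])
  have F2 := Real.fourier_deriv hf1i (fun θ => (hf1 θ).differentiableAt) (by rwa [hd1])
  rw [hd] at F1
  rw [hd1, F1] at F2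
  have hK : ∫ θ, χ θ * osc (θ * v + θ ^ 2 * T) = FourierTransform.fourier f (-v) := by
    rw [fourier_eq_osc]
    refine integral_congr_ae (Filter.Eventually.of_forall fun θ => ?_)
    simp only [f, E, mul_assoc, ← osc_add]
    congr 2; ring
  have b1 : ‖FourierTransform.fourier f (-v)‖ ≤ A := by
    rw [← hK]
    refine norm_integral_le_of_norm_le χ.integrable.norm (Filter.Eventually.of_forall fun θ => ?_)
    rw [norm_mul, norm_osc, mul_one]
  have b2 : (2 * Real.pi * |v|) ^ 2 * ‖FourierTransform.fourier f (-v)‖ ≤ (1 + |T|) ^ 2 * B := by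
    have e : ‖FourierTransform.fourier f2 (-v)‖ =
        (2 * Real.pi * |v|) ^ 2 * ‖FourierTransform.fourier f (-v)‖ := by
      rw [F2]
      simp only [norm_smul, norm_mul, Complex.norm_I, Complex.norm_real, Real.norm_eq_abs,
        abs_of_pos Real.pi_pos, abs_neg, RCLike.norm_ofNat]
      ring
    rw [← e, fourier_eq_osc, ← integral_const_mul]
    refine norm_integral_le_of_norm_le (hu.const_mul _) (Filter.Eventually.of_forall fun θ => ?_)
    rw [norm_mul, norm_osc, mul_one]
    exact hf2b θ
  rw [hK, ← div_eq_mul_inv, le_div_iff₀ (by positivity)]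
  set k := ‖FourierTransform.fourier f (-v)‖
  have hk : 0 ≤ k := norm_nonneg _
  have hT : 1 ≤ (1 + |T|) ^ 2 := by nlinarith [abs_nonneg T]
  have hpi : 1 ≤ Real.pi ^ 2 := by nlinarith [Real.pi_gt_three]
  have h1 : (1 + |v|) ^ 2 ≤ 2 + 2 * |v| ^ 2 := by nlinarith [sq_nonneg (1 - |v|)]
  have h2 : 2 * |v| ^ 2 * k ≤ (1 + |T|) ^ 2 * B := by
    refine le_trans ?_ b2
    refine mul_le_mul_of_nonneg_right ?_ hk
    nlinarith [mul_le_mul_of_nonneg_right hpi (sq_nonneg |v|), sq_nonneg |v|]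
  calc k * (1 + |v|) ^ 2 ≤ k * (2 + 2 * |v| ^ 2) := by gcongr
    _ = 2 * k + 2 * |v| ^ 2 * k := by ring
    _ ≤ 2 * A * (1 + |T|) ^ 2 + (1 + |T|) ^ 2 * B := by
      refine add_le_add ?_ h2
      nlinarith
    _ ≤ (2 * A + B + 1) * (1 + |T|) ^ 2 := by nlinarith

/-! ### Elementary properties of the extension operator -/

theorem extend_eq (a ℓ : ℝ) (g : ℝ → ℂ) (x : ℝ × ℝ) :
    extend a ℓ g x = ∫ ξ in Set.Icc a (a + ℓ), g ξ * osc (ξ * x.1 + ξ ^ 2 * x.2) := rfl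

theorem norm_extend_le (a ℓ : ℝ) (g : ℝ → ℂ) (x : ℝ × ℝ) :
    ‖extend a ℓ g x‖ ≤ ∫ ξ in Set.Icc a (a + ℓ), ‖g ξ‖ := by
  rw [extend_eq]
  refine (norm_integral_le_integral_norm _).trans (le_of_eq ?_)
  simp only [norm_mul, norm_osc, mul_one]

theorem continuous_extend {a ℓ : ℝ} {g : ℝ → ℂ} (hg : IntegrableOn g (Set.Icc a (a + ℓ))) :
    Continuous (extend a ℓ g) := by
  change Continuous fun x : ℝ × ℝ => ∫ ξ in Set.Icc a (a + ℓ), g ξ * osc (ξ * x.1 + ξ ^ 2 * x.2)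
  refine continuous_of_dominated (bound := fun ξ => ‖g ξ‖) (fun x => ?_)
    (fun x => Filter.Eventually.of_forall fun ξ => ?_) hg.norm
    (Filter.Eventually.of_forall fun ξ => ?_)
  · exact (integrable_mul_osc hg (by fun_prop)).aestronglyMeasurable
  · simp
  · fun_prop

theorem extend_eq_interval {a ℓ : ℝ} (hℓ : 0 ≤ ℓ) (g : ℝ → ℂ) (x : ℝ × ℝ) :
    extend a ℓ g x = ∫ ξ in a..(a + ℓ), g ξ * osc (ξ * x.1 + ξ ^ 2 * x.2) := by
  rw [extend_eq, integral_Icc_eq_integral_Ioc, intervalIntegral.integral_of_le (by linarith)]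

theorem extend_sum {a ℓ : ℝ} (hℓ : 0 ≤ ℓ) (n : ℕ) {g : ℝ → ℂ}
    (hg : IntegrableOn g (Set.Icc a (a + n * ℓ))) (x : ℝ × ℝ) :
    extend a (n * ℓ) g x = ∑ k ∈ Finset.range n, extend (a + k * ℓ) ℓ g x := by
  rw [extend_eq_interval (by positivity)]
  have h := intervalIntegral.sum_integral_adjacent_intervals (μ := volume) (n := n)
    (a := fun k : ℕ => a + k * ℓ) (f := fun ξ => g ξ * osc (ξ * x.1 + ξ ^ 2 * x.2)) (fun k hk => by
      rw [intervalIntegrable_iff_integrableOn_Icc_of_le (by gcongr; simp)]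
      refine IntegrableOn.mono_set (integrable_mul_osc hg (by fun_prop)) (Set.Icc_subset_Icc ?_ ?_)
      · have : 0 ≤ k * ℓ := by positivity
        linarith
      · have : ((k + 1 : ℕ) : ℝ) ≤ n := by exact_mod_cast hk
        gcongr)
  simp only [Nat.cast_zero, zero_mul, add_zero] at h
  rw [← h]
  refine Finset.sum_congr rfl fun k _ => ?_
  rw [extend_eq_interval hℓ]
  congr 1; push_cast; ring

theorem extend_translate (a ℓ : ℝ) (g : ℝ → ℂ) (x c : ℝ × ℝ) :
    extend a ℓ g (x + c) = extend a ℓ (fun ξ => g ξ * osc (ξ * c.1 + ξ ^ 2 * c.2)) x := by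
  rw [extend_eq, extend_eq]
  refine integral_congr_ae (Filter.Eventually.of_forall fun ξ => ?_)
  simp only [mul_assoc, ← osc_add, Prod.fst_add, Prod.snd_add]
  congr 2; ring

/-- Affine invariance of the parabola. -/
theorem extend_affine {σ ℓ : ℝ} (hσ : 0 < σ) (hℓ : 0 ≤ ℓ) (a α : ℝ) (g : ℝ → ℂ) (x : ℝ × ℝ) :
    extend (a + σ * α) (σ * ℓ) g x = σ * osc (a * x.1 + a ^ 2 * x.2) *
      extend α ℓ (fun η => g (a + σ * η)) (σ * (x.1 + 2 * a * x.2), σ ^ 2 * x.2) := by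
  rw [extend_eq_interval (by positivity), extend_eq_interval hℓ]
  have h := intervalIntegral.integral_comp_add_mul (a := α) (b := α + ℓ)
    (fun ξ => g ξ * osc (ξ * x.1 + ξ ^ 2 * x.2)) hσ.ne' a
  rw [mul_add, ← add_assoc] at h
  rw [mul_assoc, ← intervalIntegral.integral_const_mul]
  have e : ∀ η, osc (a * x.1 + a ^ 2 * x.2) * (g (a + σ * η) *
      osc (η * (σ * (x.1 + 2 * a * x.2)) + η ^ 2 * (σ ^ 2 * x.2))) =
      g (a + σ * η) * osc ((a + σ * η) * x.1 + (a + σ * η) ^ 2 * x.2) := fun η => by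
    rw [mul_left_comm, ← osc_add]; congr 2; ring
  simp only [e]
  rw [h, Complex.real_smul, ← mul_assoc, Complex.ofReal_inv, mul_inv_cancel₀ (by exact_mod_cast hσ.ne'),
    one_mul]

theorem integrableOn_affine {σ ℓ a α : ℝ} (hσ : 0 < σ) {g : ℝ → ℂ}
    (hg : IntegrableOn g (Set.Icc (a + σ * α) (a + σ * α + σ * ℓ))) :
    IntegrableOn (fun η => g (a + σ * η)) (Set.Icc α (α + ℓ)) := by
  rcases lt_or_ge ℓ 0 with h | h
  · simp [Set.Icc_eq_empty (show ¬ α ≤ α + ℓ by linarith)]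
  rw [← intervalIntegrable_iff_integrableOn_Icc_of_le (by nlinarith)] at hg ⊢
  have h1 := (hg.comp_add_left (c := a)).comp_mul_left (c := σ)
  convert h1 using 1 <;> field_simp <;> ring

@[fun_prop] theorem measurable_enorm_rpow_extend {a ℓ : ℝ} {g : ℝ → ℂ}
    (hg : IntegrableOn g (Set.Icc a (a + ℓ))) (p : ℝ) :
    Measurable fun x => ‖extend a ℓ g x‖ₑ ^ p :=
  ((continuous_extend hg).enorm.measurable).pow_const p

/-! ### Polynomially decaying weights -/

/-- The decaying profile `(1 + |t|)⁻ᵐ`. -/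
def dec (m : ℕ) (t : ℝ) : ℝ := ((1 + |t|) ^ m)⁻¹

theorem dec_pos (m : ℕ) (t : ℝ) : 0 < dec m t := by unfold dec; positivity

theorem dec_le_one (m : ℕ) (t : ℝ) : dec m t ≤ 1 :=
  inv_le_one_of_one_le₀ (one_le_pow₀ (by linarith [abs_nonneg t]))

theorem dec_neg (m : ℕ) (t : ℝ) : dec m (-t) = dec m t := by simp [dec]

theorem dec_add (m n : ℕ) (t : ℝ) : dec (m + n) t = dec m t * dec n t := by
  rw [dec, pow_add, mul_inv]; rfl

theorem dec_anti_left {m n : ℕ} (h : m ≤ n) (t : ℝ) : dec n t ≤ dec m t := by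
  obtain ⟨k, rfl⟩ := Nat.exists_eq_add_of_le h
  rw [dec_add]
  exact mul_le_of_le_one_right (dec_pos _ _).le (dec_le_one _ _)

theorem dec_anti {m : ℕ} {s t : ℝ} (h : |s| ≤ |t|) : dec m t ≤ dec m s := by
  unfold dec; gcongr

theorem dec_shift (m : ℕ) (s t : ℝ) : dec m s ≤ (1 + |t|) ^ m * dec m (s + t) := by
  unfold dec
  rw [← div_eq_mul_inv, le_div_iff₀ (by positivity), inv_mul_le_iff₀ (by positivity), ← mul_pow]
  gcongr
  nlinarith [abs_add_le s t, abs_nonneg s, abs_nonneg t]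

@[fun_prop] theorem continuous_dec (m : ℕ) : Continuous (dec m) := by
  unfold dec
  exact Continuous.inv₀ (by fun_prop) fun t => by positivity

theorem integrable_dec {m : ℕ} (hm : 2 ≤ m) : Integrable (dec m) := by
  have h := integrable_one_add_norm (E := ℝ) (μ := volume) (r := (m : ℝ)) (by
    simp only [Module.finrank_self, Nat.cast_one]
    exact_mod_cast hm)
  refine h.congr (Filter.Eventually.of_forall fun t => ?_)
  simp only [dec, Real.norm_eq_abs]
  rw [Real.rpow_neg (by positivity), Real.rpow_natCast]

theorem lintegral_comp_sub_div {f : ℝ → ℝ≥0∞} (hf : Measurable f) (c : ℝ) {R : ℝ} (hR : 0 < R) :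
    ∫⁻ t, f ((t - c) / R) = ENNReal.ofReal R * ∫⁻ t, f t := by
  have h1 := lintegral_sub_right_eq_self (μ := volume) (fun t => f (t / R)) c
  rw [h1]
  have h2 := Real.map_volume_mul_right (a := R⁻¹) (inv_ne_zero hR.ne')
  rw [inv_inv, abs_of_pos hR] at h2
  rw [← smul_eq_mul, ← lintegral_smul_measure, ← h2, lintegral_map hf (by fun_prop)]
  simp only [div_eq_mul_inv]

/-- The constant does not depend on the order `m ≥ 2`, because `dec` decreases in its order. -/
theorem exists_lintegral_dec_le : ∃ C : ℝ≥0, ∀ (m : ℕ), 2 ≤ m → ∀ (c R : ℝ), 0 < R →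
    ∫⁻ t, ENNReal.ofReal (dec m ((t - c) / R)) ≤ C * ENNReal.ofReal R := by
  have hi := (integrable_dec le_rfl).lintegral_lt_top
  refine ⟨(∫⁻ t, ENNReal.ofReal (dec 2 t)).toNNReal, fun m hm c R hR => ?_⟩
  rw [ENNReal.coe_toNNReal hi.ne, mul_comm, ← lintegral_comp_sub_div (by fun_prop) c hR]
  exact lintegral_mono fun t => ENNReal.ofReal_le_ofReal (dec_anti_left hm _)

/-- The Euclidean length on the plane `ℝ × ℝ`. -/
def rad (x : ℝ × ℝ) : ℝ := Real.sqrt (x.1 ^ 2 + x.2 ^ 2)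

theorem rad_eq_norm (x : ℝ × ℝ) : rad x = ‖(x.1 : ℂ) + x.2 * Complex.I‖ := by
  rw [Complex.norm_add_mul_I]; rfl

theorem rad_nonneg (x : ℝ × ℝ) : 0 ≤ rad x := Real.sqrt_nonneg _

theorem rad_add_le (x y : ℝ × ℝ) : rad (x + y) ≤ rad x + rad y := by
  simp only [rad_eq_norm]
  refine le_trans (le_of_eq ?_) (norm_add_le _ _)
  congr 1; simp only [Prod.fst_add, Prod.snd_add]; push_cast; ring

theorem rad_neg (x : ℝ × ℝ) : rad (-x) = rad x := by simp [rad]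

theorem abs_fst_le_rad (x : ℝ × ℝ) : |x.1| ≤ rad x :=
  Real.abs_le_sqrt (by nlinarith [sq_nonneg x.2])

theorem abs_snd_le_rad (x : ℝ × ℝ) : |x.2| ≤ rad x :=
  Real.abs_le_sqrt (by nlinarith [sq_nonneg x.1])

theorem rad_le (x : ℝ × ℝ) : rad x ≤ |x.1| + |x.2| := by
  refine Real.sqrt_le_iff.2 ⟨by positivity, ?_⟩
  nlinarith [sq_abs x.1, sq_abs x.2, mul_nonneg (abs_nonneg x.1) (abs_nonneg x.2)]

@[fun_prop] theorem continuous_rad : Continuous rad := by unfold rad; fun_prop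

theorem weight_eq (c : ℝ × ℝ) {R : ℝ} (hR : 0 < R) (x : ℝ × ℝ) :
    weight c R x = dec 100 (rad (x - c) / R) := by
  rw [dec, abs_of_nonneg (div_nonneg (rad_nonneg _) hR.le)]; rfl

theorem weight_nonneg (c : ℝ × ℝ) {R : ℝ} (hR : 0 < R) (x : ℝ × ℝ) : 0 ≤ weight c R x := by
  rw [weight_eq c hR]; exact (dec_pos _ _).le

theorem continuous_weight (c : ℝ × ℝ) {R : ℝ} (hR : 0 < R) : Continuous (weight c R) := by
  rw [funext (weight_eq c hR)]; fun_prop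

theorem measurable_weight (c : ℝ × ℝ) {R : ℝ} (hR : 0 < R) :
    Measurable fun x => ENNReal.ofReal (weight c R x) :=
  (continuous_weight c hR).measurable.ennreal_ofReal

/-- The profile changes by a bounded power under a translation. -/
theorem dec_rad_shift (m : ℕ) (x y : ℝ × ℝ) {R : ℝ} (hR : 0 < R) :
    dec m (rad x / R) ≤ (1 + rad y / R) ^ m * dec m (rad (x + y) / R) := by
  unfold dec
  have hx := div_nonneg (rad_nonneg x) hR.le
  have hy := div_nonneg (rad_nonneg y) hR.le
  have hxy := div_nonneg (rad_nonneg (x + y)) hR.le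
  rw [abs_of_nonneg hx, abs_of_nonneg hxy, ← div_eq_mul_inv, le_div_iff₀ (by positivity),
    inv_mul_le_iff₀ (by positivity), ← mul_pow]
  gcongr
  have : rad (x + y) / R ≤ rad x / R + rad y / R := by
    rw [← add_div]; gcongr; exact rad_add_le x y
  nlinarith

theorem weight_shift (c : ℝ × ℝ) {R : ℝ} (hR : 0 < R) (x y : ℝ × ℝ) :
    weight c R x ≤ (1 + rad y / R) ^ 100 * weight c R (x + y) := by
  rw [weight_eq c hR, weight_eq c hR, add_sub_right_comm]
  exact dec_rad_shift 100 (x - c) y hR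

theorem dec_rad_le_mul {m n : ℕ} (x : ℝ × ℝ) {R : ℝ} (hR : 0 < R) :
    dec (m + n) (rad x / R) ≤ dec m (x.1 / R) * dec n (x.2 / R) := by
  rw [dec_add]
  have hx := div_nonneg (rad_nonneg x) hR.le
  refine mul_le_mul (dec_anti ?_) (dec_anti ?_) (dec_pos _ _).le (dec_pos _ _).le
  · rw [abs_of_nonneg hx, abs_div, abs_of_pos hR]; gcongr; exact abs_fst_le_rad x
  · rw [abs_of_nonneg hx, abs_div, abs_of_pos hR]; gcongr; exact abs_snd_le_rad x

theorem lintegral_mul_prod {f g : ℝ → ℝ≥0∞} (hf : Measurable f) (hg : Measurable g) :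
    ∫⁻ x : ℝ × ℝ, f x.1 * g x.2 = (∫⁻ t, f t) * ∫⁻ t, g t :=
  lintegral_prod_mul hf.aemeasurable hg.aemeasurable

theorem exists_lintegral_weight_le : ∃ C : ℝ≥0, ∀ (c : ℝ × ℝ) (R : ℝ), 0 < R →
    ∫⁻ x, ENNReal.ofReal (weight c R x) ≤ C * ENNReal.ofReal (R ^ 2) := by
  obtain ⟨C, hC⟩ := exists_lintegral_dec_le
  refine ⟨C * C, fun c R hR => ?_⟩
  calc ∫⁻ x, ENNReal.ofReal (weight c R x)
      ≤ ∫⁻ x : ℝ × ℝ, ENNReal.ofReal (dec 50 ((x.1 - c.1) / R)) *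
          ENNReal.ofReal (dec 50 ((x.2 - c.2) / R)) := lintegral_mono fun x => by
        rw [weight_eq c hR, ← ENNReal.ofReal_mul (dec_pos _ _).le]
        exact ENNReal.ofReal_le_ofReal (dec_rad_le_mul (m := 50) (n := 50) (x - c) hR)
    _ = _ := lintegral_mul_prod (f := fun t => ENNReal.ofReal (dec 50 ((t - c.1) / R)))
          (g := fun t => ENNReal.ofReal (dec 50 ((t - c.2) / R))) (by fun_prop) (by fun_prop)
    _ ≤ C * ENNReal.ofReal R * (C * ENNReal.ofReal R) :=
        mul_le_mul' (hC _ (by norm_num) _ _ hR) (hC _ (by norm_num) _ _ hR)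
    _ = _ := by rw [sq, ENNReal.ofReal_mul hR.le]; push_cast; ring

/-! ### Local almost orthogonality in `L²` -/

/-- An almost orthogonal expansion: only the terms with `|k - l| ≤ 1` contribute, at most three for
each index. -/
theorem norm_sum_near_diagonal_le (n : ℕ) (c : ℕ → ℕ → ℂ) (d : ℕ → ℝ)
    (hd : ∀ k < n, 0 ≤ d k)
    (hfar : ∀ k < n, ∀ l < n, k + 2 ≤ l ∨ l + 2 ≤ k → c k l = 0)
    (hc : ∀ k < n, ∀ l < n, ‖c k l‖ ≤ (d k + d l) / 2) :
    ‖∑ k ∈ Finset.range n, ∑ l ∈ Finset.range n, c k l‖ ≤ 3 * ∑ k ∈ Finset.range n, d k := by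
  classical
  have card : ∀ k : ℕ, ((Finset.range n).filter fun l => l ≤ k + 1 ∧ k ≤ l + 1).card ≤ 3 := by
    intro k
    calc _ ≤ (Finset.Icc (k - 1) (k + 1)).card := Finset.card_le_card fun l hl => by
          simp only [Finset.mem_filter, Finset.mem_Icc] at hl ⊢; omega
      _ ≤ 3 := by rw [Nat.card_Icc]; omega
  have half : ∀ k ∈ Finset.range n, ∑ l ∈ Finset.range n,
      (if l ≤ k + 1 ∧ k ≤ l + 1 then d k / 2 else 0) ≤ 3 * (d k / 2) := by
    intro k hk
    rw [← Finset.sum_filter, Finset.sum_const, nsmul_eq_mul]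
    have := hd k (Finset.mem_range.1 hk)
    have h3 : (((Finset.range n).filter fun l => l ≤ k + 1 ∧ k ≤ l + 1).card : ℝ) ≤ 3 := by
      exact_mod_cast card k
    gcongr
  calc _ ≤ ∑ k ∈ Finset.range n, ∑ l ∈ Finset.range n, ‖c k l‖ :=
        (norm_sum_le _ _).trans (Finset.sum_le_sum fun k _ => norm_sum_le _ _)
    _ ≤ ∑ k ∈ Finset.range n, ∑ l ∈ Finset.range n,
          ((if l ≤ k + 1 ∧ k ≤ l + 1 then d k / 2 else 0) +
            (if k ≤ l + 1 ∧ l ≤ k + 1 then d l / 2 else 0)) := by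
        refine Finset.sum_le_sum fun k hk => Finset.sum_le_sum fun l hl => ?_
        have hk' := Finset.mem_range.1 hk
        have hl' := Finset.mem_range.1 hl
        by_cases h : l ≤ k + 1 ∧ k ≤ l + 1
        · rw [if_pos h, if_pos h.symm]
          linarith [hc k hk' l hl']
        · rw [if_neg h, if_neg fun h' => h h'.symm, hfar k hk' l hl' (by omega)]
          simp
    _ = (∑ k ∈ Finset.range n, ∑ l ∈ Finset.range n,
          (if l ≤ k + 1 ∧ k ≤ l + 1 then d k / 2 else 0)) +
        ∑ l ∈ Finset.range n, ∑ k ∈ Finset.range n,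
          (if k ≤ l + 1 ∧ l ≤ k + 1 then d l / 2 else 0) := by
        simp only [Finset.sum_add_distrib]; congr 1; exact Finset.sum_comm
    _ ≤ _ := by
        have := Finset.sum_le_sum half
        rw [← Finset.mul_sum] at this
        calc _ ≤ _ := add_le_add this this
          _ = _ := by rw [← Finset.sum_div]; ring

/-- Two functions with frequencies in intervals `S` and `S'` are orthogonal with respect to a
weight whose Fourier transform vanishes on `S - S'`. -/
theorem integral_mul_conj_eq_zero {S S' : Set ℝ} (hS : MeasurableSet S) (hS' : MeasurableSet S')
    {G : ℝ → ℂ} (hG : IntegrableOn G S) (hG' : IntegrableOn G S') {u : ℝ → ℝ} (hu : Integrable u)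
    (h : ∀ ξ ∈ S, ∀ ξ' ∈ S', ∫ x, (u x : ℂ) * osc ((ξ - ξ') * x) = 0) :
    ∫ x, (u x : ℂ) * ((∫ ξ in S, G ξ * osc (ξ * x)) *
      (starRingEnd ℂ) (∫ ξ in S', G ξ * osc (ξ * x))) = 0 := by
  have hc : IntegrableOn (fun ξ => (starRingEnd ℂ) (G ξ)) S' :=
    (Complex.conjCLE : ℂ →L[ℝ] ℂ).integrable_comp hG'
  have e : ∀ x, (u x : ℂ) * ((∫ ξ in S, G ξ * osc (ξ * x)) *
      (starRingEnd ℂ) (∫ ξ in S', G ξ * osc (ξ * x))) =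
      ∫ p, (u x : ℂ) * (G p.1 * (starRingEnd ℂ) (G p.2)) * osc ((p.1 - p.2) * x)
        ∂((volume.restrict S).prod (volume.restrict S')) := by
    intro x
    rw [← integral_conj, ← integral_prod_mul, ← integral_const_mul]
    refine integral_congr_ae (Filter.Eventually.of_forall fun p => ?_)
    simp only [map_mul, conj_osc]
    rw [show (p.1 - p.2) * x = p.1 * x + -(p.2 * x) by ring, osc_add]
    ring
  simp only [e]
  rw [integral_integral_swap]
  · have hz : ∀ᵐ p ∂((volume.restrict S).prod (volume.restrict S')),
        ∫ x, (u x : ℂ) * (G p.1 * (starRingEnd ℂ) (G p.2)) * osc ((p.1 - p.2) * x) = 0 := by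
      rw [Measure.prod_restrict]
      filter_upwards [ae_restrict_mem (hS.prod hS')] with p hp
      have := h p.1 hp.1 p.2 hp.2
      calc _ = ∫ x, (G p.1 * (starRingEnd ℂ) (G p.2)) * ((u x : ℂ) * osc ((p.1 - p.2) * x)) :=
            integral_congr_ae (Filter.Eventually.of_forall fun x => by ring)
        _ = 0 := by rw [integral_const_mul, this, mul_zero]
    rw [integral_congr_ae hz]; simp
  · have hp := (hu.ofReal (𝕜 := ℂ)).mul_prod (hG.mul_prod hc)
    exact integrable_mul_osc hp (φ := fun q : ℝ × ℝ × ℝ => (q.2.1 - q.2.2) * q.1) (by fun_prop)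

theorem lintegral_comp_div_sub {f : ℝ → ℝ≥0∞} (hf : Measurable f) (c : ℝ) {R : ℝ} (hR : 0 < R) :
    ∫⁻ t, f ((c - t) / R) = ENNReal.ofReal R * ∫⁻ t, f t := by
  rw [lintegral_sub_left_eq_self (fun t => f (t / R)) c]
  simpa using lintegral_comp_sub_div hf 0 hR

theorem lintegral_mul_lintegral_swap {α β : Type*} [MeasurableSpace α] [MeasurableSpace β]
    {μ : Measure α} {ν : Measure β} [SFinite μ] [SFinite ν] {Q : α → ℝ≥0∞} {W : β → ℝ≥0∞}
    {U : α → β → ℝ≥0∞} (hQ : Measurable Q) (hW : Measurable W)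
    (hU : Measurable (Function.uncurry U)) :
    ∫⁻ t, W t * ∫⁻ s, Q s * U s t ∂μ ∂ν = ∫⁻ s, Q s * ∫⁻ t, W t * U s t ∂ν ∂μ := by
  have h1 : ∀ t, Measurable fun s => U s t := fun t => hU.comp measurable_prodMk_right
  have h2 : ∀ s, Measurable fun t => U s t := fun s => hU.comp measurable_prodMk_left
  calc _ = ∫⁻ t, ∫⁻ s, W t * (Q s * U s t) ∂μ ∂ν :=
        lintegral_congr fun t => (lintegral_const_mul _ (hQ.mul (h1 t))).symm
    _ = ∫⁻ s, ∫⁻ t, W t * (Q s * U s t) ∂ν ∂μ := by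
        refine lintegral_lintegral_swap (Measurable.aemeasurable ?_)
        exact (hW.comp measurable_fst).mul ((hQ.comp measurable_snd).mul (hU.comp measurable_swap))
    _ = _ := lintegral_congr fun s => by
        refine Eq.trans ?_ (lintegral_const_mul _ (hW.mul (h2 s)))
        exact lintegral_congr fun t => mul_left_comm _ _ _

theorem rapidDecay_mul_integrable {f : ℝ → ℂ} (hf : RapidDecay f) (m : ℕ) :
    ∫⁻ t, ENNReal.ofReal ((1 + |t|) ^ m) * ‖f t‖ₑ < ∞ := by
  obtain ⟨C, hC, h⟩ := hf (m + 2)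
  have hi := ((integrable_dec le_rfl).const_mul C).lintegral_lt_top
  refine lt_of_le_of_lt (lintegral_mono fun t => ?_) hi
  rw [← ofReal_norm, ← ENNReal.ofReal_mul (by positivity)]
  refine ENNReal.ofReal_le_ofReal ?_
  calc (1 + |t|) ^ m * ‖f t‖ ≤ (1 + |t|) ^ m * (C * dec (m + 2) t) := by gcongr; exact h t
    _ = C * dec 2 t * ((1 + |t|) ^ m * dec m t) := by rw [dec_add]; ring
    _ = C * dec 2 t := by
      rw [show (1 + |t|) ^ m * dec m t = 1 from mul_inv_cancel₀ (by positivity), mul_one]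

theorem extend_slice_eq (a ℓ : ℝ) (g : ℝ → ℂ) (s t : ℝ) : extend a ℓ g (s, t) =
    ∫ ξ in Set.Icc a (a + ℓ), (g ξ * osc (ξ ^ 2 * t)) * osc (ξ * s) := by
  rw [extend_eq]
  refine integral_congr_ae (Filter.Eventually.of_forall fun ξ => ?_)
  simp only [mul_assoc, ← osc_add]; congr 2; ring

/-- Almost orthogonality on a horizontal line: the frequency intervals of two pieces that are not
neighbours have distance at least `ℓ ≥ 1 / R`, beyond the band of `‖η (· / R)‖ ^ 2`. -/
theorem lintegral_slice_orthogonal {η : ℝ → ℂ} (hη : Continuous η)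
    (hηi : Integrable fun x => ‖η x‖ ^ 2)
    (hη0 : ∀ t, 1 / 2 ≤ |t| → ∫ x, (‖η x‖ ^ 2 : ℝ) * osc (x * t) = 0)
    {a ℓ R : ℝ} (hℓ : 0 < ℓ) (hR : 0 < R) (hRℓ : 1 ≤ R * ℓ) (n : ℕ) {g : ℝ → ℂ}
    (hg : IntegrableOn g (Set.Icc a (a + n * ℓ))) (t₀ y : ℝ) :
    ∫⁻ s, ‖extend a (n * ℓ) g (s, y)‖ₑ ^ 2 * ‖η ((s - t₀) / R)‖ₑ ^ 2 ≤
      3 * ∑ k ∈ Finset.range n,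
        ∫⁻ s, ‖extend (a + k * ℓ) ℓ g (s, y)‖ₑ ^ 2 * ‖η ((s - t₀) / R)‖ₑ ^ 2 := by
  let u : ℝ → ℝ := fun s => ‖η ((s - t₀) / R)‖ ^ 2
  have hu0 : ∀ s, 0 ≤ u s := fun s => by positivity
  have hui : Integrable u := by
    have := (hηi.comp_div hR.ne').comp_sub_right t₀
    exact this
  have huc : Continuous u := by fun_prop
  have hsub : ∀ k < n, Set.Icc (a + k * ℓ) (a + k * ℓ + ℓ) ⊆ Set.Icc a (a + n * ℓ) := by
    intro k hk
    have h1 : (k : ℝ) + 1 ≤ n := by exact_mod_cast hk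
    refine Set.Icc_subset_Icc ?_ ?_
    · have : 0 ≤ k * ℓ := by positivity
      linarith
    · nlinarith
  have hgk : ∀ k < n, IntegrableOn g (Set.Icc (a + k * ℓ) (a + k * ℓ + ℓ)) := fun k hk =>
    hg.mono_set (hsub k hk)
  let f : ℕ → ℝ → ℂ := fun k s => extend (a + k * ℓ) ℓ g (s, y)
  have hfc : ∀ k < n, Continuous (f k) := fun k hk =>
    (continuous_extend (hgk k hk)).comp (by fun_prop)
  have hint : ∀ k < n, ∀ l < n, Integrable fun s => (u s : ℂ) * (f k s * (starRingEnd ℂ) (f l s)) := by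
    intro k hk l hl
    refine (hui.ofReal (𝕜 := ℂ)).mul_bdd (c := (∫ ξ in Set.Icc (a + k * ℓ) (a + k * ℓ + ℓ), ‖g ξ‖) *
      ∫ ξ in Set.Icc (a + l * ℓ) (a + l * ℓ + ℓ), ‖g ξ‖) ?_ (Filter.Eventually.of_forall fun s => ?_)
    · exact ((hfc k hk).mul (Complex.continuous_conj.comp (hfc l hl))).aestronglyMeasurable
    · rw [norm_mul, RCLike.norm_conj]
      exact mul_le_mul (norm_extend_le _ _ _ _) (norm_extend_le _ _ _ _) (norm_nonneg _)
        ((norm_nonneg _).trans (norm_extend_le (a + k * ℓ) ℓ g (0, y)))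
  have hdiag : ∀ k s, (u s : ℂ) * (f k s * (starRingEnd ℂ) (f k s)) = ((u s * ‖f k s‖ ^ 2 : ℝ) : ℂ) := by
    intro k s; rw [Complex.mul_conj']; push_cast; ring
  have hdi : ∀ k < n, Integrable fun s => u s * ‖f k s‖ ^ 2 := by
    intro k hk
    have := hint k hk k hk
    simp only [hdiag] at this
    exact this.re.congr (Filter.Eventually.of_forall fun s => Complex.ofReal_re _)
  have hfar : ∀ k < n, ∀ l < n, k + 2 ≤ l ∨ l + 2 ≤ k →
      ∫ s, (u s : ℂ) * (f k s * (starRingEnd ℂ) (f l s)) = 0 := by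
    intro k hk l hl hkl
    simp only [f, extend_slice_eq]
    refine integral_mul_conj_eq_zero measurableSet_Icc measurableSet_Icc
      (integrable_mul_osc (hgk k hk) (by fun_prop)) (integrable_mul_osc (hgk l hl) (by fun_prop)) hui
      fun ξ hξ ξ' hξ' => ?_
    have hsep : ℓ ≤ |ξ - ξ'| := by
      rcases hkl with h | h
      · have : (k : ℝ) + 2 ≤ l := by exact_mod_cast h
        rw [abs_sub_comm]
        refine le_trans ?_ (le_abs_self _)
        nlinarith [hξ.2, hξ'.1]
      · have : (l : ℝ) + 2 ≤ k := by exact_mod_cast h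
        refine le_trans ?_ (le_abs_self _)
        nlinarith [hξ'.2, hξ.1]
    have h0 := hη0 (R * (ξ - ξ')) (by
      rw [abs_mul, abs_of_pos hR]; nlinarith [mul_le_mul_of_nonneg_left hsep hR.le])
    let F : ℝ → ℂ := fun x => (‖η x‖ ^ 2 : ℝ) * osc (x * (R * (ξ - ξ')))
    have h1 : ∫ s, F ((s - t₀) / R) = 0 := by
      rw [integral_sub_right_eq_self (fun s => F (s / R)) t₀, Measure.integral_comp_div]
      rw [show ∫ x, F x = 0 from h0, smul_zero]
    have h2 : ∀ s, (u s : ℂ) * osc ((ξ - ξ') * s) = osc ((ξ - ξ') * t₀) * F ((s - t₀) / R) := by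
      intro s
      change (u s : ℂ) * _ = _ * ((u s : ℂ) * _)
      rw [mul_left_comm, ← osc_add]
      congr 2; field_simp; ring
    rw [integral_congr_ae (Filter.Eventually.of_forall h2), integral_const_mul, h1, mul_zero]
  have hmain := norm_sum_near_diagonal_le n
    (fun k l => ∫ s, (u s : ℂ) * (f k s * (starRingEnd ℂ) (f l s)))
    (fun k => ∫ s, u s * ‖f k s‖ ^ 2) (fun k _ => integral_nonneg fun s => by positivity) hfar ?_
  swap
  · intro k hk l hl
    rw [← integral_add (hdi k hk) (hdi l hl), ← integral_div]
    refine norm_integral_le_of_norm_le (((hdi k hk).add (hdi l hl)).div_const _)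
      (Filter.Eventually.of_forall fun s => ?_)
    rw [norm_mul, norm_mul, RCLike.norm_conj, Complex.norm_real, Real.norm_of_nonneg (hu0 s)]
    nlinarith [mul_nonneg (hu0 s) (sq_nonneg (‖f k s‖ - ‖f l s‖))]
  have hsum : ∀ s, extend a (n * ℓ) g (s, y) = ∑ k ∈ Finset.range n, f k s := fun s =>
    extend_sum hℓ.le n hg (s, y)
  have hexp : ∑ k ∈ Finset.range n, ∑ l ∈ Finset.range n,
      ∫ s, (u s : ℂ) * (f k s * (starRingEnd ℂ) (f l s)) =
      ((∫ s, u s * ‖extend a (n * ℓ) g (s, y)‖ ^ 2 : ℝ) : ℂ) := by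
    have e1 : ∀ k ∈ Finset.range n, ∑ l ∈ Finset.range n,
        ∫ s, (u s : ℂ) * (f k s * (starRingEnd ℂ) (f l s)) =
        ∫ s, ∑ l ∈ Finset.range n, (u s : ℂ) * (f k s * (starRingEnd ℂ) (f l s)) := fun k hk =>
      (integral_finsetSum _ fun l hl => hint k (Finset.mem_range.1 hk) l (Finset.mem_range.1 hl)).symm
    rw [Finset.sum_congr rfl e1, ← integral_finsetSum _ fun k hk => integrable_finsetSum _ fun l hl =>
      hint k (Finset.mem_range.1 hk) l (Finset.mem_range.1 hl), ← integral_complex_ofReal]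
    refine integral_congr_ae (Filter.Eventually.of_forall fun s => ?_)
    simp only [hsum]
    push_cast
    rw [← Complex.mul_conj', map_sum, Finset.sum_mul_sum, Finset.mul_sum]
    refine Finset.sum_congr rfl fun k _ => ?_
    rw [Finset.mul_sum]
  rw [hexp, Complex.norm_real, Real.norm_of_nonneg (integral_nonneg fun s => by positivity)] at hmain
  have hconv : ∀ (h : ℝ → ℂ), Integrable (fun s => u s * ‖h s‖ ^ 2) →
      ∫⁻ s, ‖h s‖ₑ ^ 2 * ‖η ((s - t₀) / R)‖ₑ ^ 2 = ENNReal.ofReal (∫ s, u s * ‖h s‖ ^ 2) := by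
    intro h hh
    rw [ofReal_integral_eq_lintegral_ofReal hh (Filter.Eventually.of_forall fun s => by positivity)]
    refine lintegral_congr fun s => ?_
    rw [mul_comm, ENNReal.ofReal_mul (hu0 s), ENNReal.ofReal_pow (norm_nonneg _),
      ENNReal.ofReal_pow (norm_nonneg _), ofReal_norm, ofReal_norm]
  have hFi : Integrable fun s => u s * ‖extend a (n * ℓ) g (s, y)‖ ^ 2 := by
    have hcF : Continuous fun s => extend a (n * ℓ) g (s, y) :=
      (continuous_extend hg).comp (by fun_prop)
    refine hui.mul_bdd (c := (∫ ξ in Set.Icc a (a + n * ℓ), ‖g ξ‖) ^ 2)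
      (hcF.norm.pow 2).aestronglyMeasurable (Filter.Eventually.of_forall fun s => ?_)
    rw [norm_pow, norm_norm]
    gcongr
    exact norm_extend_le _ _ _ _
  rw [hconv _ hFi]
  calc _ ≤ ENNReal.ofReal (3 * ∑ k ∈ Finset.range n, ∫ s, u s * ‖f k s‖ ^ 2) :=
        ENNReal.ofReal_le_ofReal hmain
    _ = _ := by
        rw [ENNReal.ofReal_mul (by norm_num), ENNReal.ofReal_sum_of_nonneg
          fun k _ => integral_nonneg fun s => by positivity]
        congr 1
        · simp
        · exact Finset.sum_congr rfl fun k hk => (hconv _ (hdi k (Finset.mem_range.1 hk))).symm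

/-- On squares of side at least `1 / ℓ` the pieces of an extension with frequency intervals of
length `ℓ` are almost orthogonal. The weight is replaced by its convolution in the first variable
with a band-limited bump. -/
theorem exists_local_orthogonality : ∃ C : ℝ≥0, ∀ (a ℓ R : ℝ), 0 < ℓ → 0 < R → 1 ≤ R * ℓ →
    ∀ (n : ℕ) (g : ℝ → ℂ), IntegrableOn g (Set.Icc a (a + n * ℓ)) → ∀ c : ℝ × ℝ,
    ∫⁻ x, ‖extend a (n * ℓ) g x‖ₑ ^ (2 : ℝ) * ENNReal.ofReal (weight c R x) ≤
      C * ∑ k ∈ Finset.range n,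
        ∫⁻ x, ‖extend (a + k * ℓ) ℓ g x‖ₑ ^ (2 : ℝ) * ENNReal.ofReal (weight c R x) := by
  obtain ⟨η, m, hη, -, hηd, -, -, -, hη1, -, -, hη0⟩ := exists_bandlimited
  obtain ⟨C₁, hC₁, hd1⟩ := hηd 1
  obtain ⟨C₀, hC₀, hd0⟩ := hηd 0
  have hηb : ∀ x, ‖η x‖ ≤ C₀ := fun x => by simpa using hd0 x
  have hηi : Integrable fun x => ‖η x‖ ^ 2 := by
    refine ((integrable_dec le_rfl).const_mul (C₁ ^ 2)).mono'
      (by fun_prop) (Filter.Eventually.of_forall fun x => ?_)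
    rw [Real.norm_of_nonneg (by positivity), dec, ← inv_pow, ← mul_pow]
    have := hd1 x
    rw [pow_one] at this
    gcongr
  let K : ℝ≥0∞ := ∫⁻ t, ENNReal.ofReal ((1 + |t|) ^ 100) * ‖η t‖ₑ ^ 2
  have hK : K ≠ ∞ := by
    refine (lt_of_le_of_lt (b := ENNReal.ofReal C₀ * ∫⁻ t, ENNReal.ofReal ((1 + |t|) ^ 100) * ‖η t‖ₑ)
      ?_ (ENNReal.mul_lt_top ENNReal.ofReal_lt_top (rapidDecay_mul_integrable hηd 100))).ne
    rw [← lintegral_const_mul' _ _ ENNReal.ofReal_ne_top]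
    refine lintegral_mono fun t => ?_
    rw [sq, ← mul_assoc, mul_comm]
    gcongr
    rw [← ofReal_norm]; exact ENNReal.ofReal_le_ofReal (hηb t)
  obtain ⟨A, hA⟩ : ∃ A : ℝ≥0, (A : ℝ≥0∞) = ENNReal.ofReal (2 ^ 102) :=
    ⟨(2 ^ 102 : ℝ).toNNReal, rfl⟩
  refine ⟨A * 3 * K.toNNReal, fun a ℓ R hℓ hR hRℓ n g hg c => ?_⟩
  obtain ⟨W, hW⟩ : ∃ W : ℝ → ℝ → ℝ≥0∞, ∀ s y, W s y = ENNReal.ofReal (weight c R (s, y)) :=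
    ⟨_, fun _ _ => rfl⟩
  have hWc : Measurable fun p : ℝ × ℝ => W p.1 p.2 := by
    simp only [hW]; exact measurable_weight c hR
  obtain ⟨U, hU⟩ : ∃ U : ℝ → ℝ → ℝ≥0∞, ∀ s t, U s t = ‖η ((s - t) / R)‖ₑ ^ 2 :=
    ⟨_, fun _ _ => rfl⟩
  have hUc : Measurable (Function.uncurry U) := by
    have h : Continuous fun p : ℝ × ℝ => η ((p.1 - p.2) / R) := hη.comp (by fun_prop)
    exact (h.enorm.measurable.pow_const 2).comp measurable_id |> fun h' => by
      convert h' using 1; ext p; exact hU _ _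
  have hshift : ∀ s t y, weight c R (s, y) ≤ (1 + |(s - t) / R|) ^ 100 * weight c R (t, y) := by
    intro s t y
    have h := weight_shift c hR (s, y) (t - s, 0)
    have e : rad (t - s, 0) = |s - t| := by simp [rad, Real.sqrt_sq_eq_abs, abs_sub_comm]
    rw [e] at h
    simpa [abs_div, abs_of_pos hR] using h
  -- The weight `W` varies slowly at scale `R`, so it is comparable to its convolution with the
  -- bump `‖η (· / R)‖ ^ 2`: the bounds `hlow` and `hup`. Orthogonality holds exactly for the latter.
  have hlow : ∀ s y, ENNReal.ofReal R * W s y ≤ A * ∫⁻ t, W t y * U s t := by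
    intro s y
    rw [← lintegral_const_mul' _ _ ENNReal.coe_ne_top]
    calc ENNReal.ofReal R * W s y ≤ ∫⁻ t in Set.Icc (s - R) (s + R), W s y := by
          rw [lintegral_const, Measure.restrict_apply_univ, Real.volume_Icc, mul_comm]
          gcongr; linarith
      _ ≤ ∫⁻ t in Set.Icc (s - R) (s + R), A * (W t y * U s t) := by
          refine setLIntegral_mono' measurableSet_Icc fun t ht => ?_
          have ht1 : |(s - t) / R| ≤ 1 := by
            rw [abs_div, abs_of_pos hR, div_le_one hR, abs_le]
            constructor <;> linarith [ht.1, ht.2]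
          have hU4 : ENNReal.ofReal (1 / 4) ≤ U s t := by
            have h := hη1 _ ht1
            rw [hU, ← ofReal_norm, ← ENNReal.ofReal_pow (norm_nonneg _)]
            refine ENNReal.ofReal_le_ofReal ?_
            nlinarith
          have hw : weight c R (s, y) ≤ 2 ^ 100 * weight c R (t, y) := by
            refine (hshift s t y).trans ?_
            have := weight_nonneg c hR (t, y)
            gcongr; linarith
          calc W s y ≤ ENNReal.ofReal (2 ^ 100 * weight c R (t, y)) := by
                rw [hW]; exact ENNReal.ofReal_le_ofReal hw
            _ = (A : ℝ≥0∞) * (W t y * ENNReal.ofReal (1 / 4)) := by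
                simp only [hW]
                rw [hA, ← ENNReal.ofReal_mul (weight_nonneg c hR _),
                  ← ENNReal.ofReal_mul (by norm_num)]
                refine congrArg ENNReal.ofReal ?_
                ring
            _ ≤ _ := by gcongr
      _ ≤ _ := setLIntegral_le_lintegral _ _
  have hup : ∀ s y, ∫⁻ t, W t y * U s t ≤ K * ENNReal.ofReal R * W s y := by
    intro s y
    calc _ ≤ ∫⁻ t, W s y * (ENNReal.ofReal ((1 + |(s - t) / R|) ^ 100) * U s t) := by
          refine lintegral_mono fun t => ?_
          rw [← mul_assoc]
          refine mul_le_mul' ?_ le_rfl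
          simp only [hW]
          rw [← ENNReal.ofReal_mul (weight_nonneg c hR _), mul_comm]
          refine ENNReal.ofReal_le_ofReal ((hshift t s y).trans (le_of_eq ?_))
          rw [abs_div, abs_div, abs_sub_comm]
      _ = _ := by
          simp only [hU]
          rw [lintegral_const_mul' _ _ (by simp [hW]), lintegral_comp_div_sub
            (f := fun t => ENNReal.ofReal ((1 + |t|) ^ 100) * ‖η t‖ₑ ^ 2)
            (by fun_prop) s hR]
          ring
  have hswap : ∀ f : ℝ × ℝ → ℂ, Continuous f → ∫⁻ y, ∫⁻ t, W t y * ∫⁻ s, ‖f (s, y)‖ₑ ^ 2 * U s t =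
      ∫⁻ y, ∫⁻ s, ‖f (s, y)‖ₑ ^ 2 * ∫⁻ t, W t y * U s t := by
    intro f hf
    refine lintegral_congr fun y => ?_
    have hm1 : Measurable fun s => ‖f (s, y)‖ₑ ^ 2 :=
      ((hf.comp (by fun_prop : Continuous fun s : ℝ => (s, y))).enorm.measurable).pow_const 2
    have hm2 : Measurable fun t => W t y := by
      simp only [hW]
      exact (measurable_weight c hR).comp measurable_prodMk_right
    exact lintegral_mul_lintegral_swap hm1 hm2 hUc
  have hprod : ∀ f : ℝ × ℝ → ℂ, Continuous f →
      ∫⁻ x, ‖f x‖ₑ ^ (2 : ℝ) * ENNReal.ofReal (weight c R x) = ∫⁻ y, ∫⁻ s, ‖f (s, y)‖ₑ ^ 2 * W s y := by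
    intro f hf
    have hm : Measurable fun x => ‖f x‖ₑ ^ (2 : ℝ) * ENNReal.ofReal (weight c R x) :=
      (hf.enorm.measurable.pow_const _).mul (measurable_weight c hR)
    have := lintegral_prod_symm (μ := (volume : Measure ℝ)) (ν := (volume : Measure ℝ)) _ hm.aemeasurable
    rw [Measure.volume_eq_prod, this]
    simp only [ENNReal.rpow_ofNat, hW]
  have hgk : ∀ k ∈ Finset.range n, IntegrableOn g (Set.Icc (a + k * ℓ) (a + k * ℓ + ℓ)) := by
    intro k hk
    have h1 : (k : ℝ) + 1 ≤ n := by exact_mod_cast Finset.mem_range.1 hk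
    refine hg.mono_set (Set.Icc_subset_Icc ?_ ?_)
    · have : 0 ≤ k * ℓ := by positivity
      linarith
    · nlinarith
  have hfk : ∀ k ∈ Finset.range n, Continuous (extend (a + k * ℓ) ℓ g) := fun k hk =>
    continuous_extend (hgk k hk)
  have hm0 : ∀ k ∈ Finset.range n, Measurable fun q : (ℝ × ℝ) × ℝ =>
      ‖extend (a + k * ℓ) ℓ g (q.2, q.1.1)‖ₑ ^ 2 * U q.2 q.1.2 := by
    intro k hk
    have h1 := (hfk k hk).comp (by fun_prop : Continuous fun q : (ℝ × ℝ) × ℝ => (q.2, q.1.1))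
    exact (h1.enorm.measurable.pow_const 2).mul (hUc.comp (by fun_prop : Measurable fun q : (ℝ × ℝ) × ℝ => (q.2, q.1.2)))
  have hm1 : ∀ k ∈ Finset.range n, Measurable fun q : ℝ × ℝ =>
      W q.2 q.1 * ∫⁻ s, ‖extend (a + k * ℓ) ℓ g (s, q.1)‖ₑ ^ 2 * U s q.2 := fun k hk =>
    (hWc.comp measurable_swap).mul (hm0 k hk).lintegral_prod_right'
  have hmeas : ∀ k ∈ Finset.range n, ∀ y, AEMeasurable fun t =>
      W t y * (3 * ∫⁻ s, ‖extend (a + k * ℓ) ℓ g (s, y)‖ₑ ^ 2 * U s t) := by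
    intro k hk y
    have := ((hm1 k hk).comp (measurable_prodMk_left (x := y))).const_mul 3
    refine this.aemeasurable.congr (Filter.Eventually.of_forall fun t => ?_)
    simp only [Function.comp]; ring
  have hmeas2 : ∀ k ∈ Finset.range n, AEMeasurable fun y =>
      3 * ∫⁻ t, W t y * ∫⁻ s, ‖extend (a + k * ℓ) ℓ g (s, y)‖ₑ ^ 2 * U s t := fun k hk =>
    ((hm1 k hk).lintegral_prod_right'.const_mul 3).aemeasurable
  have hR0 : ENNReal.ofReal R ≠ 0 := by simpa using hR
  rw [← ENNReal.mul_le_mul_iff_right hR0 ENNReal.ofReal_ne_top]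
  calc ENNReal.ofReal R * ∫⁻ x, ‖extend a (n * ℓ) g x‖ₑ ^ (2 : ℝ) * ENNReal.ofReal (weight c R x)
      = ∫⁻ y, ∫⁻ s, ‖extend a (n * ℓ) g (s, y)‖ₑ ^ 2 * (ENNReal.ofReal R * W s y) := by
        rw [hprod _ (continuous_extend hg), ← lintegral_const_mul' _ _ ENNReal.ofReal_ne_top]
        refine lintegral_congr fun y => ?_
        rw [← lintegral_const_mul' _ _ ENNReal.ofReal_ne_top]
        refine lintegral_congr fun s => ?_
        ring
    _ ≤ ∫⁻ y, ∫⁻ s, ‖extend a (n * ℓ) g (s, y)‖ₑ ^ 2 * (A * ∫⁻ t, W t y * U s t) := by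
        refine lintegral_mono fun y => lintegral_mono fun s => ?_
        exact mul_le_mul' le_rfl (hlow s y)
    _ = A * ∫⁻ y, ∫⁻ t, W t y * ∫⁻ s, ‖extend a (n * ℓ) g (s, y)‖ₑ ^ 2 * U s t := by
        rw [hswap _ (continuous_extend hg), ← lintegral_const_mul' _ _ ENNReal.coe_ne_top]
        refine lintegral_congr fun y => ?_
        rw [← lintegral_const_mul' _ _ ENNReal.coe_ne_top]
        refine lintegral_congr fun s => ?_
        ring
    _ ≤ A * ∫⁻ y, ∫⁻ t, W t y * (3 * ∑ k ∈ Finset.range n,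
          ∫⁻ s, ‖extend (a + k * ℓ) ℓ g (s, y)‖ₑ ^ 2 * U s t) := by
        refine mul_le_mul' le_rfl (lintegral_mono fun y => lintegral_mono fun t => ?_)
        simp only [hU]
        exact mul_le_mul' le_rfl (lintegral_slice_orthogonal hη hηi hη0 hℓ hR hRℓ n hg t y)
    _ = A * 3 * ∑ k ∈ Finset.range n,
          ∫⁻ y, ∫⁻ t, W t y * ∫⁻ s, ‖extend (a + k * ℓ) ℓ g (s, y)‖ₑ ^ 2 * U s t := by
        rw [mul_assoc]
        congr 1
        have hin : ∀ y, ∫⁻ t, W t y * (3 * ∑ k ∈ Finset.range n,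
            ∫⁻ s, ‖extend (a + k * ℓ) ℓ g (s, y)‖ₑ ^ 2 * U s t) = ∑ k ∈ Finset.range n,
            3 * ∫⁻ t, W t y * ∫⁻ s, ‖extend (a + k * ℓ) ℓ g (s, y)‖ₑ ^ 2 * U s t := by
          intro y
          simp only [Finset.mul_sum]
          rw [lintegral_finsetSum' _ fun k hk => hmeas k hk y]
          refine Finset.sum_congr rfl fun k _ => ?_
          rw [← lintegral_const_mul' _ _ (by simp)]
          refine lintegral_congr fun t => ?_
          ring
        simp only [hin]
        rw [lintegral_finsetSum' _ fun k hk => hmeas2 k hk, Finset.mul_sum]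
        refine Finset.sum_congr rfl fun k _ => ?_
        rw [← lintegral_const_mul' _ _ (by simp)]
    _ ≤ A * 3 * ∑ k ∈ Finset.range n, ∫⁻ y, ∫⁻ s, ‖extend (a + k * ℓ) ℓ g (s, y)‖ₑ ^ 2 *
          (K * ENNReal.ofReal R * W s y) := by
        refine mul_le_mul' le_rfl (Finset.sum_le_sum fun k hk => ?_)
        rw [hswap _ (hfk k hk)]
        exact lintegral_mono fun y => lintegral_mono fun s => mul_le_mul' le_rfl (hup s y)
    _ = _ := by
        have : ∀ k ∈ Finset.range n, ∫⁻ y, ∫⁻ s, ‖extend (a + k * ℓ) ℓ g (s, y)‖ₑ ^ 2 *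
            (K * ENNReal.ofReal R * W s y) = K * ENNReal.ofReal R *
            ∫⁻ x, ‖extend (a + k * ℓ) ℓ g x‖ₑ ^ (2 : ℝ) * ENNReal.ofReal (weight c R x) := by
          intro k hk
          have hKR : K * ENNReal.ofReal R ≠ ∞ := ENNReal.mul_ne_top hK ENNReal.ofReal_ne_top
          rw [hprod _ (hfk k hk), ← lintegral_const_mul' _ _ hKR]
          refine lintegral_congr fun y => ?_
          rw [← lintegral_const_mul' _ _ hKR]
          refine lintegral_congr fun s => ?_
          ring
        rw [Finset.sum_congr rfl this, ← Finset.mul_sum]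
        push_cast
        rw [ENNReal.coe_toNNReal hK]
        ring

/-! ### Localisation of an extension in physical space -/

/-- A rapidly decaying bump `η` with Fourier transform `m` supported in `[-1/4, 1/4]`, together with
a kernel `ψ` that reproduces functions with frequencies in `[-1, 1]`. -/
structure Localizer where
  /-- The bump in physical space. -/
  η : ℝ → ℂ
  /-- The Fourier transform of the bump. -/
  m : ℝ → ℂ
  /-- The reproducing kernel. -/
  ψ : ℝ → ℂ
  η_cont : Continuous η
  η_int : Integrable η
  η_decay : RapidDecay η
  m_int : Integrable m
  m_zero : ∀ t, 1 / 4 ≤ |t| → m t = 0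
  η_ge : ∀ x, |x| ≤ 1 → 1 / 2 ≤ ‖η x‖
  η_eq : ∀ x, η x = ∫ t, m t * osc (t * x)
  m_eq : ∀ t, m t = ∫ x, η x * osc (-(x * t))
  ψ_int : Integrable ψ
  ψ_decay : RapidDecay ψ
  ψ_rep : ∀ s, |s| ≤ 1 → ∫ v, ψ v * osc (-(v * s)) = 1

theorem exists_localizer : Nonempty Localizer := by
  obtain ⟨η, m, h1, h2, h3, -, h5, h6, h7, h8, h9, -⟩ := exists_bandlimited
  obtain ⟨ψ, -, k2, k3, k4⟩ := exists_reproducing 1 one_pos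
  exact ⟨⟨η, m, ψ, h1, h2, h3, h5, h6, h7, h8, h9, k2, k3, k4⟩⟩

namespace Localizer

variable (B : Localizer)

/-- The density on the frequency line whose extension at time `y` is `η (s / R)` times the
extension of `g` from `[a, a + ℓ]` at time `y`. -/
def density (R a ℓ : ℝ) (g : ℝ → ℂ) (y ξ : ℝ) : ℂ :=
  osc (-(ξ ^ 2 * y)) * ∫ s, B.η (s / R) * extend a ℓ g (s, y) * osc (-(s * ξ))

/-- The mass of the localised extension at time `y`. -/
def mass (R a ℓ : ℝ) (g : ℝ → ℂ) (y : ℝ) : ℝ := ∫ s, ‖B.η (s / R) * extend a ℓ g (s, y)‖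

variable {B} {R a ℓ : ℝ} {g : ℝ → ℂ}

theorem integrable_slice (hR : 0 < R) (hg : IntegrableOn g (Set.Icc a (a + ℓ))) (y : ℝ) :
    Integrable fun s => B.η (s / R) * extend a ℓ g (s, y) := by
  refine (B.η_int.comp_div hR.ne').mul_bdd (c := ∫ ξ in Set.Icc a (a + ℓ), ‖g ξ‖) ?_
    (Filter.Eventually.of_forall fun s => norm_extend_le _ _ _ _)
  exact ((continuous_extend hg).comp (by fun_prop)).aestronglyMeasurable

theorem norm_density_le (y ξ : ℝ) : ‖B.density R a ℓ g y ξ‖ ≤ B.mass R a ℓ g y := by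
  rw [density, norm_mul, norm_osc, one_mul]
  refine (norm_integral_le_integral_norm _).trans (le_of_eq ?_)
  simp only [mass, norm_mul, norm_osc, mul_one]

theorem mass_nonneg (y : ℝ) : 0 ≤ B.mass R a ℓ g y := integral_nonneg fun _ => norm_nonneg _

theorem integral_η_mul_osc (hR : 0 < R) (t : ℝ) :
    ∫ s, B.η (s / R) * osc (-(s * t)) = R * B.m (R * t) := by
  have h := Measure.integral_comp_div (fun x => B.η x * osc (-(x * (R * t)))) R
  rw [← B.m_eq, abs_of_pos hR] at h
  rw [← Complex.real_smul, ← h]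
  refine integral_congr_ae (Filter.Eventually.of_forall fun s => ?_)
  simp only; congr 3; field_simp

/-- In frequency space, localisation is convolution with the narrow bump `R * m (R * ·)`. -/
theorem density_eq (hR : 0 < R) (hg : IntegrableOn g (Set.Icc a (a + ℓ))) (y ξ : ℝ) :
    B.density R a ℓ g y ξ = ∫ ζ in Set.Icc a (a + ℓ),
      g ζ * (R * B.m (R * (ξ - ζ))) * osc ((ζ ^ 2 - ξ ^ 2) * y) := by
  have e : ∀ s, B.η (s / R) * extend a ℓ g (s, y) * osc (-(s * ξ)) =
      ∫ ζ in Set.Icc a (a + ℓ), B.η (s / R) * g ζ * osc (ζ ^ 2 * y - s * (ξ - ζ)) := by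
    intro s
    rw [extend_slice_eq, mul_right_comm, ← integral_const_mul]
    refine integral_congr_ae (Filter.Eventually.of_forall fun ζ => ?_)
    simp only
    rw [show ζ ^ 2 * y - s * (ξ - ζ) = ζ ^ 2 * y + (ζ * s + -(s * ξ)) by ring, osc_add, osc_add]
    ring
  rw [density]
  simp only [e]
  rw [integral_integral_swap, ← integral_const_mul]
  · refine integral_congr_ae (Filter.Eventually.of_forall fun ζ => ?_)
    simp only
    rw [← integral_η_mul_osc hR, ← integral_const_mul, ← integral_const_mul, ← integral_mul_const]
    refine integral_congr_ae (Filter.Eventually.of_forall fun s => ?_)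
    simp only
    rw [show (ζ ^ 2 - ξ ^ 2) * y = ζ ^ 2 * y + -(ξ ^ 2 * y) by ring, sub_eq_add_neg, osc_add, osc_add]
    ring
  · exact integrable_mul_osc ((B.η_int.comp_div hR.ne').mul_prod hg)
      (φ := fun p : ℝ × ℝ => p.2 ^ 2 * y - p.1 * (ξ - p.2)) (by fun_prop)

theorem density_eq_zero (hR : 0 < R) (hg : IntegrableOn g (Set.Icc a (a + ℓ))) (y : ℝ) {ξ : ℝ}
    (hξ : ∀ ζ ∈ Set.Icc a (a + ℓ), 1 / 4 ≤ R * |ξ - ζ|) : B.density R a ℓ g y ξ = 0 := by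
  rw [density_eq hR hg]
  refine setIntegral_eq_zero_of_forall_eq_zero fun ζ hζ => ?_
  rw [B.m_zero _ (by rw [abs_mul, abs_of_pos hR]; exact hξ ζ hζ)]
  simp

theorem density_eq_zero_of_notMem (hR : 0 < R) (hg : IntegrableOn g (Set.Icc a (a + ℓ))) (y : ℝ)
    {ξ : ℝ} (hξ : ξ ∉ Set.Icc (a - 1 / (4 * R)) (a + ℓ + 1 / (4 * R))) :
    B.density R a ℓ g y ξ = 0 := by
  refine density_eq_zero hR hg y fun ζ hζ => ?_
  have e : R * (1 / (4 * R)) = 1 / 4 := by field_simp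
  rw [← e]
  refine mul_le_mul_of_nonneg_left ?_ hR.le
  rw [Set.mem_Icc, not_and_or, not_le, not_le] at hξ
  rcases hξ with h | h
  · rw [abs_sub_comm]; exact le_trans (by linarith [hζ.1]) (le_abs_self _)
  · exact le_trans (by linarith [hζ.2]) (le_abs_self _)

theorem continuous_density (hR : 0 < R) (hg : IntegrableOn g (Set.Icc a (a + ℓ))) (y : ℝ) :
    Continuous (B.density R a ℓ g y) := by
  change Continuous fun ξ => osc (-(ξ ^ 2 * y)) * ∫ s, B.η (s / R) * extend a ℓ g (s, y) *
    osc (-(s * ξ))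
  refine (by fun_prop : Continuous fun ξ : ℝ => osc (-(ξ ^ 2 * y))).mul ?_
  refine continuous_of_dominated (bound := fun s => ‖B.η (s / R) * extend a ℓ g (s, y)‖)
    (fun ξ => ?_) (fun ξ => Filter.Eventually.of_forall fun s => by simp)
    (integrable_slice hR hg y).norm (Filter.Eventually.of_forall fun s => by fun_prop)
  exact (integrable_mul_osc (integrable_slice hR hg y) (by fun_prop)).aestronglyMeasurable

theorem integrable_density (hR : 0 < R) (hg : IntegrableOn g (Set.Icc a (a + ℓ))) (y : ℝ) :
    Integrable (B.density R a ℓ g y) := by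
  refine (continuous_density hR hg y).integrable_of_hasCompactSupport ?_
  exact HasCompactSupport.intro isCompact_Icc fun ξ hξ => density_eq_zero_of_notMem hR hg y hξ

theorem density_sum (hR : 0 < R) (hℓ : 0 ≤ ℓ) (n : ℕ)
    (hg : IntegrableOn g (Set.Icc a (a + n * ℓ)))
    (hk : ∀ k < n, IntegrableOn g (Set.Icc (a + k * ℓ) (a + k * ℓ + ℓ))) (y ξ : ℝ) :
    B.density R a (n * ℓ) g y ξ = ∑ k ∈ Finset.range n, B.density R (a + k * ℓ) ℓ g y ξ := by
  simp only [density, ← Finset.mul_sum]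
  rw [← integral_finsetSum _ fun k hk' => integrable_mul_osc
    (integrable_slice hR (hk k (Finset.mem_range.1 hk')) y) (by fun_prop)]
  congr 1
  refine integral_congr_ae (Filter.Eventually.of_forall fun s => ?_)
  simp only
  rw [extend_sum hℓ n hg, Finset.mul_sum, Finset.sum_mul]

/-- The kernel `ψ`, rescaled to length `R`, reproduces oscillations of frequency at most `1 / R`. -/
theorem integral_ψ_mul_osc (hR : 0 < R) (t : ℝ) {s : ℝ} (hs : |R * s| ≤ 1) :
    ∫ y, ((R : ℂ)⁻¹ * B.ψ ((t - y) / R)) * osc (s * y) = osc (s * t) := by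
  have hRc : (R : ℂ) ≠ 0 := by exact_mod_cast hR.ne'
  let F : ℝ → ℂ := fun v => ((R : ℂ)⁻¹ * B.ψ (v / R)) * osc (s * (t - v))
  have e1 : ∫ y, ((R : ℂ)⁻¹ * B.ψ ((t - y) / R)) * osc (s * y) = ∫ y, F (t - y) :=
    integral_congr_ae (Filter.Eventually.of_forall fun y => by simp [F])
  have e2 : ∀ v, F v = ((R : ℂ)⁻¹ * osc (s * t)) *
      (fun w => B.ψ w * osc (-(w * (R * s)))) (v / R) := fun v => by
    simp only [F]
    rw [show s * (t - v) = s * t + -(v / R * (R * s)) by field_simp; ring, osc_add]; ring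
  rw [e1, integral_sub_left_eq_self F]
  simp only [e2]
  rw [integral_const_mul, Measure.integral_comp_div (fun w => B.ψ w * osc (-(w * (R * s)))),
    B.ψ_rep _ hs, abs_of_pos hR,
    Complex.real_smul]
  field_simp

/-- The extension of the localised density from the whole line. -/
def evolve (B : Localizer) (R a ℓ : ℝ) (g : ℝ → ℂ) (y : ℝ) (x : ℝ × ℝ) : ℂ :=
  ∫ ξ, B.density R a ℓ g y ξ * osc (ξ * x.1 + ξ ^ 2 * x.2)

/-- The product of an extension with `η` is a superposition of extensions of localised densities,
because its dependence on the time of localisation is band-limited. -/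
theorem η_mul_extend_eq (hR : 1 ≤ R) (ha : 0 ≤ a) (haℓ : a + ℓ ≤ 1)
    (hg : IntegrableOn g (Set.Icc a (a + ℓ))) (x : ℝ × ℝ) :
    B.η (x.1 / R) * extend a ℓ g x =
      ∫ y, ((R : ℂ)⁻¹ * B.ψ ((x.2 - y) / R)) * B.evolve R a ℓ g y x := by
  have hR0 : 0 < R := by linarith
  have hRc : (R : ℂ) ≠ 0 := by exact_mod_cast hR0.ne'
  -- In the variables `p = (ξ, ζ)`, with `ξ` the frequency after and `ζ` the one before localisation,
  -- the integral over the time `y` acts on the phase `(ζ ^ 2 - ξ ^ 2) * y` only.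
  let μ := (volume : Measure ℝ).prod (volume.restrict (Set.Icc a (a + ℓ)))
  let P : ℝ × ℝ → ℂ := fun p => g p.2 * (R * B.m (R * (p.1 - p.2)))
  have hP : Integrable P μ := by
    have h0 : Integrable (fun p : ℝ × ℝ => (R * B.m (R * p.1)) * g p.2) μ :=
      ((B.m_int.comp_mul_left' hR0.ne').const_mul _).mul_prod hg
    have h1 := (measurePreserving_sub_prod (volume : Measure ℝ)
      (volume.restrict (Set.Icc a (a + ℓ))))
    exact h1.integrable_comp_of_integrable h0 |>.congr
      (Filter.Eventually.of_forall fun p => by simp only [Function.comp, P]; ring)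
  have hψ : Integrable fun y => (R : ℂ)⁻¹ * B.ψ ((x.2 - y) / R) := by
    have := (B.ψ_int.comp_div hR0.ne').comp_sub_left x.2
    exact this.const_mul _
  have e1 : ∀ y, ((R : ℂ)⁻¹ * B.ψ ((x.2 - y) / R)) * B.evolve R a ℓ g y x =
      ∫ p, ((R : ℂ)⁻¹ * B.ψ ((x.2 - y) / R)) * P p *
        osc (p.1 * x.1 + p.1 ^ 2 * x.2 + (p.2 ^ 2 - p.1 ^ 2) * y) ∂μ := by
    intro y
    simp only [mul_assoc]
    rw [integral_const_mul, integral_const_mul]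
    congr 2
    rw [integral_prod _ (integrable_mul_osc hP (by fun_prop)), evolve]
    refine integral_congr_ae (Filter.Eventually.of_forall fun ξ => ?_)
    simp only
    rw [density_eq hR0 hg, ← integral_mul_const]
    refine integral_congr_ae (Filter.Eventually.of_forall fun ζ => ?_)
    simp only [P, osc_add]
    ring
  simp only [e1]
  rw [integral_integral_swap]
  · have e2 : ∀ᵐ p ∂μ, ∫ y, ((R : ℂ)⁻¹ * B.ψ ((x.2 - y) / R)) * P p *
        osc (p.1 * x.1 + p.1 ^ 2 * x.2 + (p.2 ^ 2 - p.1 ^ 2) * y) =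
        P p * osc (p.1 * x.1 + p.2 ^ 2 * x.2) := by
      have hmem : ∀ᵐ p ∂μ, p.2 ∈ Set.Icc a (a + ℓ) :=
        Measure.quasiMeasurePreserving_snd.ae (ae_restrict_mem measurableSet_Icc)
      filter_upwards [hmem] with p hp
      by_cases h : 1 / 4 ≤ |R * (p.1 - p.2)|
      · simp [P, B.m_zero _ h]
      · -- The phase difference in the time variable lies in the band of the kernel `ψ`.
        have hs : |R * (p.2 ^ 2 - p.1 ^ 2)| ≤ 1 := by
          rw [not_le] at h
          have h1 : |p.1 - p.2| ≤ 1 / 4 := by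
            rw [abs_mul, abs_of_pos hR0] at h
            nlinarith [abs_nonneg (p.1 - p.2)]
          have h2 : |p.1 + p.2| ≤ 9 / 4 := by
            rw [abs_le] at h1 ⊢
            constructor <;> linarith [hp.1, hp.2]
          calc |R * (p.2 ^ 2 - p.1 ^ 2)| = |R * (p.1 - p.2)| * |p.1 + p.2| := by
                rw [← abs_mul, ← abs_neg]; congr 1; ring
            _ ≤ 1 / 4 * (9 / 4) := mul_le_mul h.le h2 (abs_nonneg _) (by norm_num)
            _ ≤ 1 := by norm_num
        have := integral_ψ_mul_osc (B := B) hR0 x.2 hs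
        calc _ = ∫ y, P p * osc (p.1 * x.1 + p.1 ^ 2 * x.2) *
              (((R : ℂ)⁻¹ * B.ψ ((x.2 - y) / R)) * osc ((p.2 ^ 2 - p.1 ^ 2) * y)) := by
              refine integral_congr_ae (Filter.Eventually.of_forall fun y => ?_)
              simp only [osc_add]; ring
          _ = _ := by
              rw [integral_const_mul, this, mul_assoc, ← osc_add]
              congr 2; ring
    rw [integral_congr_ae e2, integral_prod_symm _ (integrable_mul_osc hP (by fun_prop)), extend_eq,
      ← integral_const_mul]
    refine integral_congr_ae (Filter.Eventually.of_forall fun ζ => ?_)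
    have e3 : ∀ ξ, P (ξ, ζ) * osc (ξ * x.1 + ζ ^ 2 * x.2) =
        (g ζ * osc (ζ * x.1 + ζ ^ 2 * x.2)) *
          (R * (B.m (R * (ξ - ζ)) * osc (R * (ξ - ζ) * (x.1 / R)))) := by
      intro ξ
      have : ξ * x.1 + ζ ^ 2 * x.2 = (ζ * x.1 + ζ ^ 2 * x.2) + R * (ξ - ζ) * (x.1 / R) := by
        field_simp; ring
      rw [this, osc_add]; simp only [P]; ring
    simp only [e3]
    rw [integral_const_mul, integral_const_mul, integral_sub_right_eq_self
      (fun t => B.m (R * t) * osc (R * t * (x.1 / R))) ζ, Measure.integral_comp_mul_left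
      (fun t => B.m t * osc (t * (x.1 / R))), ← B.η_eq, abs_of_pos (inv_pos.2 hR0),
      Complex.real_smul, Complex.ofReal_inv, mul_inv_cancel_left₀ hRc]
    ring
  · exact integrable_mul_osc (hψ.mul_prod hP) (φ := fun q : ℝ × ℝ × ℝ =>
      q.2.1 * x.1 + q.2.1 ^ 2 * x.2 + (q.2.2 ^ 2 - q.2.1 ^ 2) * q.1) (by fun_prop)

end Localizer

/-! ### Estimates for localised extensions -/

/-- Young's inequality for convolution with an integrable kernel, in sixth powers. -/
theorem lintegral_conv_rpow_le {k f : ℝ → ℝ≥0∞} (hk : Measurable k) (hf : Measurable f) :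
    ∫⁻ x, (∫⁻ s, f s * k (x - s)) ^ (6 : ℝ) ≤ (∫⁻ t, k t) ^ (6 : ℝ) * ∫⁻ s, f s ^ (6 : ℝ) := by
  have hm : Measurable fun p : ℝ × ℝ => k (p.1 - p.2) := hk.comp (by fun_prop)
  calc _ ≤ ∫⁻ x, (∫⁻ t, k t) ^ ((6 : ℝ) - 1) * ∫⁻ s, f s ^ (6 : ℝ) * k (x - s) := by
        refine lintegral_mono fun x => ?_
        have h := lintegral_mul_rpow_le (μ := volume) (p := 6) (by norm_num) hf.aemeasurable
          (k := fun s => k (x - s)) (hk.comp (by fun_prop)).aemeasurable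
        rwa [lintegral_sub_left_eq_self k x] at h
    _ = (∫⁻ t, k t) ^ ((6 : ℝ) - 1) * ∫⁻ s, ∫⁻ x, f s ^ (6 : ℝ) * k (x - s) := by
        rw [lintegral_const_mul, lintegral_lintegral_swap]
        · exact (((hf.comp measurable_snd).pow_const _).mul hm).aemeasurable
        · exact (((hf.comp measurable_snd).pow_const _).mul hm).lintegral_prod_right'
    _ = (∫⁻ t, k t) ^ ((6 : ℝ) - 1) * ((∫⁻ s, f s ^ (6 : ℝ)) * ∫⁻ t, k t) := by
        congr 1
        rw [← lintegral_mul_const _ (hf.pow_const _)]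
        refine lintegral_congr fun s => ?_
        refine (lintegral_const_mul _ (hk.comp (measurable_id.sub_const s))).trans ?_
        exact congrArg _ (lintegral_sub_right_eq_self k s)
    _ = _ := by
        rw [mul_comm (∫⁻ s, f s ^ (6 : ℝ)), ← mul_assoc]
        congr 1
        nth_rw 2 [← ENNReal.rpow_one (∫⁻ t, k t)]
        rw [← ENNReal.rpow_add_of_nonneg _ _ (by norm_num) (by norm_num)]
        norm_num

namespace Localizer

variable {B : Localizer} {R a ℓ : ℝ} {g : ℝ → ℂ}

/-- The localised sixth moment of an extension at time `y`. -/
def energy (B : Localizer) (R a ℓ : ℝ) (g : ℝ → ℂ) (y : ℝ) : ℝ≥0∞ :=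
  ∫⁻ s, ‖extend a ℓ g (s, y)‖ₑ ^ (6 : ℝ) * ‖B.η (s / R)‖ₑ

/-- By Jensen's inequality the mass, which bounds the density pointwise, is controlled by the energy. -/
theorem exists_mass_le (B : Localizer) : ∃ C : ℝ≥0, ∀ (R a ℓ : ℝ) (g : ℝ → ℂ), 0 < R →
    IntegrableOn g (Set.Icc a (a + ℓ)) → ∀ y,
    ENNReal.ofReal (R ^ 2) * ENNReal.ofReal (R⁻¹ * B.mass R a ℓ g y) ^ (6 : ℝ) ≤
      C * (ENNReal.ofReal R * B.energy R a ℓ g y) := by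
  have hI : ∫⁻ t, ‖B.η t‖ₑ ≠ ∞ := B.η_int.2.ne
  refine ⟨(∫⁻ t, ‖B.η t‖ₑ).toNNReal ^ 5, fun R a ℓ g hR hg y => ?_⟩
  rw [ENNReal.coe_pow, ENNReal.coe_toNNReal hI]
  set I := ∫⁻ t, ‖B.η t‖ₑ
  have hmeas : Measurable fun s => ‖extend a ℓ g (s, y)‖ₑ :=
    ((continuous_extend hg).comp (by fun_prop : Continuous fun s : ℝ => (s, y))).enorm.measurable
  have hη : Measurable fun s => ‖B.η (s / R)‖ₑ :=
    (B.η_cont.comp (by fun_prop : Continuous fun s : ℝ => s / R)).enorm.measurable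
  have h1 : ENNReal.ofReal (B.mass R a ℓ g y) = ∫⁻ s, ‖extend a ℓ g (s, y)‖ₑ * ‖B.η (s / R)‖ₑ := by
    rw [mass, ofReal_integral_norm_eq_lintegral_enorm (integrable_slice hR hg y)]
    exact lintegral_congr fun s => by rw [enorm_mul, mul_comm]
  have h2 : ∫⁻ s, ‖B.η (s / R)‖ₑ = ENNReal.ofReal R * I := by
    simpa using lintegral_comp_sub_div (f := fun s => ‖B.η s‖ₑ) B.η_cont.enorm.measurable 0 hR
  have h3 := lintegral_mul_rpow_le (μ := volume) (p := 6) (by norm_num) hmeas.aemeasurable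
    hη.aemeasurable
  rw [← h1, h2, show (6 : ℝ) - 1 = (5 : ℕ) by norm_num, ENNReal.rpow_natCast] at h3
  have hR0 : ENNReal.ofReal R ≠ 0 := by simpa using hR
  have hRt : ENNReal.ofReal R ≠ ∞ := ENNReal.ofReal_ne_top
  rw [ENNReal.ofReal_mul (inv_nonneg.2 hR.le), ENNReal.mul_rpow_of_nonneg _ _ (by norm_num),
    ENNReal.ofReal_inv_of_pos hR, ENNReal.ofReal_pow hR.le]
  set r := ENNReal.ofReal R
  have e6 : r⁻¹ ^ (6 : ℝ) = r⁻¹ ^ 6 := by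
    rw [show (6 : ℝ) = (6 : ℕ) by norm_num, ENNReal.rpow_natCast]
  have hc : r⁻¹ * r = 1 := ENNReal.inv_mul_cancel hR0 hRt
  calc _ ≤ r ^ 2 * (r⁻¹ ^ (6 : ℝ) * ((r * I) ^ 5 * B.energy R a ℓ g y)) := by
        gcongr; exact h3
    _ = (r⁻¹ * r) ^ 6 * (I ^ 5 * (r * B.energy R a ℓ g y)) := by rw [e6]; ring
    _ = _ := by rw [hc]; simp

theorem integrable_density_mul_osc (hR : 0 < R) (hg : IntegrableOn g (Set.Icc a (a + ℓ))) (y : ℝ)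
    (x : ℝ × ℝ) : Integrable fun ξ => B.density R a ℓ g y ξ * osc (ξ * x.1 + ξ ^ 2 * x.2) :=
  integrable_mul_osc (integrable_density hR hg y) (by fun_prop)

/-- Off its interval, a localised density lives on a set of measure at most `1 / R`. -/
theorem norm_setIntegral_density_le (hR : 0 < R)
    (hg : IntegrableOn g (Set.Icc a (a + ℓ))) (y : ℝ) (x : ℝ × ℝ) {S : Set ℝ}
    (hS : MeasurableSet S) (hd : ∀ ξ ∈ S, ξ ≤ a ∨ a + ℓ ≤ ξ) :
    ‖∫ ξ in S, B.density R a ℓ g y ξ * osc (ξ * x.1 + ξ ^ 2 * x.2)‖ ≤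
      R⁻¹ * B.mass R a ℓ g y := by
  let T₁ := Set.Icc (a - 1 / (4 * R)) a
  let T₂ := Set.Icc (a + ℓ) (a + ℓ + 1 / (4 * R))
  have hM := mass_nonneg (B := B) (R := R) (a := a) (ℓ := ℓ) (g := g) y
  have hi : ∀ u v : ℝ, Integrable ((Set.Icc u v).indicator fun _ => B.mass R a ℓ g y) := fun u v =>
    (integrable_indicator_iff measurableSet_Icc).2 (by simp)
  rw [← integral_indicator hS]
  calc _ ≤ ∫ ξ, (T₁.indicator (fun _ => B.mass R a ℓ g y) ξ +
        T₂.indicator (fun _ => B.mass R a ℓ g y) ξ) := by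
        refine norm_integral_le_of_norm_le ((hi _ _).add (hi _ _))
          (Filter.Eventually.of_forall fun ξ => ?_)
        have n1 : 0 ≤ T₁.indicator (fun _ => B.mass R a ℓ g y) ξ :=
          Set.indicator_nonneg (fun _ _ => hM) _
        have n2 : 0 ≤ T₂.indicator (fun _ => B.mass R a ℓ g y) ξ :=
          Set.indicator_nonneg (fun _ _ => hM) _
        by_cases hξ : ξ ∈ S
        swap
        · rw [Set.indicator_of_notMem hξ, norm_zero]; positivity
        rw [Set.indicator_of_mem hξ, norm_mul, norm_osc, mul_one]
        have hb := norm_density_le (B := B) (R := R) (a := a) (ℓ := ℓ) (g := g) y ξ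
        by_cases h : ξ ∈ Set.Icc (a - 1 / (4 * R)) (a + ℓ + 1 / (4 * R))
        · rcases hd ξ hξ with h' | h'
          · rw [Set.indicator_of_mem (show ξ ∈ T₁ from ⟨h.1, h'⟩)]; linarith
          · rw [Set.indicator_of_mem (show ξ ∈ T₂ from ⟨h', h.2⟩)]; linarith
        · rw [density_eq_zero_of_notMem hR hg y h, norm_zero]; positivity
    _ = (1 / (4 * R) + 1 / (4 * R)) * B.mass R a ℓ g y := by
        rw [integral_add (hi _ _) (hi _ _)]
        rw [integral_indicator_const _ measurableSet_Icc, integral_indicator_const _ measurableSet_Icc,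
          Real.volume_real_Icc_of_le (by simp [hR.le]), Real.volume_real_Icc_of_le (by simp [hR.le])]
        simp only [smul_eq_mul]; ring
    _ ≤ _ := by
        gcongr
        rw [← one_div, ← add_div, div_le_div_iff₀ (by positivity) hR]
        linarith

theorem continuous_evolve (hR : 0 < R) (hg : IntegrableOn g (Set.Icc a (a + ℓ))) (y : ℝ) :
    Continuous (B.evolve R a ℓ g y) := by
  change Continuous fun x : ℝ × ℝ => ∫ ξ, B.density R a ℓ g y ξ * osc (ξ * x.1 + ξ ^ 2 * x.2)
  refine continuous_of_dominated (bound := fun ξ => ‖B.density R a ℓ g y ξ‖) (fun x => ?_)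
    (fun x => Filter.Eventually.of_forall fun ξ => by simp) (integrable_density hR hg y).norm
    (Filter.Eventually.of_forall fun ξ => by fun_prop)
  exact (integrable_density_mul_osc hR hg y x).aestronglyMeasurable

/-- The kernel of the evolution by time `t` of functions with frequencies near `[a, a + ℓ]`. -/
def kernel (χ : ℝ → ℂ) (a ℓ u t : ℝ) : ℂ := ∫ ξ, χ ((ξ - a) / ℓ) * osc (ξ * u + ξ ^ 2 * t)

theorem kernel_eq (χ : ℝ → ℂ) (hℓ : 0 < ℓ) (u t : ℝ) : kernel χ a ℓ u t = ℓ * osc (a * u + a ^ 2 * t) *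
    ∫ θ, χ θ * osc (θ * (ℓ * (u + 2 * a * t)) + θ ^ 2 * (ℓ ^ 2 * t)) := by
  let F : ℝ → ℂ := fun v => χ (v / ℓ) * osc ((a + v) * u + (a + v) ^ 2 * t)
  have e1 : kernel χ a ℓ u t = ∫ ξ, F (ξ - a) :=
    integral_congr_ae (Filter.Eventually.of_forall fun ξ => by simp [F])
  have e2 : ∀ v, F v = (fun θ => χ θ * osc ((a + ℓ * θ) * u + (a + ℓ * θ) ^ 2 * t)) (v / ℓ) := by
    intro v; simp only [F]; rw [mul_div_cancel₀ _ hℓ.ne']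
  rw [e1, integral_sub_right_eq_self F, funext e2, Measure.integral_comp_div (fun θ => χ θ *
    osc ((a + ℓ * θ) * u + (a + ℓ * θ) ^ 2 * t)), abs_of_pos hℓ, Complex.real_smul, mul_assoc]
  refine congrArg (fun z : ℂ => (ℓ : ℂ) * z) ?_
  rw [← integral_const_mul]
  refine integral_congr_ae (Filter.Eventually.of_forall fun θ => ?_)
  simp only
  rw [mul_left_comm, ← osc_add]; congr 2; ring

/-- The evolution is convolution with `kernel`: the cutoff `χ` equals `1` on the support of the
density. -/
theorem evolve_eq_conv {χ : SchwartzMap ℝ ℂ} (hχ : ∀ s, |s| ≤ 2 → χ s = 1) (hR : 0 < R)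
    (hℓ : 0 < ℓ) (hℓR : 1 ≤ R * ℓ) (hg : IntegrableOn g (Set.Icc a (a + ℓ))) (y : ℝ) (x : ℝ × ℝ) :
    B.evolve R a ℓ g y x =
      ∫ s, (B.η (s / R) * extend a ℓ g (s, y)) * kernel χ a ℓ (x.1 - s) (x.2 - y) := by
  have hχi : Integrable fun ξ => χ ((ξ - a) / ℓ) :=
    (χ.integrable.comp_div hℓ.ne').comp_sub_right a
  have e1 : ∀ ξ, B.density R a ℓ g y ξ * osc (ξ * x.1 + ξ ^ 2 * x.2) =
      ∫ s, χ ((ξ - a) / ℓ) * (B.η (s / R) * extend a ℓ g (s, y)) *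
        osc (ξ * (x.1 - s) + ξ ^ 2 * (x.2 - y)) := by
    intro ξ
    have hcut : B.density R a ℓ g y ξ = χ ((ξ - a) / ℓ) * B.density R a ℓ g y ξ := by
      by_cases h : ξ ∈ Set.Icc (a - 1 / (4 * R)) (a + ℓ + 1 / (4 * R))
      · rw [hχ, one_mul]
        have : 1 / (4 * R) ≤ ℓ := by
          rw [div_le_iff₀ (by positivity)]; nlinarith
        rw [abs_div, abs_of_pos hℓ, div_le_iff₀ hℓ, abs_le]
        constructor <;> linarith [h.1, h.2]
      · rw [density_eq_zero_of_notMem hR hg y h, mul_zero]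
    rw [hcut, density, mul_assoc, mul_right_comm, ← osc_add, ← integral_const_mul,
      ← integral_const_mul]
    refine integral_congr_ae (Filter.Eventually.of_forall fun s => ?_)
    simp only
    rw [show ξ * (x.1 - s) + ξ ^ 2 * (x.2 - y) =
      (-(ξ ^ 2 * y) + (ξ * x.1 + ξ ^ 2 * x.2)) + -(s * ξ) by ring, osc_add _ (-(s * ξ))]
    ring
  rw [evolve]
  simp only [e1]
  rw [integral_integral_swap]
  · refine integral_congr_ae (Filter.Eventually.of_forall fun s => ?_)
    simp only [kernel]
    rw [← integral_const_mul]
    refine integral_congr_ae (Filter.Eventually.of_forall fun ξ => ?_)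
    simp only; ring
  · exact integrable_mul_osc (hχi.mul_prod (integrable_slice hR hg y))
      (φ := fun p : ℝ × ℝ => p.1 * (x.1 - p.2) + p.1 ^ 2 * (x.2 - y)) (by fun_prop)

/-- The evolution spreads `L⁶` norms by at most a power of the elapsed time. -/
theorem exists_lintegral_evolve_le (B : Localizer) : ∃ C : ℝ≥0, ∀ (R a ℓ : ℝ) (g : ℝ → ℂ),
    0 < ℓ → ℓ ≤ 1 → R * ℓ ^ 2 = 1 → IntegrableOn g (Set.Icc a (a + ℓ)) → ∀ y,
    ∫⁻ x, ‖B.evolve R a ℓ g y x‖ₑ ^ (6 : ℝ) * ENNReal.ofReal (weight 0 R x) ≤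
      C * (ENNReal.ofReal ((1 + |y / R|) ^ 12) * (ENNReal.ofReal R * B.energy R a ℓ g y)) := by
  obtain ⟨χ, hχ⟩ := exists_schwartz_bump 2 (by norm_num)
  obtain ⟨C₁, hC₁, hK⟩ := exists_chirp_bound χ
  obtain ⟨C₂, hC₂⟩ := exists_lintegral_dec_le
  obtain ⟨C₀, hC₀, hd0⟩ := B.η_decay 0
  have hηb : ∀ x, ‖B.η x‖ₑ ≤ ENNReal.ofReal C₀ := fun x => by
    rw [← ofReal_norm]; exact ENNReal.ofReal_le_ofReal (by simpa using hd0 x)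
  refine ⟨(C₁.toNNReal * C₂) ^ 6 * C₀.toNNReal ^ 5 * C₂, fun R a ℓ g hℓ hℓ1 hRℓ hg y => ?_⟩
  have hR : 0 < R := by
    by_contra h; nlinarith [sq_nonneg ℓ, mul_nonneg (neg_nonneg.2 (not_lt.1 h)) (sq_nonneg ℓ)]
  have hRℓ' : 1 ≤ R * ℓ := by nlinarith [mul_pos hR hℓ]
  -- On each horizontal line: Young's inequality, the kernel having mass at most `C (1 + |τ|) ^ 2` at
  -- the rescaled time `τ`.
  have slice : ∀ t, ∫⁻ s, ‖B.evolve R a ℓ g y (s, t)‖ₑ ^ (6 : ℝ) ≤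
      ((C₁.toNNReal * C₂) ^ 6 * C₀.toNNReal ^ 5 : ℝ≥0) *
      (ENNReal.ofReal ((1 + |(t - y) / R|) ^ 12) * B.energy R a ℓ g y) := by
    intro t
    let τ := (t - y) / R
    have hτ : ℓ ^ 2 * (t - y) = τ := by
      simp only [τ]; rw [eq_div_iff hR.ne']; linear_combination (t - y) * hRℓ
    let k : ℝ → ℝ≥0∞ := fun u => ENNReal.ofReal (C₁ * (1 + |τ|) ^ 2 * ℓ) *
      ENNReal.ofReal (dec 2 ((u - -(2 * a * (t - y))) / ℓ⁻¹))
    let f : ℝ → ℝ≥0∞ := fun s => ‖B.η (s / R) * extend a ℓ g (s, y)‖ₑ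
    have hf : Measurable f := ((B.η_cont.comp (by fun_prop)).mul
      ((continuous_extend hg).comp (by fun_prop))).enorm.measurable
    have hk : Measurable k := by
      simp only [k]; exact Measurable.const_mul (by fun_prop) _
    have hkb : ∀ u, ‖kernel χ a ℓ u (t - y)‖ₑ ≤ k u := fun u => by
      rw [kernel_eq _ hℓ, ← ofReal_norm, norm_mul, norm_mul, norm_osc, mul_one, Complex.norm_real,
        Real.norm_of_nonneg hℓ.le, hτ]
      simp only [k]
      rw [← ENNReal.ofReal_mul (by positivity)]
      refine ENNReal.ofReal_le_ofReal ?_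
      have h := mul_le_mul_of_nonneg_left (hK τ (ℓ * (u + 2 * a * (t - y)))) hℓ.le
      refine h.trans (le_of_eq ?_)
      rw [dec, div_inv_eq_mul, sub_neg_eq_add, mul_comm _ ℓ]
      ring_nf
    have hkI : ∫⁻ u, k u ≤ ENNReal.ofReal ((1 + |τ|) ^ 2) * (C₁.toNNReal * C₂ : ℝ≥0) := by
      simp only [k]
      rw [lintegral_const_mul' _ _ ENNReal.ofReal_ne_top]
      calc _ ≤ ENNReal.ofReal (C₁ * (1 + |τ|) ^ 2 * ℓ) * (C₂ * ENNReal.ofReal ℓ⁻¹) :=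
            mul_le_mul' le_rfl (hC₂ 2 le_rfl _ _ (inv_pos.2 hℓ))
        _ = _ := by
            have : ENNReal.ofReal ℓ * ENNReal.ofReal ℓ⁻¹ = 1 := by
              rw [← ENNReal.ofReal_mul hℓ.le, mul_inv_cancel₀ hℓ.ne', ENNReal.ofReal_one]
            rw [ENNReal.ofReal_mul (by positivity), ENNReal.ofReal_mul hC₁.le]
            push_cast
            change ENNReal.ofReal C₁ * _ * _ * _ = _ * (ENNReal.ofReal C₁ * _)
            calc _ = ENNReal.ofReal ((1 + |τ|) ^ 2) * (ENNReal.ofReal C₁ * C₂) *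
                  (ENNReal.ofReal ℓ * ENNReal.ofReal ℓ⁻¹) := by ring
              _ = _ := by rw [this, mul_one]
    calc _ ≤ ∫⁻ s, (∫⁻ r, f r * k (s - r)) ^ (6 : ℝ) := by
          refine lintegral_mono fun s => ENNReal.rpow_le_rpow ?_ (by norm_num)
          rw [evolve_eq_conv hχ hR hℓ hRℓ' hg]
          refine (enorm_integral_le_lintegral_enorm _).trans (lintegral_mono fun r => ?_)
          rw [enorm_mul]
          exact mul_le_mul' le_rfl (hkb _)
      _ ≤ _ := lintegral_conv_rpow_le hk hf
      _ ≤ (ENNReal.ofReal ((1 + |τ|) ^ 2) * (C₁.toNNReal * C₂ : ℝ≥0)) ^ (6 : ℝ) *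
          ((C₀.toNNReal ^ 5 : ℝ≥0) * B.energy R a ℓ g y) := by
          refine mul_le_mul' (ENNReal.rpow_le_rpow hkI (by norm_num)) ?_
          rw [energy, ← lintegral_const_mul' _ _ ENNReal.coe_ne_top]
          refine lintegral_mono fun s => ?_
          simp only [f]
          rw [enorm_mul, ENNReal.mul_rpow_of_nonneg _ _ (by norm_num), mul_comm, mul_left_comm]
          refine mul_le_mul' le_rfl ?_
          rw [show (6 : ℝ) = (6 : ℕ) by norm_num, ENNReal.rpow_natCast, pow_succ, ENNReal.coe_pow]
          gcongr
          exact hηb _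
      _ = _ := by
          rw [show (6 : ℝ) = (6 : ℕ) by norm_num, ENNReal.rpow_natCast, mul_pow,
            ← ENNReal.ofReal_pow (by positivity), ← pow_mul]
          push_cast
          ring
  have hm : Measurable fun x => ‖B.evolve R a ℓ g y x‖ₑ ^ (6 : ℝ) * ENNReal.ofReal (weight 0 R x) :=
    ((continuous_evolve hR hg y).enorm.measurable.pow_const _).mul (measurable_weight 0 hR)
  rw [Measure.volume_eq_prod, lintegral_prod_symm _ hm.aemeasurable]
  set A : ℝ≥0 := (C₁.toNNReal * C₂) ^ 6 * C₀.toNNReal ^ 5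
  calc _ ≤ ∫⁻ t, ENNReal.ofReal (dec 100 (t / R)) * ∫⁻ s, ‖B.evolve R a ℓ g y (s, t)‖ₑ ^ (6 : ℝ) := by
        refine lintegral_mono fun t => ?_
        rw [← lintegral_const_mul' _ _ ENNReal.ofReal_ne_top]
        refine lintegral_mono fun s => ?_
        rw [mul_comm]
        refine mul_le_mul' (ENNReal.ofReal_le_ofReal ?_) le_rfl
        rw [weight_eq 0 hR, sub_zero]
        refine (dec_rad_le_mul (m := 0) (n := 100) (s, t) hR).trans ?_
        exact mul_le_of_le_one_left (dec_pos _ _).le (dec_le_one _ _)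
    _ ≤ ∫⁻ t, ENNReal.ofReal (dec 88 ((t - 0) / R)) * (A * (ENNReal.ofReal ((1 + |y / R|) ^ 12) *
          B.energy R a ℓ g y)) := by
        refine lintegral_mono fun t => (mul_le_mul' le_rfl (slice t)).trans ?_
        have h : dec 100 (t / R) * (1 + |(t - y) / R|) ^ 12 ≤
            dec 88 ((t - 0) / R) * (1 + |y / R|) ^ 12 := by
          rw [sub_zero, dec_add 88 12, mul_assoc]
          refine mul_le_mul_of_nonneg_left ?_ (dec_pos _ _).le
          rw [dec, inv_mul_le_iff₀ (by positivity), ← mul_pow]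
          gcongr
          rw [sub_div]
          nlinarith [abs_sub (t / R) (y / R), abs_nonneg (t / R), abs_nonneg (y / R)]
        calc _ = A * (ENNReal.ofReal (dec 100 (t / R) * (1 + |(t - y) / R|) ^ 12) *
              B.energy R a ℓ g y) := by
              rw [ENNReal.ofReal_mul (dec_pos _ _).le]; ring
          _ ≤ A * (ENNReal.ofReal (dec 88 ((t - 0) / R) * (1 + |y / R|) ^ 12) *
              B.energy R a ℓ g y) := by gcongr
          _ = _ := by rw [ENNReal.ofReal_mul (dec_pos _ _).le]; ring
    _ ≤ (C₂ * ENNReal.ofReal R) * (A * (ENNReal.ofReal ((1 + |y / R|) ^ 12) *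
          B.energy R a ℓ g y)) := by
        rw [lintegral_mul_const _ (by fun_prop)]
        exact mul_le_mul' (hC₂ 88 (by norm_num) 0 R hR) le_rfl
    _ = _ := by push_cast; ring

end Localizer

/-! ### The linear decoupling constant is finite and bounded below -/

theorem rpow_cubeRoot (y : ℝ≥0∞) : (y ^ (1 / 3 : ℝ)) ^ (3 : ℝ) = y := by
  rw [← ENNReal.rpow_mul]; norm_num

theorem weightedNorm_sq (c : ℝ × ℝ) (R : ℝ) (f : ℝ × ℝ → ℂ) : weightedNorm 6 c R f ^ 2 =
    (∫⁻ x, ‖f x‖ₑ ^ (6 : ℝ) * ENNReal.ofReal (weight c R x)) ^ (1 / 3 : ℝ) := by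
  rw [weightedNorm, ← ENNReal.rpow_natCast, ← ENNReal.rpow_mul]; norm_num

theorem sum_cube_le {ι : Type*} (s : Finset ι) (f : ι → ℝ≥0∞) :
    ∑ i ∈ s, f i ^ (3 : ℝ) ≤ (∑ i ∈ s, f i) ^ (3 : ℝ) := by
  have e : ∀ y : ℝ≥0∞, y ^ (3 : ℝ) = y * y ^ 2 := fun y => by
    rw [show (3 : ℝ) = (3 : ℕ) by norm_num, ENNReal.rpow_natCast]; ring
  simp only [e]
  rw [Finset.sum_mul]
  gcongr with i hi
  exact Finset.single_le_sum (f := f) (fun _ _ => zero_le) hi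

theorem numCells_one (N : ℕ) : numCells 1 (1 / (N : ℝ)) = N := by
  rw [numCells, one_div_one_div, Nat.floor_natCast]

theorem square_subset_ball {c x : ℝ × ℝ} {R : ℝ} (hR : 0 < R) (hx : x ∈ square c R) :
    rad (x - c) / R ≤ 1 := by
  obtain ⟨⟨h1, h2⟩, h3, h4⟩ := hx
  rw [div_le_one hR]
  refine (rad_le _).trans ?_
  have i1 : |(x - c).1| ≤ R / 2 := abs_le.2 ⟨by simp only [Prod.fst_sub]; linarith,
    by simp only [Prod.fst_sub]; linarith⟩
  have i2 : |(x - c).2| ≤ R / 2 := abs_le.2 ⟨by simp only [Prod.snd_sub]; linarith,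
    by simp only [Prod.snd_sub]; linarith⟩
  linarith

theorem measurableSet_square (c : ℝ × ℝ) (R : ℝ) : MeasurableSet (square c R) :=
  measurableSet_Icc.prod measurableSet_Icc

theorem mem_square_comm {c x : ℝ × ℝ} {R : ℝ} : x ∈ square c R ↔ c ∈ square x R := by
  simp only [square, Set.mem_prod, Set.mem_Icc]
  constructor <;> rintro ⟨⟨h1, h2⟩, h3, h4⟩ <;> exact ⟨⟨by linarith, by linarith⟩, by linarith, by linarith⟩

theorem volume_square (c : ℝ × ℝ) {R : ℝ} (hR : 0 < R) :
    volume (square c R) = ENNReal.ofReal (R ^ 2) := by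
  rw [square, Measure.volume_eq_prod, Measure.prod_prod, Real.volume_Icc, Real.volume_Icc,
    ← ENNReal.ofReal_mul (by linarith)]
  congr 1; ring

/-- A weight that is slowly varying at scale `R` is dominated by its averages over squares. -/
theorem exists_average_squares (K : ℝ≥0) : ∃ C : ℝ≥0, ∀ (R : ℝ), 0 < R → ∀ (W f : ℝ × ℝ → ℝ≥0∞),
    Measurable W → Measurable f →
    (∀ x q, W x ≤ K * ENNReal.ofReal ((1 + rad (x - q) / R) ^ 100) * W q) →
    ENNReal.ofReal (R ^ 2) * ∫⁻ x, f x * W x ≤ C * ∫⁻ q, W q * ∫⁻ x in square q R, f x := by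
  refine ⟨K * (2 ^ 100 : ℝ).toNNReal, fun R hR W f hW hf h => ?_⟩
  let U : ℝ × ℝ → ℝ × ℝ → ℝ≥0∞ := fun x q => (square x R).indicator (fun _ => 1) q
  have hset : MeasurableSet {p : (ℝ × ℝ) × (ℝ × ℝ) | p.2 ∈ square p.1 R} := by
    have : {p : (ℝ × ℝ) × (ℝ × ℝ) | p.2 ∈ square p.1 R} =
        {p | p.1.1 - R / 2 ≤ p.2.1} ∩ {p | p.2.1 ≤ p.1.1 + R / 2} ∩
        ({p | p.1.2 - R / 2 ≤ p.2.2} ∩ {p | p.2.2 ≤ p.1.2 + R / 2}) := by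
      ext p; simp only [square, Set.mem_prod, Set.mem_Icc, Set.mem_ofPred_eq, Set.mem_inter_iff]
    rw [this]
    refine ((measurableSet_le ?_ ?_).inter (measurableSet_le ?_ ?_)).inter
      ((measurableSet_le ?_ ?_).inter (measurableSet_le ?_ ?_)) <;> fun_prop
  have hU : Measurable (Function.uncurry U) := by
    have : Function.uncurry U =
        Set.indicator {p : (ℝ × ℝ) × (ℝ × ℝ) | p.2 ∈ square p.1 R} (fun _ => 1) := by
      ext p
      by_cases hp : p.2 ∈ square p.1 R <;> simp [Function.uncurry, U, hp]
    rw [this]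
    exact measurable_const.indicator hset
  have hUc : ∀ x q, U x q = (square q R).indicator (fun _ => 1) x := fun x q => by
    by_cases hx : x ∈ square q R
    · simp [U, hx, mem_square_comm.1 hx]
    · simp [U, hx, mt mem_square_comm.1 hx]
  -- Each point lies in the squares whose centres fill a set of measure `R ^ 2`.
  have hUI : ∀ x, ∫⁻ q, U x q = ENNReal.ofReal (R ^ 2) := fun x => by
    simp only [U]
    rw [lintegral_indicator_const (measurableSet_square x R), one_mul, volume_square x hR]
  have hsw := lintegral_mul_lintegral_swap (μ := (volume : Measure (ℝ × ℝ)))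
    (ν := (volume : Measure (ℝ × ℝ))) hf hW hU
  have e1 : ∀ q, ∫⁻ x, f x * U x q = ∫⁻ x in square q R, f x := fun q => by
    rw [← lintegral_indicator (measurableSet_square q R)]
    refine lintegral_congr fun x => ?_
    rw [hUc]
    by_cases hx : x ∈ square q R <;> simp [hx]
  simp only [e1] at hsw
  rw [hsw, ← lintegral_const_mul' _ _ ENNReal.ofReal_ne_top, ← lintegral_const_mul' _ _
    ENNReal.coe_ne_top]
  refine lintegral_mono fun x => ?_
  rw [mul_left_comm, mul_left_comm (_ : ℝ≥0∞) (f x)]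
  refine mul_le_mul' le_rfl ?_
  rw [← hUI x, ← lintegral_mul_const _ (hU.of_uncurry_left (x := x)), ← lintegral_const_mul' _ _ ENNReal.coe_ne_top]
  refine lintegral_mono fun q => ?_
  by_cases hx : x ∈ square q R
  · have hr := square_subset_ball hR hx
    calc U x q * W x ≤ U x q * (K * ENNReal.ofReal ((1 + rad (x - q) / R) ^ 100) * W q) := by
          gcongr; exact h x q
      _ ≤ U x q * (K * ENNReal.ofReal (2 ^ 100) * W q) := by
          have h0 := div_nonneg (rad_nonneg (x - q)) hR.le
          gcongr; linarith
      _ = _ := by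
          push_cast
          change _ = K * ENNReal.ofReal (2 ^ 100) * _
          ring
  · rw [hUc]; simp [hx]

theorem one_le_weight_on_square : ∃ C : ℝ≥0, ∀ (c : ℝ × ℝ) (R : ℝ), 0 < R → ∀ x ∈ square c R,
    1 ≤ C * ENNReal.ofReal (weight c R x) := by
  refine ⟨(2 ^ 100 : ℝ).toNNReal, fun c R hR x hx => ?_⟩
  change 1 ≤ ENNReal.ofReal (2 ^ 100) * _
  rw [← ENNReal.ofReal_mul (by positivity), ENNReal.one_le_ofReal, weight_eq c hR, dec]
  have hr := square_subset_ball hR hx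
  have h0 := div_nonneg (rad_nonneg (x - c)) hR.le
  rw [abs_of_nonneg h0, ← div_eq_mul_inv, one_le_div (by positivity)]
  gcongr; linarith

theorem integrableOn_piece {N : ℕ} {g : ℝ → ℂ} {a ℓ : ℝ} (hℓ : 0 ≤ ℓ)
    (hg : IntegrableOn g (Set.Icc a (a + N * ℓ))) {k : ℕ} (hk : k < N) :
    IntegrableOn g (Set.Icc (a + k * ℓ) (a + k * ℓ + ℓ)) := by
  have h1 : (k : ℝ) + 1 ≤ N := by exact_mod_cast hk
  refine hg.mono_set (Set.Icc_subset_Icc ?_ ?_)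
  · have : 0 ≤ k * ℓ := by positivity
    linarith
  · nlinarith

theorem lintegral_extend_ne_top {a ℓ : ℝ} {g : ℝ → ℂ} (c : ℝ × ℝ) {R : ℝ} (hR : 0 < R) {p : ℝ}
    (hp : 0 ≤ p) :
    ∫⁻ x, ‖extend a ℓ g x‖ₑ ^ p * ENNReal.ofReal (weight c R x) ≠ ∞ := by
  obtain ⟨C, hC⟩ := exists_lintegral_weight_le
  let M := ENNReal.ofReal (∫ ξ in Set.Icc a (a + ℓ), ‖g ξ‖)
  refine (lt_of_le_of_lt (b := M ^ p * (C * ENNReal.ofReal (R ^ 2))) ?_ ?_).ne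
  · refine le_trans ?_ (mul_le_mul' le_rfl (hC c R hR))
    rw [← lintegral_const_mul' _ _ (ENNReal.rpow_ne_top_of_nonneg hp ENNReal.ofReal_ne_top)]
    refine lintegral_mono fun x => ?_
    gcongr
    rw [← ofReal_norm]
    exact ENNReal.ofReal_le_ofReal (norm_extend_le _ _ _ _)
  · exact ENNReal.mul_lt_top (ENNReal.rpow_lt_top_of_nonneg hp ENNReal.ofReal_ne_top)
      (ENNReal.mul_lt_top ENNReal.coe_lt_top ENNReal.ofReal_lt_top)

/-- The constants admissible in the definition of `linearConst`. -/
def linearSet (N : ℕ) : Set ℝ≥0∞ :=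
  {A | ∀ (g : ℝ → ℂ), IntegrableOn g (Set.Icc 0 1) → ∀ c : ℝ × ℝ,
    ∫⁻ x in square c ((1 / (N : ℝ)) ^ 2)⁻¹, ‖extend 0 1 g x‖ₑ ^ (6 : ℝ) ≤
      A ^ (6 : ℝ) * (∑ k ∈ Finset.range N,
        (∫⁻ x, ‖extend (k * (1 / (N : ℝ))) (1 / (N : ℝ)) g x‖ₑ ^ (6 : ℝ) *
          ENNReal.ofReal (weight c ((1 / (N : ℝ)) ^ 2)⁻¹ x)) ^ (1 / 3 : ℝ)) ^ (3 : ℝ)}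

theorem linearConst_eq (N : ℕ) : linearConst (1 / (N : ℝ)) = sInf (linearSet N) := by
  rw [linearConst, linearSet]
  congr 1
  ext A
  simp only [Set.mem_ofPred_eq, numCells_one, weightedNorm_sq]
  refine forall_congr' fun g => forall_congr' fun _ => forall_congr' fun c => ?_
  rw [one_div (6 : ℝ), ENNReal.rpow_inv_le_iff (by norm_num), ENNReal.mul_rpow_of_nonneg _ _
    (by norm_num), ← ENNReal.rpow_mul _ (1 / 2 : ℝ)]
  norm_num

theorem extend_one_sum {N : ℕ} (hN : 0 < N) {g : ℝ → ℂ} (hg : IntegrableOn g (Set.Icc 0 1))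
    (x : ℝ × ℝ) : extend 0 1 g x =
      ∑ k ∈ Finset.range N, extend (k * (1 / (N : ℝ))) (1 / (N : ℝ)) g x := by
  have hN' : (N : ℝ) ≠ 0 := by positivity
  have h := extend_sum (a := 0) (ℓ := 1 / (N : ℝ)) (by positivity) N (g := g)
    (by rwa [mul_one_div_cancel hN', zero_add]) x
  rw [mul_one_div_cancel hN'] at h
  simpa only [zero_add] using h

theorem integrableOn_piece_one {N : ℕ} (hN : 0 < N) {g : ℝ → ℂ}
    (hg : IntegrableOn g (Set.Icc 0 1)) {k : ℕ} (hk : k < N) :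
    IntegrableOn g (Set.Icc (k * (1 / (N : ℝ))) (k * (1 / (N : ℝ)) + 1 / (N : ℝ))) := by
  have hN' : (N : ℝ) ≠ 0 := by positivity
  simpa using integrableOn_piece (a := 0) (ℓ := 1 / (N : ℝ)) (N := N) (by positivity)
    (by rwa [mul_one_div_cancel hN', zero_add]) hk

/-- The linear decoupling constant is finite, by Hölder's inequality. -/
theorem exists_mem_linearSet {N : ℕ} (hN : 0 < N) : ∃ A ∈ linearSet N, A ≠ ∞ := by
  obtain ⟨C, hC⟩ := one_le_weight_on_square
  have hR : 0 < ((1 / (N : ℝ)) ^ 2)⁻¹ := by positivity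
  refine ⟨(C * (N : ℝ≥0∞) ^ (5 : ℝ)) ^ (6 : ℝ)⁻¹, fun g hg c => ?_, ?_⟩
  · rw [ENNReal.rpow_inv_rpow (by norm_num)]
    refine le_trans ?_ (mul_le_mul' le_rfl (sum_cube_le _ _))
    simp only [rpow_cubeRoot]
    have hm : ∀ k ∈ Finset.range N, Measurable fun x =>
        ‖extend (k * (1 / (N : ℝ))) (1 / (N : ℝ)) g x‖ₑ ^ (6 : ℝ) *
          ENNReal.ofReal (weight c ((1 / (N : ℝ)) ^ 2)⁻¹ x) := fun k hk =>
      (measurable_enorm_rpow_extend (integrableOn_piece_one hN hg (Finset.mem_range.1 hk)) 6).mul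
        (measurable_weight c hR)
    rw [← lintegral_finsetSum' _ fun k hk => (hm k hk).aemeasurable, ← lintegral_const_mul' _ _
      (ENNReal.mul_ne_top ENNReal.coe_ne_top (by simp))]
    refine (setLIntegral_mono' (measurableSet_square _ _) fun x hx => ?_).trans
      (setLIntegral_le_lintegral _ _)
    rw [← Finset.sum_mul]
    calc ‖extend 0 1 g x‖ₑ ^ (6 : ℝ)
        ≤ (∑ k ∈ Finset.range N, ‖extend (k * (1 / (N : ℝ))) (1 / (N : ℝ)) g x‖ₑ) ^ (6 : ℝ) := by
          rw [extend_one_sum hN hg]; gcongr; exact enorm_sum_le _ _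
      _ ≤ (N : ℝ≥0∞) ^ (5 : ℝ) *
            ∑ k ∈ Finset.range N, ‖extend (k * (1 / (N : ℝ))) (1 / (N : ℝ)) g x‖ₑ ^ (6 : ℝ) := by
          refine (ENNReal.rpow_sum_le_const_mul_sum_rpow _ _ (by norm_num)).trans ?_
          rw [Finset.card_range]; norm_num
      _ ≤ (C * ENNReal.ofReal (weight c ((1 / (N : ℝ)) ^ 2)⁻¹ x)) * ((N : ℝ≥0∞) ^ (5 : ℝ) *
            ∑ k ∈ Finset.range N, ‖extend (k * (1 / (N : ℝ))) (1 / (N : ℝ)) g x‖ₑ ^ (6 : ℝ)) :=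
          le_mul_of_one_le_left zero_le (hC c _ hR x hx)
      _ = _ := by ring
  · exact ENNReal.rpow_ne_top_of_nonneg (by norm_num) (ENNReal.mul_ne_top ENNReal.coe_ne_top
      (by simp))

theorem linearConst_ne_top {N : ℕ} (hN : 0 < N) : linearConst (1 / (N : ℝ)) ≠ ∞ := by
  obtain ⟨A, hA, hA'⟩ := exists_mem_linearSet hN
  rw [linearConst_eq]
  exact ne_top_of_le_ne_top hA' (sInf_le hA)

/-- The infimum defining the linear decoupling constant is attained. -/
theorem linearConst_mem {N : ℕ} (hN : 0 < N) : linearConst (1 / (N : ℝ)) ∈ linearSet N := by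
  obtain ⟨A, hA, -⟩ := exists_mem_linearSet hN
  rw [linearConst_eq]
  refine IsClosed.sInf_mem ⟨A, hA⟩ ?_
  simp only [linearSet, Set.ofPred_forall]
  refine isClosed_iInter fun g => isClosed_iInter fun hg => isClosed_iInter fun c => ?_
  refine isClosed_le continuous_const ((ENNReal.continuous_mul_const ?_).comp
    ENNReal.continuous_rpow_const)
  refine ENNReal.rpow_ne_top_of_nonneg (by norm_num) (ENNReal.sum_ne_top.2 fun k _ => ?_)
  exact ENNReal.rpow_ne_top_of_nonneg (by norm_num)
    (lintegral_extend_ne_top c (by positivity) (by norm_num))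

/-- Testing on the indicator function of the first short interval shows that the decoupling
constant is bounded below. -/
theorem exists_one_le_linearConst : ∃ C : ℝ≥0, ∀ N : ℕ, 0 < N →
    1 ≤ C * linearConst (1 / (N : ℝ)) ^ (6 : ℝ) := by
  obtain ⟨C₁, hC₁⟩ := exists_average_squares 1
  obtain ⟨C₂, hC₂⟩ := exists_lintegral_weight_le
  refine ⟨C₁ * C₂, fun N hN => ?_⟩
  have hmem := linearConst_mem hN
  have hfin := linearConst_ne_top hN
  obtain ⟨A, hA⟩ : ∃ A, A = linearConst (1 / (N : ℝ)) := ⟨_, rfl⟩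
  rw [← hA] at hmem hfin ⊢
  obtain ⟨δ, hδ⟩ : ∃ δ : ℝ, δ = 1 / (N : ℝ) := ⟨_, rfl⟩
  have hδ0 : 0 < δ := by rw [hδ]; positivity
  have hδ1 : δ ≤ 1 := by
    rw [hδ, div_le_one (by positivity)]; exact_mod_cast hN
  obtain ⟨R, hRe⟩ : ∃ R : ℝ, R = (δ ^ 2)⁻¹ := ⟨_, rfl⟩
  have hR : 0 < R := by rw [hRe]; positivity
  let g : ℝ → ℂ := (Set.Icc 0 δ).indicator fun _ => 1
  have hgi : Integrable g := by
    rw [integrable_indicator_iff measurableSet_Icc]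
    exact integrableOn_const (by simp)
  let f : ℝ × ℝ → ℝ≥0∞ := fun x => ‖extend 0 δ g x‖ₑ ^ (6 : ℝ)
  have hfc : Continuous f := by
    exact ENNReal.continuous_rpow_const.comp (continuous_extend hgi.integrableOn).enorm
  have hset : ∀ s : Set ℝ, MeasurableSet s → ∀ x : ℝ × ℝ,
      ∫ ξ in s, g ξ * osc (ξ * x.1 + ξ ^ 2 * x.2) =
        ∫ ξ in s ∩ Set.Icc 0 δ, osc (ξ * x.1 + ξ ^ 2 * x.2) := fun s hs x => by
    rw [← setIntegral_indicator measurableSet_Icc]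
    refine setIntegral_congr_fun hs fun ξ _ => ?_
    by_cases h : ξ ∈ Set.Icc 0 δ <;> simp [g, h]
  have e1 : ∀ x, extend 0 1 g x = extend 0 δ g x := fun x => by
    rw [extend_eq, extend_eq, hset _ measurableSet_Icc, hset _ measurableSet_Icc, zero_add,
      zero_add, Set.inter_self, Set.inter_eq_self_of_subset_right (Set.Icc_subset_Icc le_rfl hδ1)]
  have e2 : ∀ k : ℕ, k ≠ 0 → ∀ x, extend (k * δ) δ g x = 0 := fun k hk x => by
    rw [extend_eq, hset _ measurableSet_Icc]
    refine setIntegral_measure_zero _ ?_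
    have : δ ≤ k * δ := le_mul_of_one_le_left hδ0.le (by exact_mod_cast Nat.one_le_iff_ne_zero.2 hk)
    refine measure_mono_null (t := {δ}) (fun ξ hξ => ?_) (by simp)
    exact le_antisymm hξ.2.2 (this.trans hξ.1.1)
  have hkey : ∀ c, ∫⁻ x in square c R, f x ≤
      A ^ (6 : ℝ) * ∫⁻ x, f x * ENNReal.ofReal (weight c R x) := fun c => by
    have h := hmem g hgi.integrableOn c
    rw [← hδ, ← hRe, Finset.sum_eq_single_of_mem 0 (Finset.mem_range.2 hN), rpow_cubeRoot] at h
    · simpa only [e1, Nat.cast_zero, zero_mul] using h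
    · intro k _ hk
      simp [e2 k hk]
  -- Let `S` be the largest integral of `f` over a square of side length `R`. The weighted integrals of
  -- `f` are at most a multiple of `S`, so decoupling gives `S ≤ C * A ^ 6 * S` with `0 < S < ∞`.
  obtain ⟨S, hS⟩ : ∃ S, S = ⨆ c, ∫⁻ x in square c R, f x := ⟨_, rfl⟩
  have hwt : ∀ c, ∫⁻ x, f x * ENNReal.ofReal (weight c R x) ≤ C₁ * C₂ * S := fun c => by
    have hR2 : ENNReal.ofReal (R ^ 2) ≠ 0 := by
      rw [Ne, ENNReal.ofReal_eq_zero, not_le]; positivity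
    refine (ENNReal.mul_le_mul_iff_right hR2 ENNReal.ofReal_ne_top).1 ?_
    calc _ ≤ C₁ * ∫⁻ q, ENNReal.ofReal (weight c R q) * ∫⁻ x in square q R, f x :=
          hC₁ R hR _ f (measurable_weight c hR) hfc.measurable fun x q => by
            rw [ENNReal.coe_one, one_mul, ← ENNReal.ofReal_mul (by
              have := div_nonneg (rad_nonneg (x - q)) hR.le; positivity)]
            refine ENNReal.ofReal_le_ofReal ?_
            have := weight_shift c hR x (q - x)
            rwa [add_sub_cancel, ← neg_sub, rad_neg] at this
      _ ≤ C₁ * ∫⁻ q, ENNReal.ofReal (weight c R q) * S := by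
          gcongr with q
          rw [hS]; exact le_iSup (fun c => ∫⁻ x in square c R, f x) q
      _ = C₁ * ((∫⁻ q, ENNReal.ofReal (weight c R q)) * S) := by
          rw [lintegral_mul_const _ (measurable_weight c hR)]
      _ ≤ C₁ * (C₂ * ENNReal.ofReal (R ^ 2) * S) := by gcongr; exact hC₂ c R hR
      _ = _ := by ring
  have hSle : S ≤ (C₁ * C₂ * A ^ (6 : ℝ)) * S := by
    nth_rewrite 1 [hS]
    refine iSup_le fun c => (hkey c).trans ?_
    calc _ ≤ A ^ (6 : ℝ) * (C₁ * C₂ * S) := by gcongr; exact hwt c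
      _ = _ := by ring
  have hS0 : S ≠ 0 := by
    refine (lt_of_lt_of_le ?_ (hS ▸ le_iSup (fun c => ∫⁻ x in square c R, f x) 0)).ne'
    rw [setLIntegral_pos_iff hfc.measurable]
    refine Measure.measure_pos_of_mem_nhds volume (x := (0 : ℝ × ℝ)) (Filter.inter_mem ?_ ?_)
    · refine (hfc.isOpen_support).mem_nhds ?_
      simp only [f, Function.mem_support]
      have : extend 0 δ g 0 = δ := by
        rw [extend_eq, hset _ measurableSet_Icc]
        simp [hδ0.le]
      rw [this]
      simp [hδ0.ne']
    · exact prod_mem_nhds (Icc_mem_nhds (by simpa using hR) (by simpa using hR))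
        (Icc_mem_nhds (by simpa using hR) (by simpa using hR))
  have hST : S ≠ ∞ := by
    let M := ENNReal.ofReal (∫ ξ in Set.Icc 0 (0 + δ), ‖g ξ‖)
    refine ne_top_of_le_ne_top (b := M ^ (6 : ℝ) * ENNReal.ofReal (R ^ 2)) (ENNReal.mul_ne_top
      (ENNReal.rpow_ne_top_of_nonneg (by norm_num) ENNReal.ofReal_ne_top) ENNReal.ofReal_ne_top) ?_
    rw [hS]
    refine iSup_le fun c => ?_
    rw [← volume_square c hR, ← setLIntegral_const]
    refine lintegral_mono fun x => ?_
    simp only [f]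
    gcongr
    rw [← ofReal_norm]
    exact ENNReal.ofReal_le_ofReal (norm_extend_le _ _ _ _)
  push_cast
  refine (ENNReal.mul_le_mul_iff_left hS0 hST).1 ?_
  rwa [one_mul]

/-! ### Decoupling on a square with rapidly decaying weights -/

theorem rpow_add_sum_le {ι : Type*} (a : ℝ≥0∞) (s : Finset ι) (f : ι → ℝ≥0∞) (hs : s.card ≤ 3) :
    (a + ∑ i ∈ s, f i) ^ (6 : ℝ) ≤
      (2 ^ 5 * 3 ^ 5 : ℝ≥0) * (a ^ (6 : ℝ) + ∑ i ∈ s, f i ^ (6 : ℝ)) := by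
  have e2 : (2 : ℝ≥0∞) ^ ((6 : ℝ) - 1) = 2 ^ 5 := by
    rw [show (6 : ℝ) - 1 = (5 : ℕ) by norm_num, ENNReal.rpow_natCast]
  have e3 : (3 : ℝ≥0∞) ^ ((6 : ℝ) - 1) = 3 ^ 5 := by
    rw [show (6 : ℝ) - 1 = (5 : ℕ) by norm_num, ENNReal.rpow_natCast]
  have h1 := ENNReal.rpow_add_le_mul_rpow_add_rpow a (∑ i ∈ s, f i) (p := 6) (by norm_num)
  have h2 : (∑ i ∈ s, f i) ^ (6 : ℝ) ≤ 3 ^ 5 * ∑ i ∈ s, f i ^ (6 : ℝ) := by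
    refine (ENNReal.rpow_sum_le_const_mul_sum_rpow s f (by norm_num)).trans ?_
    rw [← e3]
    gcongr
    exact_mod_cast hs
  rw [e2] at h1
  calc _ ≤ 2 ^ 5 * (a ^ (6 : ℝ) + (∑ i ∈ s, f i) ^ (6 : ℝ)) := h1
    _ ≤ 2 ^ 5 * (3 ^ 5 * a ^ (6 : ℝ) + 3 ^ 5 * ∑ i ∈ s, f i ^ (6 : ℝ)) := by
        gcongr
        exact le_mul_of_one_le_left zero_le (by norm_num)
    _ = _ := by push_cast; ring

/-- Summing over the neighbours of each index costs a factor of three. -/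
theorem sum_neighbours_le (N : ℕ) (f : ℕ → ℝ≥0∞) :
    ∑ k ∈ Finset.range N, ∑ j ∈ Finset.range N with j ≤ k + 1 ∧ k ≤ j + 1, f j ≤
      3 * ∑ j ∈ Finset.range N, f j := by
  simp only [Finset.sum_filter]
  rw [Finset.sum_comm, Finset.mul_sum]
  refine Finset.sum_le_sum fun j _ => ?_
  rw [← Finset.sum_filter, Finset.sum_const, nsmul_eq_mul]
  gcongr
  have : (Finset.range N).filter (fun k => j ≤ k + 1 ∧ k ≤ j + 1) ⊆ Finset.Icc (j - 1) (j + 1) := by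
    intro k hk
    rw [Finset.mem_filter] at hk
    rw [Finset.mem_Icc]; omega
  refine le_trans (Nat.cast_le.2 (Finset.card_le_card this)) ?_
  rw [Nat.card_Icc]
  exact_mod_cast (by omega : j + 1 + 1 - (j - 1) ≤ 3)

theorem card_neighbours_le (N k : ℕ) :
    ((Finset.range N).filter fun j => j ≤ k + 1 ∧ k ≤ j + 1).card ≤ 3 := by
  have : (Finset.range N).filter (fun j => j ≤ k + 1 ∧ k ≤ j + 1) ⊆ Finset.Icc (k - 1) (k + 1) := by
    intro j hj
    rw [Finset.mem_filter] at hj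
    rw [Finset.mem_Icc]; omega
  refine (Finset.card_le_card this).trans ?_
  rw [Nat.card_Icc]; omega

theorem card_ends_le (N : ℕ) : ((Finset.range N).filter fun j => j = 0 ∨ j + 1 = N).card ≤ 3 := by
  have : (Finset.range N).filter (fun j => j = 0 ∨ j + 1 = N) ⊆ {0, N - 1} := by
    intro j hj
    rw [Finset.mem_filter] at hj
    rw [Finset.mem_insert, Finset.mem_singleton]; omega
  exact (Finset.card_le_card this).trans (Finset.card_le_two.trans (by norm_num))

theorem rpow_sum_cubeRoot_le {ι : Type*} (s : Finset ι) (f : ι → ℝ≥0∞) :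
    (∑ i ∈ s, f i) ^ (1 / 3 : ℝ) ≤ ∑ i ∈ s, f i ^ (1 / 3 : ℝ) := by
  classical
  induction s using Finset.induction_on with
  | empty => simp
  | insert a s ha ih =>
    rw [Finset.sum_insert ha, Finset.sum_insert ha]
    exact (ENNReal.rpow_add_le_add_rpow _ _ (by norm_num) (by norm_num)).trans
      (add_le_add le_rfl ih)

namespace Localizer

variable {B : Localizer} {R δ : ℝ} {g : ℝ → ℂ} {N : ℕ}

theorem density_one_eq_sum (hN : 0 < N) (hδ : N * δ = 1) (hR : 0 < R)
    (hg : IntegrableOn g (Set.Icc 0 1)) (y ξ : ℝ) :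
    B.density R 0 1 g y ξ = ∑ k ∈ Finset.range N, B.density R (k * δ) δ g y ξ := by
  have hδ0 : 0 < δ := pos_of_mul_pos_right (by rw [hδ]; exact one_pos) (Nat.cast_nonneg N)
  have hd : δ = 1 / N := by rw [eq_div_iff (by positivity), mul_comm, hδ]
  have h := density_sum (B := B) (R := R) (a := 0) hR hδ0.le N (by rwa [hδ, zero_add])
    (fun k hk => by rw [hd, zero_add]; exact integrableOn_piece_one hN hg hk) y ξ
  rw [hδ] at h
  simpa only [zero_add] using h

/-- The localised density on `[0, 1]` differs from its evolution on the line only by the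
contributions of the two extreme short intervals. -/
theorem norm_evolve_sub_extend_le (hN : 0 < N) (hδ : N * δ = 1) (hR : 0 < R) (hRδ : 1 ≤ R * δ)
    (hg : IntegrableOn g (Set.Icc 0 1)) (y : ℝ) (x : ℝ × ℝ) :
    ‖B.evolve R 0 1 g y x - extend 0 1 (B.density R 0 1 g y) x‖ ≤
      ∑ j ∈ Finset.range N with j = 0 ∨ j + 1 = N, R⁻¹ * B.mass R (j * δ) δ g y := by
  have hδ0 : 0 < δ := pos_of_mul_pos_right (by rw [hδ]; exact one_pos) (Nat.cast_nonneg N)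
  have hd : δ = 1 / N := by rw [eq_div_iff (by positivity), mul_comm, hδ]
  have hgj : ∀ j ∈ Finset.range N, IntegrableOn g (Set.Icc (j * δ) (j * δ + δ)) := fun j hj => by
    rw [hd]; exact integrableOn_piece_one hN hg (Finset.mem_range.1 hj)
  have hi := integrable_density_mul_osc (B := B) hR (show IntegrableOn g (Set.Icc 0 (0 + 1)) by
    rwa [zero_add]) y x
  rw [evolve, extend_eq, zero_add, ← integral_add_compl measurableSet_Icc hi, add_sub_cancel_left]
  simp only [density_one_eq_sum hN hδ hR hg, Finset.sum_mul]
  rw [integral_finsetSum _ fun j hj => (integrable_density_mul_osc hR (hgj j hj) y x).integrableOn,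
    Finset.sum_filter]
  refine (norm_sum_le _ _).trans (Finset.sum_le_sum fun j hj => ?_)
  have hjN : (j : ℝ) + 1 ≤ N := by exact_mod_cast Finset.mem_range.1 hj
  split_ifs with h
  · refine norm_setIntegral_density_le hR (hgj j hj) y x measurableSet_Icc.compl fun ξ hξ => ?_
    rw [Set.mem_compl_iff, Set.mem_Icc, not_and_or, not_le, not_le] at hξ
    have h0 : 0 ≤ j * δ := by positivity
    rcases hξ with hξ | hξ
    · left; linarith
    · right; nlinarith
  · rw [not_or] at h
    have h1 : (1 : ℝ) ≤ j := by exact_mod_cast Nat.one_le_iff_ne_zero.2 h.1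
    have h2 : (j : ℝ) + 2 ≤ N := by
      have := Finset.mem_range.1 hj
      exact_mod_cast (by omega : j + 2 ≤ N)
    rw [setIntegral_eq_zero_of_forall_eq_zero, norm_zero]
    intro ξ hξ
    rw [density_eq_zero hR (hgj j hj) y, zero_mul]
    intro ζ hζ
    rw [Set.mem_compl_iff, Set.mem_Icc, not_and_or, not_le, not_le] at hξ
    have h3 : δ ≤ |ξ - ζ| := by
      rcases hξ with hξ | hξ
      · rw [abs_sub_comm]; exact le_trans (by nlinarith [hζ.1]) (le_abs_self _)
      · exact le_trans (by nlinarith [hζ.2]) (le_abs_self _)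
    nlinarith

/-- On a short interval, the localised density differs from the evolution of the contribution of
that interval only by the contributions of the interval and its neighbours. -/
theorem norm_extend_sub_evolve_le (hN : 0 < N) (hδ : N * δ = 1) (hR : 0 < R) (hRδ : 1 ≤ R * δ)
    (hg : IntegrableOn g (Set.Icc 0 1)) (y : ℝ) (x : ℝ × ℝ) {k : ℕ} (hk : k < N) :
    ‖extend (k * δ) δ (B.density R 0 1 g y) x - B.evolve R (k * δ) δ g y x‖ ≤
      ∑ j ∈ Finset.range N with j ≤ k + 1 ∧ k ≤ j + 1, R⁻¹ * B.mass R (j * δ) δ g y := by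
  have hδ0 : 0 < δ := pos_of_mul_pos_right (by rw [hδ]; exact one_pos) (Nat.cast_nonneg N)
  have hd : δ = 1 / N := by rw [eq_div_iff (by positivity), mul_comm, hδ]
  have hgj : ∀ j ∈ Finset.range N, IntegrableOn g (Set.Icc (j * δ) (j * δ + δ)) := fun j hj => by
    rw [hd]; exact integrableOn_piece_one hN hg (Finset.mem_range.1 hj)
  have hij := fun j hj => integrable_density_mul_osc (B := B) hR (hgj j hj) y x
  have hmn : ∀ j : ℕ, 0 ≤ R⁻¹ * B.mass R (j * δ) δ g y := fun j =>
    mul_nonneg (inv_nonneg.2 hR.le) (mass_nonneg y)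
  have hkm := Finset.mem_range.2 hk
  rw [evolve, extend_eq]
  simp only [density_one_eq_sum hN hδ hR hg, Finset.sum_mul]
  rw [integral_finsetSum _ fun j hj => (hij j hj).integrableOn,
    ← Finset.sum_ite_eq_of_mem (Finset.range N) k (fun j =>
      ∫ ξ, B.density R (j * δ) δ g y ξ * osc (ξ * x.1 + ξ ^ 2 * x.2)) hkm, ← Finset.sum_sub_distrib,
    Finset.sum_filter]
  refine (norm_sum_le _ _).trans (Finset.sum_le_sum fun j hj => ?_)
  by_cases hjk : k = j
  · subst hjk
    rw [if_pos rfl, if_pos (by omega), ← integral_add_compl (measurableSet_Icc (a := k * δ)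
      (b := k * δ + δ)) (hij k hj), sub_add_cancel_left, norm_neg]
    refine norm_setIntegral_density_le hR (hgj k hj) y x measurableSet_Icc.compl fun ξ hξ => ?_
    rw [Set.mem_compl_iff, Set.mem_Icc, not_and_or, not_le, not_le] at hξ
    exact hξ.imp le_of_lt le_of_lt
  rw [if_neg hjk, sub_zero]
  split_ifs with h
  · refine norm_setIntegral_density_le hR (hgj j hj) y x measurableSet_Icc fun ξ hξ => ?_
    rcases Nat.lt_or_gt_of_ne hjk with h' | h'
    · left
      have : (k : ℝ) + 1 ≤ j := by exact_mod_cast h'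
      nlinarith [hξ.2]
    · right
      have : (j : ℝ) + 1 ≤ k := by exact_mod_cast h'
      nlinarith [hξ.1]
  · rw [setIntegral_eq_zero_of_forall_eq_zero, norm_zero]
    intro ξ hξ
    rw [density_eq_zero hR (hgj j hj) y, zero_mul]
    intro ζ hζ
    have h3 : δ ≤ |ξ - ζ| := by
      rw [not_and_or, not_le, not_le] at h
      rcases h with h | h
      · have : (k : ℝ) + 2 ≤ j := by exact_mod_cast h
        rw [abs_sub_comm]; exact le_trans (by nlinarith [hζ.1, hξ.2]) (le_abs_self _)
      · have : (j : ℝ) + 2 ≤ k := by exact_mod_cast h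
        exact le_trans (by nlinarith [hζ.2, hξ.1]) (le_abs_self _)
    nlinarith

theorem continuous_uncurry_slice {a ℓ : ℝ} (hg : IntegrableOn g (Set.Icc a (a + ℓ))) :
    Continuous fun p : ℝ × ℝ => B.η (p.1 / R) * extend a ℓ g p :=
  (B.η_cont.comp (by fun_prop)).mul (continuous_extend hg)

theorem measurable_energy {a ℓ : ℝ} (hg : IntegrableOn g (Set.Icc a (a + ℓ))) :
    Measurable (B.energy R a ℓ g) := by
  have : Measurable fun p : ℝ × ℝ => ‖extend a ℓ g (p.2, p.1)‖ₑ ^ (6 : ℝ) * ‖B.η (p.2 / R)‖ₑ :=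
    (((continuous_extend hg).comp (by fun_prop)).enorm.measurable.pow_const _).mul
      (B.η_cont.comp (by fun_prop)).enorm.measurable
  exact this.lintegral_prod_right'

theorem measurable_evolve {a ℓ : ℝ} (hg : IntegrableOn g (Set.Icc a (a + ℓ))) :
    Measurable (Function.uncurry (B.evolve R a ℓ g)) := by
  have h1 : StronglyMeasurable fun p : ℝ × ℝ => B.density R a ℓ g p.1 p.2 := by
    refine StronglyMeasurable.mul (Continuous.stronglyMeasurable (by fun_prop)) ?_
    refine StronglyMeasurable.integral_prod_right (f := fun (p : ℝ × ℝ) (s : ℝ) =>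
      B.η (s / R) * extend a ℓ g (s, p.1) * osc (-(s * p.2))) (Continuous.stronglyMeasurable ?_)
    exact ((continuous_uncurry_slice (B := B) (R := R) hg).comp (by fun_prop :
      Continuous fun q : (ℝ × ℝ) × ℝ => (q.2, q.1.1))).mul (by fun_prop)
  have h2 : StronglyMeasurable (Function.uncurry (B.evolve R a ℓ g)) := by
    refine StronglyMeasurable.integral_prod_right (f := fun (p : ℝ × ℝ × ℝ) (ξ : ℝ) =>
      B.density R a ℓ g p.1 ξ * osc (ξ * p.2.1 + ξ ^ 2 * p.2.2)) ?_
    exact (h1.comp_measurable (by fun_prop : Measurable fun q : (ℝ × ℝ × ℝ) × ℝ =>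
      (q.1.1, q.2))).mul (Continuous.stronglyMeasurable (by fun_prop))
  exact h2.measurable

end Localizer

namespace Localizer

/-- Decoupling for the evolution from a single time `y`: the definition of `linearConst` is applied to
the localised density. The errors from its spreading over the boundaries of the short intervals are
controlled by the energies of neighbouring intervals. -/
theorem exists_lintegral_evolve_square_le (B : Localizer) : ∃ C : ℝ≥0, ∀ (N : ℕ) (δ R : ℝ)
    (g : ℝ → ℂ), 0 < N → N * δ = 1 → R * δ ^ 2 = 1 → IntegrableOn g (Set.Icc 0 1) → ∀ y,
    ∫⁻ x in square 0 R, ‖B.evolve R 0 1 g y x‖ₑ ^ (6 : ℝ) ≤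
      C * (linearConst (1 / (N : ℝ)) ^ (6 : ℝ) * (ENNReal.ofReal ((1 + |y / R|) ^ 12) *
        (∑ k ∈ Finset.range N,
          (ENNReal.ofReal R * B.energy R (k * δ) δ g y) ^ (1 / 3 : ℝ)) ^ (3 : ℝ))) := by
  obtain ⟨Cm, hCm⟩ := exists_mass_le B
  obtain ⟨Ce, hCe⟩ := exists_lintegral_evolve_le B
  obtain ⟨Cw, hCw⟩ := exists_lintegral_weight_le
  obtain ⟨CD, hCD⟩ := exists_one_le_linearConst
  obtain ⟨K₀, hK₀⟩ : ∃ K : ℝ≥0, K = 2 ^ 5 * 3 ^ 5 := ⟨_, rfl⟩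
  have hpow := fun (a : ℝ≥0∞) (s : Finset ℕ) (f : ℕ → ℝ≥0∞) => rpow_add_sum_le a s f
  simp only [← hK₀] at hpow
  refine ⟨K₀ * (27 * (K₀ * (Ce + Cw * Cm)) + Cm * CD), fun N δ R g hN hδ hRδ hg y => ?_⟩
  have hδ0 : 0 < δ := pos_of_mul_pos_right (by rw [hδ]; exact one_pos) (Nat.cast_nonneg N)
  have hd : δ = 1 / N := by rw [eq_div_iff (by positivity), mul_comm, hδ]
  have hδ1 : δ ≤ 1 := by
    rw [hd, div_le_one (by positivity)]; exact_mod_cast hN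
  have hRe : R = (δ ^ 2)⁻¹ := eq_inv_of_mul_eq_one_left hRδ
  have hR : 0 < R := by rw [hRe]; positivity
  have hRδ1 : 1 ≤ R * δ := by nlinarith [mul_pos hR hδ0]
  have hg01 : IntegrableOn g (Set.Icc 0 (0 + 1)) := by rwa [zero_add]
  have hgj : ∀ j ∈ Finset.range N, IntegrableOn g (Set.Icc (j * δ) (j * δ + δ)) := fun j hj => by
    rw [hd]; exact integrableOn_piece_one hN hg (Finset.mem_range.1 hj)
  obtain ⟨h, hh⟩ : ∃ h, h = B.density R 0 1 g y := ⟨_, rfl⟩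
  have hhi : Integrable h := by rw [hh]; exact integrable_density hR hg01 y
  obtain ⟨e, he⟩ : ∃ e : ℕ → ℝ≥0∞, ∀ k, e k = ENNReal.ofReal R * B.energy R (k * δ) δ g y :=
    ⟨_, fun _ => rfl⟩
  obtain ⟨μ, hμ⟩ : ∃ μ : ℕ → ℝ≥0∞, ∀ k, μ k = ENNReal.ofReal (R⁻¹ * B.mass R (k * δ) δ g y) :=
    ⟨_, fun _ => rfl⟩
  obtain ⟨Y, hY⟩ : ∃ Y : ℝ≥0∞, Y = ENNReal.ofReal ((1 + |y / R|) ^ 12) := ⟨_, rfl⟩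
  have hY1 : 1 ≤ Y := by
    rw [hY, ENNReal.one_le_ofReal]
    exact one_le_pow₀ (by linarith [abs_nonneg (y / R)])
  have hμe : ∀ j ∈ Finset.range N, ENNReal.ofReal (R ^ 2) * μ j ^ (6 : ℝ) ≤ Cm * e j :=
    fun j hj => by rw [hμ, he]; exact hCm R _ _ g hR (hgj j hj) y
  have hsum : ∀ s : Finset ℕ, ENNReal.ofReal (∑ j ∈ s, R⁻¹ * B.mass R (j * δ) δ g y) =
      ∑ j ∈ s, μ j := fun s => by
    simp only [hμ]
    exact ENNReal.ofReal_sum_of_nonneg fun j _ => mul_nonneg (inv_nonneg.2 hR.le) (mass_nonneg y)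
  -- The pieces of the extension of the localised density `h`, compared with the evolutions of the
  -- corresponding pieces of `g`.
  have hX : ∀ k ∈ Finset.range N,
      ∫⁻ x, ‖extend (k * δ) δ h x‖ₑ ^ (6 : ℝ) * ENNReal.ofReal (weight 0 R x) ≤
        (K₀ * (Ce + Cw * Cm) : ℝ≥0) * (Y *
          ∑ j ∈ Finset.range N with j ≤ k + 1 ∧ k ≤ j + 1, e j) := by
    intro k hk
    have hw := measurable_weight 0 hR
    have hem : Measurable fun x => ‖B.evolve R (k * δ) δ g y x‖ₑ ^ (6 : ℝ) :=
      (continuous_evolve hR (hgj k hk) y).enorm.measurable.pow_const _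
    have hmw : Measurable fun x => ‖B.evolve R (k * δ) δ g y x‖ₑ ^ (6 : ℝ) *
        ENNReal.ofReal (weight 0 R x) := hem.mul hw
    have hkT : k ∈ (Finset.range N).filter fun j => j ≤ k + 1 ∧ k ≤ j + 1 := by
      rw [Finset.mem_filter]; exact ⟨hk, by omega, by omega⟩
    set T := (Finset.range N).filter fun j => j ≤ k + 1 ∧ k ≤ j + 1
    have hE : ∫⁻ x, ‖B.evolve R (k * δ) δ g y x‖ₑ ^ (6 : ℝ) * ENNReal.ofReal (weight 0 R x) ≤
        Ce * (Y * e k) := by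
      rw [hY, he]; exact hCe R _ δ g hδ0 hδ1 hRδ (hgj k hk) y
    calc _ ≤ ∫⁻ x, K₀ * (‖B.evolve R (k * δ) δ g y x‖ₑ ^ (6 : ℝ) + ∑ j ∈ T, μ j ^ (6 : ℝ)) *
            ENNReal.ofReal (weight 0 R x) := by
          refine lintegral_mono fun x => mul_le_mul' ?_ le_rfl
          refine le_trans (ENNReal.rpow_le_rpow ?_ (by norm_num))
            (hpow _ T μ (card_neighbours_le N k))
          rw [← hsum]
          refine le_trans (b := ‖B.evolve R (k * δ) δ g y x‖ₑ +
            ‖extend (k * δ) δ h x - B.evolve R (k * δ) δ g y x‖ₑ) ?_ (add_le_add le_rfl ?_)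
          · refine le_trans (le_of_eq ?_) (enorm_add_le _ _)
            rw [add_sub_cancel]
          · rw [← ofReal_norm, hh]
            exact ENNReal.ofReal_le_ofReal (norm_extend_sub_evolve_le hN hδ hR hRδ1 hg y x
              (Finset.mem_range.1 hk))
      _ = K₀ * (∫⁻ x, ‖B.evolve R (k * δ) δ g y x‖ₑ ^ (6 : ℝ) * ENNReal.ofReal (weight 0 R x)) +
            K₀ * ((∑ j ∈ T, μ j ^ (6 : ℝ)) * ∫⁻ x, ENNReal.ofReal (weight 0 R x)) := by
          rw [← lintegral_const_mul _ hw, ← lintegral_const_mul _ hmw,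
            ← lintegral_const_mul _ (hw.const_mul _), ← lintegral_add_left
            (hmw.const_mul _)]
          exact lintegral_congr fun x => by ring
      _ ≤ K₀ * (Ce * (Y * e k)) +
            K₀ * ((∑ j ∈ T, μ j ^ (6 : ℝ)) * (Cw * ENNReal.ofReal (R ^ 2))) := by
          gcongr; exact hCw 0 R hR
      _ = K₀ * (Ce * (Y * e k)) +
            K₀ * (Cw * ∑ j ∈ T, ENNReal.ofReal (R ^ 2) * μ j ^ (6 : ℝ)) := by
          rw [← Finset.mul_sum]; ring
      _ ≤ K₀ * (Ce * (Y * ∑ j ∈ T, e j)) + K₀ * (Cw * (Y * ∑ j ∈ T, Cm * e j)) := by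
          gcongr with j hj
          · exact Finset.single_le_sum (f := e) (fun _ _ => zero_le) hkT
          · refine le_trans (Finset.sum_le_sum fun j hj => hμe j (Finset.mem_filter.1 hj).1)
              (le_mul_of_one_le_left zero_le hY1)
      _ = _ := by rw [← Finset.mul_sum]; push_cast; ring
  obtain ⟨K₁, hK₁⟩ : ∃ K : ℝ≥0, K = K₀ * (Ce + Cw * Cm) := ⟨_, rfl⟩
  rw [← hK₁] at hX ⊢
  obtain ⟨S, hS⟩ : ∃ S, S = (∑ k ∈ Finset.range N, e k ^ (1 / 3 : ℝ)) ^ (3 : ℝ) := ⟨_, rfl⟩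
  have hXS : (∑ k ∈ Finset.range N, (∫⁻ x, ‖extend (k * δ) δ h x‖ₑ ^ (6 : ℝ) *
      ENNReal.ofReal (weight 0 R x)) ^ (1 / 3 : ℝ)) ^ (3 : ℝ) ≤ 27 * (K₁ * (Y * S)) := by
    calc _ ≤ ((K₁ * Y) ^ (1 / 3 : ℝ) * ∑ k ∈ Finset.range N,
            ∑ j ∈ Finset.range N with j ≤ k + 1 ∧ k ≤ j + 1, e j ^ (1 / 3 : ℝ)) ^ (3 : ℝ) := by
          refine ENNReal.rpow_le_rpow ?_ (by norm_num)
          rw [Finset.mul_sum]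
          refine Finset.sum_le_sum fun k hk => ?_
          refine (ENNReal.rpow_le_rpow (hX k hk) (by norm_num)).trans ?_
          rw [← mul_assoc, ENNReal.mul_rpow_of_nonneg _ _ (by norm_num)]
          exact mul_le_mul' le_rfl (rpow_sum_cubeRoot_le _ _)
      _ ≤ ((K₁ * Y) ^ (1 / 3 : ℝ) * (3 * ∑ k ∈ Finset.range N, e k ^ (1 / 3 : ℝ))) ^ (3 : ℝ) := by
          gcongr; exact sum_neighbours_le N fun j => e j ^ (1 / 3 : ℝ)
      _ = _ := by
          rw [ENNReal.mul_rpow_of_nonneg _ _ (by norm_num), rpow_cubeRoot,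
            ENNReal.mul_rpow_of_nonneg _ _ (by norm_num), ← hS,
            show (3 : ℝ) = (3 : ℕ) by norm_num, ENNReal.rpow_natCast]
          norm_num
          ring
  have hDh := linearConst_mem hN h hhi.integrableOn 0
  rw [← hd, ← hRe, hd, ← hd] at hDh
  obtain ⟨D, hDe⟩ : ∃ D, D = linearConst (1 / (N : ℝ)) ^ (6 : ℝ) := ⟨_, rfl⟩
  have hD1 : 1 ≤ CD * D := by rw [hDe]; exact hCD N hN
  have hDh' : ∫⁻ x in square 0 R, ‖extend 0 1 h x‖ₑ ^ (6 : ℝ) ≤ D * (27 * (K₁ * (Y * S))) := by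
    refine hDh.trans (mul_le_mul' (le_of_eq (by rw [hDe, hd])) hXS)
  simp only [← he, ← hS, ← hY, ← hDe]
  set E := (Finset.range N).filter fun j => j = 0 ∨ j + 1 = N
  calc _ ≤ ∫⁻ x in square 0 R, K₀ * (‖extend 0 1 h x‖ₑ ^ (6 : ℝ) + ∑ j ∈ E, μ j ^ (6 : ℝ)) := by
        refine lintegral_mono fun x => ?_
        refine le_trans (ENNReal.rpow_le_rpow ?_ (by norm_num)) (hpow _ E μ (card_ends_le N))
        rw [← hsum]
        refine le_trans (b := ‖extend 0 1 h x‖ₑ + ‖B.evolve R 0 1 g y x - extend 0 1 h x‖ₑ) ?_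
          (add_le_add le_rfl ?_)
        · refine le_trans (le_of_eq ?_) (enorm_add_le _ _)
          rw [add_sub_cancel]
        · rw [← ofReal_norm, hh]
          exact ENNReal.ofReal_le_ofReal (norm_evolve_sub_extend_le hN hδ hR hRδ1 hg y x)
    _ = K₀ * ((∫⁻ x in square 0 R, ‖extend 0 1 h x‖ₑ ^ (6 : ℝ)) +
          ∑ j ∈ E, ENNReal.ofReal (R ^ 2) * μ j ^ (6 : ℝ)) := by
        rw [lintegral_const_mul' _ _ ENNReal.coe_ne_top, lintegral_add_right _ measurable_const,
          setLIntegral_const, volume_square 0 hR, ← Finset.mul_sum, mul_comm (Finset.sum _ _)]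
    _ ≤ K₀ * (D * (27 * (K₁ * (Y * S))) + (CD * D) * (Y * (Cm * S))) := by
        gcongr
        refine le_trans ?_ (le_mul_of_one_le_left zero_le hD1)
        refine le_trans ?_ (le_mul_of_one_le_left zero_le hY1)
        calc _ ≤ ∑ j ∈ E, Cm * e j := Finset.sum_le_sum fun j hj => hμe j (Finset.mem_filter.1 hj).1
          _ ≤ ∑ j ∈ Finset.range N, Cm * e j :=
              Finset.sum_le_sum_of_subset (Finset.filter_subset _ _)
          _ ≤ Cm * S := by
              rw [← Finset.mul_sum, hS]
              refine mul_le_mul' le_rfl (le_trans (le_of_eq ?_) (sum_cube_le _ _))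
              simp only [rpow_cubeRoot]
    _ = _ := by push_cast; ring

/-- On a square, an extension is dominated by the average of the evolutions of its localisations. -/
theorem exists_extend_le_evolve (B : Localizer) : ∃ C : ℝ≥0, ∀ (R : ℝ) (g : ℝ → ℂ), 1 ≤ R →
    IntegrableOn g (Set.Icc 0 1) → ∀ x ∈ square 0 R, ‖extend 0 1 g x‖ₑ ^ (6 : ℝ) ≤
      C * ∫⁻ y, ‖B.evolve R 0 1 g y x‖ₑ ^ (6 : ℝ) * ENNReal.ofReal (R⁻¹ * dec 130 (y / R)) := by
  obtain ⟨C₁, hC₁, hψ⟩ := B.ψ_decay 130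
  obtain ⟨C₂, hC₂⟩ := exists_lintegral_dec_le
  obtain ⟨A, hA⟩ : ∃ A : ℝ, A = 2 ^ 130 := ⟨_, rfl⟩
  have hA0 : 0 < A := by rw [hA]; positivity
  refine ⟨(2 * (C₁ * A).toNNReal) ^ 6 * C₂ ^ 5, fun R g hR hg x hx => ?_⟩
  have hR0 : 0 < R := by linarith
  have hg01 : IntegrableOn g (Set.Icc 0 (0 + 1)) := by rwa [zero_add]
  obtain ⟨⟨h1, h2⟩, h3, h4⟩ := hx
  simp only [Prod.fst_zero, Prod.snd_zero, zero_sub, zero_add] at h1 h2 h3 h4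
  have hk : Measurable fun y => ENNReal.ofReal (R⁻¹ * dec 130 (y / R)) := by fun_prop
  have hkI : ∫⁻ y, ENNReal.ofReal (R⁻¹ * dec 130 (y / R)) ≤ C₂ := by
    have h := hC₂ 130 (by norm_num) 0 R hR0
    simp only [sub_zero] at h
    simp only [ENNReal.ofReal_mul (inv_nonneg.2 hR0.le)]
    rw [lintegral_const_mul' _ _ ENNReal.ofReal_ne_top]
    calc _ ≤ ENNReal.ofReal R⁻¹ * (C₂ * ENNReal.ofReal R) := by gcongr
      _ = C₂ * ENNReal.ofReal (R⁻¹ * R) := by rw [ENNReal.ofReal_mul (inv_nonneg.2 hR0.le)]; ring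
      _ = C₂ := by rw [inv_mul_cancel₀ hR0.ne', ENNReal.ofReal_one, mul_one]
  have hm : Measurable fun y => ‖B.evolve R 0 1 g y x‖ₑ :=
    ((measurable_evolve hg01).comp measurable_prodMk_right).enorm
  -- On the square the bump `η` is at least `1 / 2`, so it can be inserted.
  have hη : 1 ≤ 2 * ‖B.η (x.1 / R)‖ₑ := by
    have h := B.η_ge (x.1 / R) (by
      rw [abs_div, abs_of_pos hR0, div_le_one hR0, abs_le]; constructor <;> linarith)
    rw [← ofReal_norm, show (2 : ℝ≥0∞) = ENNReal.ofReal 2 by simp, ← ENNReal.ofReal_mul (by norm_num),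
      ENNReal.one_le_ofReal]
    linarith
  have hF : ‖extend 0 1 g x‖ₑ ≤ 2 * (C₁ * A).toNNReal *
      ∫⁻ y, ‖B.evolve R 0 1 g y x‖ₑ * ENNReal.ofReal (R⁻¹ * dec 130 (y / R)) := by
    calc _ ≤ 2 * ‖B.η (x.1 / R)‖ₑ * ‖extend 0 1 g x‖ₑ := le_mul_of_one_le_left zero_le hη
      _ = 2 * ‖∫ y, ((R : ℂ)⁻¹ * B.ψ ((x.2 - y) / R)) * B.evolve R 0 1 g y x‖ₑ := by
          rw [mul_assoc, ← enorm_mul, η_mul_extend_eq hR le_rfl (by norm_num) hg01]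
      _ ≤ 2 * ∫⁻ y, ‖((R : ℂ)⁻¹ * B.ψ ((x.2 - y) / R)) * B.evolve R 0 1 g y x‖ₑ := by
          gcongr; exact enorm_integral_le_lintegral_enorm _
      _ ≤ _ := by
          rw [mul_assoc]
          refine mul_le_mul' le_rfl ?_
          rw [← lintegral_const_mul' _ _ ENNReal.coe_ne_top]
          refine lintegral_mono fun y => ?_
          rw [enorm_mul, mul_left_comm, mul_comm]
          refine mul_le_mul' le_rfl ?_
          change _ ≤ ENNReal.ofReal (C₁ * A) * _
          rw [← ENNReal.ofReal_mul (by positivity), ← ofReal_norm]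
          refine ENNReal.ofReal_le_ofReal ?_
          rw [norm_mul, norm_inv, Complex.norm_real, Real.norm_of_nonneg hR0.le]
          -- The height `x.2` is at most `R`, so the decay in `x.2 - y` is decay in `y`.
          have hd : dec 130 ((x.2 - y) / R) ≤ A * dec 130 (y / R) := by
            refine (dec_shift 130 ((x.2 - y) / R) (-(x.2 / R))).trans ?_
            rw [show (x.2 - y) / R + -(x.2 / R) = -(y / R) by ring, dec_neg, hA]
            refine mul_le_mul_of_nonneg_right ?_ (dec_pos _ _).le
            refine pow_le_pow_left₀ (by positivity) ?_ _
            have : |x.2 / R| ≤ 1 := by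
              rw [abs_div, abs_of_pos hR0, div_le_one hR0, abs_le]; constructor <;> linarith
            rw [abs_neg]; linarith
          calc R⁻¹ * ‖B.ψ ((x.2 - y) / R)‖ ≤ R⁻¹ * (C₁ * dec 130 ((x.2 - y) / R)) := by
                gcongr; exact hψ _
            _ ≤ R⁻¹ * (C₁ * (A * dec 130 (y / R))) := by gcongr
            _ = _ := by ring
  have hJ := lintegral_mul_rpow_le (μ := volume) (p := 6) (by norm_num) hm.aemeasurable
    hk.aemeasurable
  calc _ ≤ _ := ENNReal.rpow_le_rpow hF (by norm_num : (0 : ℝ) ≤ 6)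
    _ ≤ (2 * (C₁ * A).toNNReal : ℝ≥0∞) ^ (6 : ℝ) * ((C₂ : ℝ≥0∞) ^ ((6 : ℝ) - 1) *
          ∫⁻ y, ‖B.evolve R 0 1 g y x‖ₑ ^ (6 : ℝ) * ENNReal.ofReal (R⁻¹ * dec 130 (y / R))) := by
        rw [ENNReal.mul_rpow_of_nonneg _ _ (by norm_num)]
        refine mul_le_mul' le_rfl (hJ.trans ?_)
        gcongr
    _ = _ := by
        rw [show (6 : ℝ) - 1 = (5 : ℕ) by norm_num, ENNReal.rpow_natCast,
          show (6 : ℝ) = (6 : ℕ) by norm_num]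
        simp only [ENNReal.rpow_natCast]
        push_cast; ring

end Localizer

/-- The product weight of the square with centre `c` and side length `R`, decaying to order `m` in
each coordinate. -/
def prodDec (m : ℕ) (c : ℝ × ℝ) (R : ℝ) (x : ℝ × ℝ) : ℝ :=
  dec m ((x.1 - c.1) / R) * dec m ((x.2 - c.2) / R)

theorem prodDec_nonneg (m : ℕ) (c : ℝ × ℝ) (R : ℝ) (x : ℝ × ℝ) : 0 ≤ prodDec m c R x :=
  mul_nonneg (dec_pos _ _).le (dec_pos _ _).le

@[fun_prop] theorem continuous_prodDec (m : ℕ) (c : ℝ × ℝ) (R : ℝ) :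
    Continuous (prodDec m c R) := by
  unfold prodDec; fun_prop

/-- Linear decoupling with a weight of rapid decay in place of the weight of the definition. -/
theorem exists_linear_decoupling_prodDec : ∃ C : ℝ≥0, ∀ (N : ℕ) (δ R : ℝ) (g : ℝ → ℂ), 0 < N →
    N * δ = 1 → R * δ ^ 2 = 1 → IntegrableOn g (Set.Icc 0 1) → ∀ c,
    ∫⁻ x in square c R, ‖extend 0 1 g x‖ₑ ^ (6 : ℝ) ≤
      C * (linearConst (1 / (N : ℝ)) ^ (6 : ℝ) * (∑ k ∈ Finset.range N,
        (∫⁻ x, ‖extend (k * δ) δ g x‖ₑ ^ (6 : ℝ) *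
          ENNReal.ofReal (prodDec 118 c R x)) ^ (1 / 3 : ℝ)) ^ (3 : ℝ)) := by
  obtain ⟨B⟩ := exists_localizer
  obtain ⟨C₁, hC₁⟩ := B.exists_extend_le_evolve
  obtain ⟨C₂, hC₂⟩ := B.exists_lintegral_evolve_square_le
  obtain ⟨C₃, hC₃, hη⟩ := B.η_decay 118
  refine ⟨C₁ * (C₂ * C₃.toNNReal), fun N δ R g hN hδ hRδ hg c => ?_⟩
  have hδ0 : 0 < δ := pos_of_mul_pos_right (by rw [hδ]; exact one_pos) (Nat.cast_nonneg N)
  have hd : δ = 1 / N := by rw [eq_div_iff (by positivity), mul_comm, hδ]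
  have hδ1 : δ ≤ 1 := by
    rw [hd, div_le_one (by positivity)]; exact_mod_cast hN
  have hR1 : 1 ≤ R := by
    rw [eq_inv_of_mul_eq_one_left hRδ]
    exact (one_le_inv₀ (by positivity)).2 (pow_le_one₀ hδ0.le hδ1)
  have hR : 0 < R := by linarith
  obtain ⟨D, hD⟩ : ∃ D, D = linearConst (1 / (N : ℝ)) ^ (6 : ℝ) := ⟨_, rfl⟩
  rw [← hD]
  -- By modulating `g` it suffices to treat squares centred at the origin.
  suffices key : ∀ g : ℝ → ℂ, IntegrableOn g (Set.Icc 0 1) →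
      ∫⁻ x in square 0 R, ‖extend 0 1 g x‖ₑ ^ (6 : ℝ) ≤
      (C₁ * (C₂ * C₃.toNNReal) : ℝ≥0) * (D * (∑ k ∈ Finset.range N,
        (∫⁻ x, ‖extend (k * δ) δ g x‖ₑ ^ (6 : ℝ) *
          ENNReal.ofReal (prodDec 118 0 R x)) ^ (1 / 3 : ℝ)) ^ (3 : ℝ)) by
    have hg' : IntegrableOn (fun ξ => g ξ * osc (ξ * c.1 + ξ ^ 2 * c.2)) (Set.Icc 0 1) :=
      integrable_mul_osc hg (by fun_prop)
    have h := key _ hg'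
    simp only [← extend_translate] at h
    have e1 : ∫⁻ x in square 0 R, ‖extend 0 1 g (x + c)‖ₑ ^ (6 : ℝ) =
        ∫⁻ x in square c R, ‖extend 0 1 g x‖ₑ ^ (6 : ℝ) := by
      rw [← lintegral_indicator (measurableSet_square _ _),
        ← lintegral_indicator (measurableSet_square _ _), ← lintegral_add_right_eq_self
          ((square c R).indicator _) c]
      refine lintegral_congr fun x => ?_
      have : x + c ∈ square c R ↔ x ∈ square 0 R := by
        simp only [square, Set.mem_prod, Set.mem_Icc, Prod.fst_add, Prod.snd_add, Prod.fst_zero,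
          Prod.snd_zero]
        constructor <;> rintro ⟨⟨h1, h2⟩, h3, h4⟩ <;>
          exact ⟨⟨by linarith, by linarith⟩, by linarith, by linarith⟩
      by_cases hx : x ∈ square 0 R
      · rw [Set.indicator_of_mem hx, Set.indicator_of_mem (this.2 hx)]
      · rw [Set.indicator_of_notMem hx, Set.indicator_of_notMem (mt this.1 hx)]
    have e2 : ∀ k : ℕ, ∫⁻ x, ‖extend (k * δ) δ g (x + c)‖ₑ ^ (6 : ℝ) *
          ENNReal.ofReal (prodDec 118 0 R x) =
        ∫⁻ x, ‖extend (k * δ) δ g x‖ₑ ^ (6 : ℝ) * ENNReal.ofReal (prodDec 118 c R x) := fun k => by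
      rw [← lintegral_add_right_eq_self (fun x => ‖extend (k * δ) δ g x‖ₑ ^ (6 : ℝ) *
        ENNReal.ofReal (prodDec 118 c R x)) c]
      refine lintegral_congr fun x => ?_
      simp [prodDec]
    simpa only [e1, e2] using h
  intro g hg
  have hg01 : IntegrableOn g (Set.Icc 0 (0 + 1)) := by rwa [zero_add]
  have hgj : ∀ j ∈ Finset.range N, IntegrableOn g (Set.Icc (j * δ) (j * δ + δ)) := fun j hj => by
    rw [hd]; exact integrableOn_piece_one hN hg (Finset.mem_range.1 hj)
  have hev : Measurable fun p : (ℝ × ℝ) × ℝ => ‖B.evolve R 0 1 g p.2 p.1‖ₑ ^ (6 : ℝ) *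
      ENNReal.ofReal (R⁻¹ * dec 130 (p.2 / R)) :=
    (((Localizer.measurable_evolve hg01).comp measurable_swap).enorm.pow_const _).mul (by fun_prop)
  have hb : ∀ k ∈ Finset.range N, Measurable fun y => ENNReal.ofReal (R⁻¹ * dec 118 (y / R)) *
      (ENNReal.ofReal R * B.energy R (k * δ) δ g y) := fun k hk =>
    Measurable.mul (by fun_prop) ((Localizer.measurable_energy (hgj k hk)).const_mul _)
  calc _ ≤ ∫⁻ x in square 0 R, C₁ * ∫⁻ y, ‖B.evolve R 0 1 g y x‖ₑ ^ (6 : ℝ) *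
          ENNReal.ofReal (R⁻¹ * dec 130 (y / R)) :=
        setLIntegral_mono' (measurableSet_square _ _) fun x hx => hC₁ R g hR1 hg x hx
    _ = C₁ * ∫⁻ y, ENNReal.ofReal (R⁻¹ * dec 130 (y / R)) *
          ∫⁻ x in square 0 R, ‖B.evolve R 0 1 g y x‖ₑ ^ (6 : ℝ) := by
        rw [lintegral_const_mul' _ _ ENNReal.coe_ne_top, lintegral_lintegral_swap hev.aemeasurable]
        refine congrArg _ (lintegral_congr fun y => ?_)
        rw [lintegral_mul_const' _ _ ENNReal.ofReal_ne_top, mul_comm]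
    _ ≤ C₁ * ∫⁻ y, (C₂ * D) * (∑ k ∈ Finset.range N, (ENNReal.ofReal (R⁻¹ * dec 118 (y / R)) *
          (ENNReal.ofReal R * B.energy R (k * δ) δ g y)) ^ (1 / 3 : ℝ)) ^ (3 : ℝ) := by
        refine mul_le_mul' le_rfl (lintegral_mono fun y => ?_)
        have h := hC₂ N δ R g hN hδ hRδ hg y
        rw [← hD] at h
        refine (mul_le_mul' le_rfl h).trans (le_of_eq ?_)
        -- Twelve of the powers of decay in `y` pay for the spreading of the evolution.
        have e3 : ENNReal.ofReal (R⁻¹ * dec 130 (y / R)) * ENNReal.ofReal ((1 + |y / R|) ^ 12) =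
            ENNReal.ofReal (R⁻¹ * dec 118 (y / R)) := by
          rw [← ENNReal.ofReal_mul (mul_nonneg (inv_nonneg.2 hR.le) (dec_pos _ _).le)]
          refine congrArg ENNReal.ofReal ?_
          rw [dec_add 118 12, dec, dec, mul_assoc, mul_assoc, inv_mul_cancel₀ (by positivity), mul_one]
        simp only [ENNReal.mul_rpow_of_nonneg (ENNReal.ofReal (R⁻¹ * dec 118 (y / R))) _
          (by norm_num : (0 : ℝ) ≤ 1 / 3)]
        rw [← Finset.mul_sum, ENNReal.mul_rpow_of_nonneg _ _ (by norm_num : (0 : ℝ) ≤ 3),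
          rpow_cubeRoot, ← e3]
        generalize ENNReal.ofReal (R⁻¹ * dec 130 (y / R)) = X
        generalize ENNReal.ofReal ((1 + |y / R|) ^ 12) = Y
        ring
    _ ≤ C₁ * ((C₂ * D) * (∑ k ∈ Finset.range N, (∫⁻ y, ENNReal.ofReal (R⁻¹ * dec 118 (y / R)) *
          (ENNReal.ofReal R * B.energy R (k * δ) δ g y)) ^ (1 / 3 : ℝ)) ^ (3 : ℝ)) := by
        rw [lintegral_const_mul'']
        · exact mul_le_mul' le_rfl (mul_le_mul' le_rfl
            (lintegral_sum_cubeRoot_le _ fun k hk => (hb k hk).aemeasurable))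
        · exact ((Finset.measurable_fun_sum _ fun k hk =>
            (hb k hk).pow_const _).pow_const _).aemeasurable
    _ ≤ C₁ * ((C₂ * D) * (∑ k ∈ Finset.range N, (C₃.toNNReal *
          ∫⁻ x, ‖extend (k * δ) δ g x‖ₑ ^ (6 : ℝ) *
            ENNReal.ofReal (prodDec 118 0 R x)) ^ (1 / 3 : ℝ)) ^ (3 : ℝ)) := by
        gcongr with k hk
        have hpm : Measurable fun x => ‖extend (k * δ) δ g x‖ₑ ^ (6 : ℝ) *
            ENNReal.ofReal (prodDec 118 0 R x) :=
          (measurable_enorm_rpow_extend (hgj k hk) 6).mul (by fun_prop)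
        rw [Measure.volume_eq_prod, lintegral_prod_symm _ hpm.aemeasurable,
          ← lintegral_const_mul' _ _ ENNReal.coe_ne_top]
        refine lintegral_mono fun y => ?_
        rw [Localizer.energy, ← mul_assoc, ← ENNReal.ofReal_mul
          (mul_nonneg (inv_nonneg.2 hR.le) (dec_pos _ _).le), mul_right_comm,
          inv_mul_cancel₀ hR.ne', one_mul, ← lintegral_const_mul' _ _ ENNReal.ofReal_ne_top,
          ← lintegral_const_mul' _ _ ENNReal.coe_ne_top]
        refine lintegral_mono fun s => ?_
        rw [mul_left_comm, mul_left_comm _ (‖extend _ _ _ _‖ₑ ^ _)]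
        refine mul_le_mul' le_rfl ?_
        change _ ≤ ENNReal.ofReal C₃ * _
        rw [← ofReal_norm, ← ENNReal.ofReal_mul (dec_pos _ _).le, ← ENNReal.ofReal_mul hC₃.le]
        refine ENNReal.ofReal_le_ofReal ?_
        simp only [prodDec, Prod.fst_zero, Prod.snd_zero, sub_zero]
        rw [← mul_assoc, mul_comm]
        exact mul_le_mul_of_nonneg_right (hη _) (dec_pos _ _).le
    _ = _ := by
        simp only [ENNReal.mul_rpow_of_nonneg (C₃.toNNReal : ℝ≥0∞) _
          (by norm_num : (0 : ℝ) ≤ 1 / 3)]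
        rw [← Finset.mul_sum, ENNReal.mul_rpow_of_nonneg _ _ (by norm_num : (0 : ℝ) ≤ 3),
          rpow_cubeRoot]
        push_cast; ring

/-! ### Linear decoupling with slowly varying weights, rescaled to short intervals -/

theorem one_add_rad_le (x : ℝ × ℝ) {R : ℝ} (hR : 0 < R) :
    1 + rad x / R ≤ (1 + |x.1 / R|) * (1 + |x.2 / R|) := by
  have h := div_le_div_of_nonneg_right (rad_le x) hR.le
  rw [add_div] at h
  rw [abs_div, abs_div, abs_of_pos hR]
  have h1 : 0 ≤ |x.1| / R * (|x.2| / R) := by positivity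
  nlinarith

theorem exists_lintegral_prodDec_le : ∃ C : ℝ≥0, ∀ (m : ℕ), 2 ≤ m → ∀ (c : ℝ × ℝ) (R : ℝ), 0 < R →
    ∫⁻ x, ENNReal.ofReal (prodDec m c R x) ≤ C * ENNReal.ofReal (R ^ 2) := by
  obtain ⟨C, hC⟩ := exists_lintegral_dec_le
  refine ⟨C * C, fun m hm c R hR => ?_⟩
  calc _ = ∫⁻ x : ℝ × ℝ, ENNReal.ofReal (dec m ((x.1 - c.1) / R)) *
          ENNReal.ofReal (dec m ((x.2 - c.2) / R)) :=
        lintegral_congr fun x => ENNReal.ofReal_mul (dec_pos _ _).le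
    _ = _ := lintegral_mul_prod (f := fun t => ENNReal.ofReal (dec m ((t - c.1) / R)))
          (g := fun t => ENNReal.ofReal (dec m ((t - c.2) / R))) (by fun_prop) (by fun_prop)
    _ ≤ C * ENNReal.ofReal R * (C * ENNReal.ofReal R) :=
        mul_le_mul' (hC _ hm _ _ hR) (hC _ hm _ _ hR)
    _ = _ := by rw [sq, ENNReal.ofReal_mul hR.le]; push_cast; ring

/-- The extra decay of a product weight absorbs the growth of a slowly varying weight. -/
theorem rad_pow_mul_prodDec_le (m n : ℕ) (q x : ℝ × ℝ) {R : ℝ} (hR : 0 < R) :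
    (1 + rad (q - x) / R) ^ n * prodDec (m + n) q R x ≤ prodDec m x R q := by
  have h1 := one_add_rad_le (q - x) hR
  have h0 := div_nonneg (rad_nonneg (q - x)) hR.le
  rw [prodDec, prodDec, ← neg_sub q.1, ← neg_sub q.2, neg_div, neg_div, dec_neg, dec_neg,
    dec_add m n, dec_add m n, dec.eq_def n, dec.eq_def n]
  rw [Prod.fst_sub, Prod.snd_sub] at h1
  have h2 := pow_le_pow_left₀ (by positivity) h1 n
  rw [mul_pow] at h2
  refine (mul_le_mul_of_nonneg_right h2 (mul_nonneg (mul_nonneg (dec_pos _ _).le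
    (by positivity)) (mul_nonneg (dec_pos _ _).le (by positivity)))).trans (le_of_eq ?_)
  field_simp

/-- Decoupling with respect to a weight that varies slowly at the scale of the squares. -/
theorem exists_linear_decoupling_weight (K : ℝ≥0) : ∃ C : ℝ≥0, ∀ (N : ℕ) (δ R : ℝ) (g : ℝ → ℂ)
    (V : ℝ × ℝ → ℝ≥0∞), 0 < N → N * δ = 1 → R * δ ^ 2 = 1 → IntegrableOn g (Set.Icc 0 1) →
    Measurable V → (∀ x q, V x ≤ K * ENNReal.ofReal ((1 + rad (x - q) / R) ^ 100) * V q) →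
    ∫⁻ x, ‖extend 0 1 g x‖ₑ ^ (6 : ℝ) * V x ≤
      C * (linearConst (1 / (N : ℝ)) ^ (6 : ℝ) * (∑ k ∈ Finset.range N,
        (∫⁻ x, ‖extend (k * δ) δ g x‖ₑ ^ (6 : ℝ) * V x) ^ (1 / 3 : ℝ)) ^ (3 : ℝ)) := by
  obtain ⟨C₁, hC₁⟩ := exists_average_squares K
  obtain ⟨C₂, hC₂⟩ := exists_linear_decoupling_prodDec
  obtain ⟨C₃, hC₃⟩ := exists_lintegral_prodDec_le
  refine ⟨C₁ * (C₂ * (K * C₃)), fun N δ R g V hN hδ hRδ hg hV hVs => ?_⟩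
  have hδ0 : 0 < δ := pos_of_mul_pos_right (by rw [hδ]; exact one_pos) (Nat.cast_nonneg N)
  have hd : δ = 1 / N := by rw [eq_div_iff (by positivity), mul_comm, hδ]
  have hR : 0 < R := by rw [eq_inv_of_mul_eq_one_left hRδ]; positivity
  have hg01 : IntegrableOn g (Set.Icc 0 (0 + 1)) := by rwa [zero_add]
  have hgj : ∀ j ∈ Finset.range N, IntegrableOn g (Set.Icc (j * δ) (j * δ + δ)) := fun j hj => by
    rw [hd]; exact integrableOn_piece_one hN hg (Finset.mem_range.1 hj)
  have hU : Measurable (Function.uncurry fun x q : ℝ × ℝ => ENNReal.ofReal (prodDec 118 q R x)) := by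
    simp only [Function.uncurry_def, prodDec]; fun_prop
  have hc : ∀ c, ∫⁻ x in square c R, ‖extend 0 1 g x‖ₑ ^ (6 : ℝ) ≤ _ := hC₂ N δ R g hN hδ hRδ hg
  generalize linearConst (1 / (N : ℝ)) ^ (6 : ℝ) = D at hc ⊢
  have hm : ∀ k ∈ Finset.range N, Measurable fun q => V q * ∫⁻ x, ‖extend (k * δ) δ g x‖ₑ ^ (6 : ℝ) *
      ENNReal.ofReal (prodDec 118 q R x) := fun k hk => by
    refine hV.mul (Measurable.lintegral_prod_right' (f := fun p : (ℝ × ℝ) × (ℝ × ℝ) =>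
      ‖extend (k * δ) δ g p.2‖ₑ ^ (6 : ℝ) * ENNReal.ofReal (prodDec 118 p.1 R p.2)) ?_)
    have h1 : Measurable fun p : (ℝ × ℝ) × (ℝ × ℝ) => ENNReal.ofReal (prodDec 118 p.1 R p.2) := by
      simp only [prodDec]; fun_prop
    have h2 : Measurable fun p : (ℝ × ℝ) × (ℝ × ℝ) => ‖extend (k * δ) δ g p.2‖ₑ ^ (6 : ℝ) :=
      (measurable_enorm_rpow_extend (hgj k hk) 6).comp measurable_snd
    exact h2.mul h1
  have hq : ∀ k ∈ Finset.range N, ∫⁻ q, V q * ∫⁻ x, ‖extend (k * δ) δ g x‖ₑ ^ (6 : ℝ) *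
      ENNReal.ofReal (prodDec 118 q R x) ≤ (K * C₃ * ENNReal.ofReal (R ^ 2)) *
        ∫⁻ x, ‖extend (k * δ) δ g x‖ₑ ^ (6 : ℝ) * V x := fun k hk => by
    rw [lintegral_mul_lintegral_swap (measurable_enorm_rpow_extend (hgj k hk) 6) hV hU,
      ← lintegral_const_mul' _ _ (by finiteness)]
    refine lintegral_mono fun x => ?_
    rw [mul_left_comm]
    refine mul_le_mul' le_rfl ?_
    calc _ ≤ ∫⁻ q, (K * V x) * ENNReal.ofReal (prodDec 18 x R q) := by
          refine lintegral_mono fun q => ?_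
          refine (mul_le_mul' (hVs q x) le_rfl).trans ?_
          have h : (1 + rad (q - x) / R) ^ 100 * prodDec 118 q R x ≤ prodDec 18 x R q :=
            rad_pow_mul_prodDec_le 18 100 q x hR
          calc _ = K * V x * ENNReal.ofReal ((1 + rad (q - x) / R) ^ 100 * prodDec 118 q R x) := by
                have h0 := div_nonneg (rad_nonneg (q - x)) hR.le
                rw [ENNReal.ofReal_mul (by positivity), mul_right_comm _ _ (V x), mul_assoc (K * V x)]
            _ ≤ _ := mul_le_mul' le_rfl (ENNReal.ofReal_le_ofReal h)
      _ = (K * V x) * ∫⁻ q, ENNReal.ofReal (prodDec 18 x R q) :=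
          lintegral_const_mul _ (by fun_prop)
      _ ≤ (K * V x) * (C₃ * ENNReal.ofReal (R ^ 2)) := by
          gcongr; exact hC₃ 18 (by norm_num) x R hR
      _ = _ := by ring
  have hR2 : ENNReal.ofReal (R ^ 2) ≠ 0 := by
    rw [Ne, ENNReal.ofReal_eq_zero, not_le]; positivity
  refine (ENNReal.mul_le_mul_iff_right hR2 ENNReal.ofReal_ne_top).1 ?_
  calc _ ≤ C₁ * ∫⁻ q, V q * ∫⁻ x in square q R, ‖extend 0 1 g x‖ₑ ^ (6 : ℝ) :=
        hC₁ R hR V _ hV (measurable_enorm_rpow_extend hg01 6) hVs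
    _ ≤ C₁ * ∫⁻ q, (C₂ * D) * (∑ k ∈ Finset.range N, (V q * ∫⁻ x, ‖extend (k * δ) δ g x‖ₑ ^ (6 : ℝ) *
          ENNReal.ofReal (prodDec 118 q R x)) ^ (1 / 3 : ℝ)) ^ (3 : ℝ) := by
        refine mul_le_mul' le_rfl (lintegral_mono fun q => ?_)
        refine (mul_le_mul' le_rfl (hc q)).trans (le_of_eq ?_)
        simp only [ENNReal.mul_rpow_of_nonneg (V q) _ (by norm_num : (0 : ℝ) ≤ 1 / 3)]
        rw [← Finset.mul_sum, ENNReal.mul_rpow_of_nonneg _ _ (by norm_num : (0 : ℝ) ≤ 3),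
          rpow_cubeRoot]
        ring
    _ ≤ C₁ * ((C₂ * D) * (∑ k ∈ Finset.range N, (∫⁻ q, V q * ∫⁻ x, ‖extend (k * δ) δ g x‖ₑ ^ (6 : ℝ) *
          ENNReal.ofReal (prodDec 118 q R x)) ^ (1 / 3 : ℝ)) ^ (3 : ℝ)) := by
        rw [lintegral_const_mul'']
        · exact mul_le_mul' le_rfl (mul_le_mul' le_rfl
            (lintegral_sum_cubeRoot_le _ fun k hk => (hm k hk).aemeasurable))
        · exact ((Finset.measurable_fun_sum _ fun k hk =>
            (hm k hk).pow_const _).pow_const _).aemeasurable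
    _ ≤ C₁ * ((C₂ * D) * (∑ k ∈ Finset.range N, ((K * C₃ * ENNReal.ofReal (R ^ 2)) *
          ∫⁻ x, ‖extend (k * δ) δ g x‖ₑ ^ (6 : ℝ) * V x) ^ (1 / 3 : ℝ)) ^ (3 : ℝ)) := by
        gcongr with k hk; exact hq k hk
    _ = _ := by
        simp only [ENNReal.mul_rpow_of_nonneg (K * C₃ * ENNReal.ofReal (R ^ 2)) _
          (by norm_num : (0 : ℝ) ≤ 1 / 3)]
        rw [← Finset.mul_sum, ENNReal.mul_rpow_of_nonneg _ _ (by norm_num : (0 : ℝ) ≤ 3),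
          rpow_cubeRoot]
        push_cast; ring

/-- The linear change of variables that maps the parabola over `[a, a + σ]` to the parabola over the
unit interval. -/
def shear (a σ : ℝ) (x : ℝ × ℝ) : ℝ × ℝ := (σ * (x.1 + 2 * a * x.2), σ ^ 2 * x.2)

/-- The inverse of `shear a σ`. -/
def unshear (a σ : ℝ) (u : ℝ × ℝ) : ℝ × ℝ := (u.1 / σ - 2 * a * (u.2 / σ ^ 2), u.2 / σ ^ 2)

@[fun_prop] theorem continuous_shear (a σ : ℝ) : Continuous (shear a σ) := by
  unfold shear; fun_prop

@[fun_prop] theorem continuous_unshear (a σ : ℝ) : Continuous (unshear a σ) := by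
  unfold unshear; fun_prop

theorem unshear_shear (a : ℝ) {σ : ℝ} (hσ : σ ≠ 0) (x : ℝ × ℝ) : unshear a σ (shear a σ x) = x := by
  ext <;> simp only [shear, unshear] <;> field_simp
  ring

theorem unshear_sub (a σ : ℝ) (u v : ℝ × ℝ) :
    unshear a σ (u - v) = unshear a σ u - unshear a σ v := by
  ext <;> simp only [unshear, Prod.fst_sub, Prod.snd_sub] <;> ring

theorem lintegral_comp_shear (a : ℝ) {σ : ℝ} (hσ : 0 < σ) {F : ℝ × ℝ → ℝ≥0∞} (hF : Measurable F) :
    ∫⁻ x, F (shear a σ x) = ENNReal.ofReal σ⁻¹ * ENNReal.ofReal (σ ^ 2)⁻¹ * ∫⁻ u, F u := by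
  have h1 : ∀ t : ℝ, ∫⁻ s, F (shear a σ (s, t)) = ENNReal.ofReal σ⁻¹ * ∫⁻ s, F (s, σ ^ 2 * t) := by
    intro t
    rw [← lintegral_comp_sub_div (f := fun s => F (s, σ ^ 2 * t)) (hF.comp measurable_prodMk_right)
      (-(2 * a * t)) (inv_pos.2 hσ)]
    refine lintegral_congr fun s => ?_
    rw [shear, div_inv_eq_mul, sub_neg_eq_add, mul_comm]
  have h2 : Measurable fun t => ∫⁻ s, F (s, t) := Measurable.lintegral_prod_left' hF
  have h3 : Measurable fun x => F (shear a σ x) := hF.comp (continuous_shear a σ).measurable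
  rw [Measure.volume_eq_prod, lintegral_prod_symm _ h3.aemeasurable,
    lintegral_prod_symm _ hF.aemeasurable]
  simp only [h1]
  rw [lintegral_const_mul' _ _ ENNReal.ofReal_ne_top, mul_assoc]
  congr 1
  rw [← lintegral_comp_sub_div h2 0 (by positivity)]
  refine lintegral_congr fun t => ?_
  rw [sub_zero, div_inv_eq_mul, mul_comm t]

theorem rad_unshear_le {a σ : ℝ} (ha : 0 ≤ a) (ha1 : a ≤ 1) (hσ : 0 < σ) (hσ1 : σ ≤ 1)
    (u : ℝ × ℝ) : rad (unshear a σ u) ≤ 4 * (rad u / σ ^ 2) := by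
  have h1 : |u.1| / σ ≤ rad u / σ ^ 2 := by
    refine div_le_div₀ (rad_nonneg u) (abs_fst_le_rad u) (by positivity) (by nlinarith)
  have h2 : |u.2| / σ ^ 2 ≤ rad u / σ ^ 2 := by gcongr; exact abs_snd_le_rad u
  have h3 : 0 ≤ |u.2| / σ ^ 2 := by positivity
  calc _ ≤ |u.1 / σ - 2 * a * (u.2 / σ ^ 2)| + |u.2 / σ ^ 2| := rad_le _
    _ ≤ |u.1 / σ| + |2 * a * (u.2 / σ ^ 2)| + |u.2 / σ ^ 2| := by gcongr; exact abs_sub _ _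
    _ = |u.1| / σ + 2 * a * (|u.2| / σ ^ 2) + |u.2| / σ ^ 2 := by
        rw [abs_div, abs_mul, abs_div, abs_of_pos hσ, abs_of_pos (by positivity : 0 < σ ^ 2),
          abs_of_nonneg (by positivity : 0 ≤ 2 * a)]
    _ ≤ _ := by nlinarith

theorem enorm_extend_shear {a σ ℓ : ℝ} (hσ : 0 < σ) (hℓ : 0 ≤ ℓ) (α : ℝ) (g : ℝ → ℂ) (x : ℝ × ℝ) :
    ‖extend (a + σ * α) (σ * ℓ) g x‖ₑ =
      ENNReal.ofReal σ * ‖extend α ℓ (fun η => g (a + σ * η)) (shear a σ x)‖ₑ := by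
  rw [extend_affine hσ hℓ, enorm_mul, enorm_mul, enorm_osc, mul_one, shear, ← ofReal_norm (σ : ℂ),
    Complex.norm_real, Real.norm_of_nonneg hσ.le]

/-- Parabolic rescaling: decoupling an interval of length `σ` into intervals of length `δ` costs
`linearConst (δ / σ)`. -/
theorem exists_rescaled_decoupling : ∃ C : ℝ≥0, ∀ (N : ℕ) (a σ δ R : ℝ) (g : ℝ → ℂ), 0 < N →
    0 ≤ a → a ≤ 1 → 0 < σ → σ ≤ 1 → N * δ = σ → R * δ ^ 2 = 1 →
    IntegrableOn g (Set.Icc a (a + σ)) → ∀ c,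
    ∫⁻ x, ‖extend a σ g x‖ₑ ^ (6 : ℝ) * ENNReal.ofReal (weight c R x) ≤
      C * (linearConst (1 / (N : ℝ)) ^ (6 : ℝ) * (∑ k ∈ Finset.range N,
        (∫⁻ x, ‖extend (a + k * δ) δ g x‖ₑ ^ (6 : ℝ) *
          ENNReal.ofReal (weight c R x)) ^ (1 / 3 : ℝ)) ^ (3 : ℝ)) := by
  obtain ⟨A, hA⟩ : ∃ A : ℝ, A = 4 ^ 100 := ⟨_, rfl⟩
  have hA0 : 0 ≤ A := by rw [hA]; positivity
  obtain ⟨C, hC⟩ := exists_linear_decoupling_weight A.toNNReal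
  refine ⟨C, fun N a σ δ R g hN ha ha1 hσ hσ1 hδ hRδ hg c => ?_⟩
  have hδ0 : 0 < δ := pos_of_mul_pos_right (by rw [hδ]; exact hσ) (Nat.cast_nonneg N)
  have hR : 0 < R := by rw [eq_inv_of_mul_eq_one_left hRδ]; positivity
  let h : ℝ → ℂ := fun η => g (a + σ * η)
  have hh : IntegrableOn h (Set.Icc 0 1) := by
    have := integrableOn_affine (σ := σ) (ℓ := 1) (a := a) (α := 0) hσ (g := g) (by simpa using hg)
    simpa using this
  -- The pulled back weight varies slowly at scale `σ ^ 2 * R`, the scale of the squares for the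
  -- rescaled problem. The constant `4` comes from `rad_unshear_le`.
  let V : ℝ × ℝ → ℝ≥0∞ := fun u => ENNReal.ofReal (weight c R (unshear a σ u))
  have hV : Measurable V := (measurable_weight c hR).comp (by fun_prop)
  have hVs : ∀ x q, V x ≤
      A.toNNReal * ENNReal.ofReal ((1 + rad (x - q) / (σ ^ 2 * R)) ^ 100) * V q := fun x q => by
    have h0 : 0 ≤ rad (x - q) / (σ ^ 2 * R) := div_nonneg (rad_nonneg _) (by positivity)
    change _ ≤ ENNReal.ofReal A * _ * ENNReal.ofReal _
    rw [← ENNReal.ofReal_mul hA0, ← ENNReal.ofReal_mul (by positivity)]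
    refine ENNReal.ofReal_le_ofReal ?_
    have h1 := weight_shift c hR (unshear a σ x) (unshear a σ q - unshear a σ x)
    rw [add_sub_cancel, ← neg_sub, rad_neg, ← unshear_sub] at h1
    refine h1.trans (mul_le_mul_of_nonneg_right ?_ (weight_nonneg c hR _))
    rw [hA, ← mul_pow]
    have h2 := div_nonneg (rad_nonneg (unshear a σ (x - q))) hR.le
    refine pow_le_pow_left₀ (by positivity) ?_ 100
    have h3 := div_le_div_of_nonneg_right (rad_unshear_le ha ha1 hσ hσ1 (x - q)) hR.le
    rw [mul_div_assoc, div_div] at h3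
    linarith
  have hmain := hC N (δ / σ) (σ ^ 2 * R) h V hN (by rw [← mul_div_assoc, hδ, div_self hσ.ne'])
    (by rw [div_pow]; field_simp; linarith) hh hV hVs
  obtain ⟨κ, hκ⟩ : ∃ κ : ℝ≥0∞, κ = ENNReal.ofReal σ ^ (6 : ℝ) *
    (ENNReal.ofReal σ⁻¹ * ENNReal.ofReal (σ ^ 2)⁻¹) := ⟨_, rfl⟩
  have hpiece : ∀ α ℓ, 0 ≤ ℓ → IntegrableOn h (Set.Icc α (α + ℓ)) →
      ∫⁻ x, ‖extend (a + σ * α) (σ * ℓ) g x‖ₑ ^ (6 : ℝ) * ENNReal.ofReal (weight c R x) =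
        κ * ∫⁻ u, ‖extend α ℓ h u‖ₑ ^ (6 : ℝ) * V u := fun α ℓ hℓ hi => by
    have hm : Measurable fun u => ‖extend α ℓ h u‖ₑ ^ (6 : ℝ) * V u :=
      (measurable_enorm_rpow_extend hi 6).mul hV
    rw [hκ, mul_assoc, ← lintegral_comp_shear a hσ hm,
      ← lintegral_const_mul' _ _ (by finiteness)]
    refine lintegral_congr fun x => ?_
    rw [enorm_extend_shear hσ hℓ, ENNReal.mul_rpow_of_nonneg _ _ (by norm_num)]
    simp only [V, unshear_shear a hσ.ne', h]
    ring
  have e1 := hpiece 0 1 zero_le_one (by simpa using hh)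
  rw [mul_zero, add_zero, mul_one] at e1
  have e2 : ∀ k ∈ Finset.range N, (∫⁻ x, ‖extend (a + k * δ) δ g x‖ₑ ^ (6 : ℝ) *
      ENNReal.ofReal (weight c R x)) ^ (1 / 3 : ℝ) = κ ^ (1 / 3 : ℝ) *
        (∫⁻ u, ‖extend (k * (δ / σ)) (δ / σ) h u‖ₑ ^ (6 : ℝ) * V u) ^ (1 / 3 : ℝ) := fun k hk => by
    have hi : IntegrableOn h (Set.Icc (k * (δ / σ)) (k * (δ / σ) + δ / σ)) := by
      have hd : δ / σ = 1 / N := by rw [← hδ]; field_simp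
      rw [hd]; exact integrableOn_piece_one hN hh (Finset.mem_range.1 hk)
    have := hpiece (k * (δ / σ)) (δ / σ) (by positivity) hi
    rw [mul_left_comm, mul_div_cancel₀ _ hσ.ne'] at this
    rw [this, ENNReal.mul_rpow_of_nonneg _ _ (by norm_num)]
  rw [e1, Finset.sum_congr rfl e2, ← Finset.mul_sum, ENNReal.mul_rpow_of_nonneg _ _
    (by norm_num : (0 : ℝ) ≤ 3), rpow_cubeRoot]
  calc _ ≤ _ := mul_le_mul' le_rfl hmain
    _ = _ := by ring

/-! ### Ball inflation for a pair of short intervals -/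

/-- A sum over an arithmetic progression with step `h` is comparable to the integral. -/
theorem exists_sum_dec_le : ∃ C : ℝ≥0, ∀ h : ℝ, h ≠ 0 → |h| ≤ 2 → ∀ (γ : ℝ) (N : ℕ),
    ∑ j ∈ Finset.range N, ENNReal.ofReal (dec 2 (h * j + γ)) ≤ C * ENNReal.ofReal |h|⁻¹ := by
  obtain ⟨C, hC⟩ := exists_lintegral_dec_le
  refine ⟨9 * C, fun h hh hh2 γ N => ?_⟩
  have hm : Measurable fun t : ℝ => ENNReal.ofReal (dec 2 (h * t + γ)) := by fun_prop
  have hI : ∫⁻ t, ENNReal.ofReal (dec 2 (h * t + γ)) ≤ C * ENNReal.ofReal |h|⁻¹ := by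
    have := hC 2 le_rfl (-(γ / h)) |h|⁻¹ (by positivity)
    refine le_trans (le_of_eq (lintegral_congr fun t => ?_)) this
    refine congrArg ENNReal.ofReal ?_
    rw [div_inv_eq_mul, sub_neg_eq_add, show h * t + γ = (t + γ / h) * h by field_simp]
    simp only [dec, abs_mul, abs_abs]
  have hterm : ∀ j : ℕ, ENNReal.ofReal (dec 2 (h * j + γ)) ≤
      9 * ∫⁻ t in Set.Ico (j : ℝ) (j + 1), ENNReal.ofReal (dec 2 (h * t + γ)) := fun j => by
    have h1 : ENNReal.ofReal (dec 2 (h * j + γ)) = ∫⁻ t in Set.Ico (j : ℝ) (j + 1),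
        ENNReal.ofReal (dec 2 (h * j + γ)) := by simp
    rw [h1, ← lintegral_const_mul _ hm]
    refine setLIntegral_mono' measurableSet_Ico fun t ht => ?_
    rw [show (9 : ℝ≥0∞) = ENNReal.ofReal 9 by norm_num, ← ENNReal.ofReal_mul (by norm_num)]
    refine ENNReal.ofReal_le_ofReal ((dec_shift 2 _ (h * (t - j))).trans ?_)
    rw [show h * j + γ + h * (t - j) = h * t + γ by ring]
    refine mul_le_mul_of_nonneg_right ?_ (dec_pos _ _).le
    have h2 : |h * (t - j)| ≤ 2 := by
      rw [abs_mul, abs_of_nonneg (sub_nonneg.2 ht.1)]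
      nlinarith [ht.1, ht.2, abs_nonneg h]
    calc (1 + |h * (t - j)|) ^ 2 ≤ (1 + 2) ^ 2 := by gcongr
      _ = 9 := by norm_num
  have hdisj : Set.PairwiseDisjoint (↑(Finset.range N)) fun j : ℕ => Set.Ico (j : ℝ) (j + 1) := by
    intro i _ j _ hij
    refine Set.disjoint_left.2 fun t h1 h2 => hij ?_
    have h3 : (i : ℝ) < j + 1 := h1.1.trans_lt h2.2
    have h4 : (j : ℝ) < i + 1 := h2.1.trans_lt h1.2
    norm_cast at h3 h4
    omega
  calc _ ≤ ∑ j ∈ Finset.range N, 9 * ∫⁻ t in Set.Ico (j : ℝ) (j + 1),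
          ENNReal.ofReal (dec 2 (h * t + γ)) := Finset.sum_le_sum fun j _ => hterm j
    _ = 9 * ∫⁻ t in ⋃ j ∈ Finset.range N, Set.Ico (j : ℝ) (j + 1),
          ENNReal.ofReal (dec 2 (h * t + γ)) := by
        rw [lintegral_biUnion_finset hdisj fun _ _ => measurableSet_Ico, Finset.mul_sum]
    _ ≤ 9 * (C * ENNReal.ofReal |h|⁻¹) := by
        gcongr; exact (setLIntegral_le_lintegral _ _).trans hI
    _ = _ := by push_cast; ring

/-- The modulus of an extension from the unit interval is essentially constant at unit scale. -/
theorem exists_locally_constant_one (m : ℕ) : ∃ C : ℝ≥0, ∀ g : ℝ → ℂ,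
    IntegrableOn g (Set.Icc 0 1) → ∀ u, ‖extend 0 1 g u‖ₑ ^ (2 : ℝ) ≤
      C * ∫⁻ v, ‖extend 0 1 g v‖ₑ ^ (2 : ℝ) * ENNReal.ofReal (prodDec m u 1 v) := by
  obtain ⟨ψ, hψc, hψi, hψd, hψ⟩ := exists_reproducing 1 one_pos
  obtain ⟨C, hC, hd⟩ := hψd m
  have hI : ∫⁻ v : ℝ × ℝ, ‖ψ v.1 * ψ v.2‖ₑ ≠ ∞ := (hψi.mul_prod hψi).2.ne
  refine ⟨(∫⁻ v : ℝ × ℝ, ‖ψ v.1 * ψ v.2‖ₑ).toNNReal * (C * C).toNNReal, fun g hg u => ?_⟩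
  have hg01 : IntegrableOn g (Set.Icc 0 (0 + 1)) := by rwa [zero_add]
  have hrep : extend 0 1 g u = ∫ v : ℝ × ℝ, ψ v.1 * ψ v.2 * extend 0 1 g (u - v) := by
    have e : ∀ v : ℝ × ℝ, ψ v.1 * ψ v.2 * extend 0 1 g (u - v) = ∫ ξ in Set.Icc (0 : ℝ) (0 + 1),
        ψ v.1 * ψ v.2 * g ξ * osc (ξ * (u.1 - v.1) + ξ ^ 2 * (u.2 - v.2)) := fun v => by
      rw [extend_eq, ← integral_const_mul]
      simp only [Prod.fst_sub, Prod.snd_sub, mul_assoc]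
    simp only [e]
    rw [integral_integral_swap, extend_eq]
    · refine setIntegral_congr_fun measurableSet_Icc fun ξ hξ => ?_
      have hξ1 : |ξ| ≤ 1 := by rw [abs_le]; constructor <;> linarith [hξ.1, hξ.2]
      have hξ2 : |ξ ^ 2| ≤ 1 := by rw [abs_pow]; exact pow_le_one₀ (abs_nonneg _) hξ1
      have e2 : ∀ v : ℝ × ℝ, ψ v.1 * ψ v.2 * g ξ * osc (ξ * (u.1 - v.1) + ξ ^ 2 * (u.2 - v.2)) =
          g ξ * osc (ξ * u.1 + ξ ^ 2 * u.2) *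
            ((ψ v.1 * osc (-(v.1 * ξ))) * (ψ v.2 * osc (-(v.2 * ξ ^ 2)))) := fun v => by
        rw [show ξ * (u.1 - v.1) + ξ ^ 2 * (u.2 - v.2) =
          (ξ * u.1 + ξ ^ 2 * u.2) + -(v.1 * ξ) + -(v.2 * ξ ^ 2) by ring, osc_add, osc_add]
        ring
      simp only [e2]
      rw [integral_const_mul, Measure.volume_eq_prod, integral_prod_mul (fun v => ψ v * osc (-(v * ξ)))
        (fun v => ψ v * osc (-(v * ξ ^ 2))), hψ ξ hξ1, hψ _ hξ2, mul_one, mul_one]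
    · exact integrable_mul_osc ((hψi.mul_prod hψi).mul_prod hg01) (φ := fun p : (ℝ × ℝ) × ℝ =>
        p.2 * (u.1 - p.1.1) + p.2 ^ 2 * (u.2 - p.1.2)) (by fun_prop)
  have hm1 : Measurable fun v => ‖extend 0 1 g (u - v)‖ₑ :=
    ((continuous_extend hg01).comp (by fun_prop)).enorm.measurable
  have hm2 : Measurable fun v : ℝ × ℝ => ‖ψ v.1 * ψ v.2‖ₑ :=
    ((hψc.comp continuous_fst).mul (hψc.comp continuous_snd)).enorm.measurable
  have hJ := lintegral_mul_rpow_le (μ := volume) (p := 2) (by norm_num) hm1.aemeasurable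
    hm2.aemeasurable
  rw [show (2 : ℝ) - 1 = 1 by norm_num, ENNReal.rpow_one] at hJ
  calc _ ≤ (∫⁻ v : ℝ × ℝ, ‖extend 0 1 g (u - v)‖ₑ * ‖ψ v.1 * ψ v.2‖ₑ) ^ (2 : ℝ) := by
        rw [hrep]
        refine ENNReal.rpow_le_rpow ((enorm_integral_le_lintegral_enorm _).trans (le_of_eq ?_))
          (by norm_num)
        exact lintegral_congr fun v => by rw [enorm_mul, mul_comm]
    _ ≤ _ := hJ
    _ ≤ (∫⁻ v : ℝ × ℝ, ‖ψ v.1 * ψ v.2‖ₑ) * ∫⁻ v, (C * C).toNNReal *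
          (‖extend 0 1 g (u - v)‖ₑ ^ (2 : ℝ) * ENNReal.ofReal (prodDec m u 1 (u - v))) := by
        refine mul_le_mul' le_rfl (lintegral_mono fun v => ?_)
        rw [mul_left_comm]
        refine mul_le_mul' le_rfl ?_
        change _ ≤ ENNReal.ofReal (C * C) * _
        rw [← ENNReal.ofReal_mul (by positivity), ← ofReal_norm, norm_mul]
        refine ENNReal.ofReal_le_ofReal ?_
        simp only [prodDec, Prod.fst_sub, Prod.snd_sub, div_one, sub_sub_cancel_left, dec_neg]
        calc _ ≤ (C * dec m v.1) * (C * dec m v.2) :=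
              mul_le_mul (hd _) (hd _) (norm_nonneg _) (mul_nonneg hC.le (dec_pos _ _).le)
          _ = _ := by ring
    _ = _ := by
        rw [lintegral_const_mul' _ _ ENNReal.coe_ne_top, lintegral_sub_left_eq_self
          (fun v => ‖extend 0 1 g v‖ₑ ^ (2 : ℝ) * ENNReal.ofReal (prodDec m u 1 v)) u,
          ENNReal.coe_mul, ENNReal.coe_toNNReal hI, mul_assoc]

/-- The modulus of an extension from a short interval is essentially constant on translates of the
box dual to the arc over that interval. -/
theorem exists_locally_constant (m : ℕ) : ∃ C : ℝ≥0, ∀ (a σ : ℝ) (g : ℝ → ℂ), 0 < σ →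
    IntegrableOn g (Set.Icc a (a + σ)) → ∀ x, ‖extend a σ g x‖ₑ ^ (2 : ℝ) ≤
      C * (ENNReal.ofReal (σ ^ 3) * ∫⁻ y, ‖extend a σ g y‖ₑ ^ (2 : ℝ) *
        ENNReal.ofReal (prodDec m (shear a σ x) 1 (shear a σ y))) := by
  obtain ⟨C, hC⟩ := exists_locally_constant_one m
  refine ⟨C, fun a σ g hσ hg x => ?_⟩
  let h : ℝ → ℂ := fun η => g (a + σ * η)
  have hh : IntegrableOn h (Set.Icc 0 1) := by
    have := integrableOn_affine (σ := σ) (ℓ := 1) (a := a) (α := 0) hσ (g := g) (by simpa using hg)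
    simpa using this
  have he : ∀ x, ‖extend a σ g x‖ₑ = ENNReal.ofReal σ * ‖extend 0 1 h (shear a σ x)‖ₑ := fun x => by
    have := enorm_extend_shear (a := a) hσ zero_le_one 0 g x
    rwa [mul_zero, add_zero, mul_one] at this
  have hm : Measurable fun v => ‖extend 0 1 h v‖ₑ ^ (2 : ℝ) *
      ENNReal.ofReal (prodDec m (shear a σ x) 1 v) :=
    (measurable_enorm_rpow_extend (by rwa [zero_add]) 2).mul (by fun_prop)
  have hcv := lintegral_comp_shear a hσ hm
  have hone : ENNReal.ofReal (σ ^ 3) * (ENNReal.ofReal σ⁻¹ * ENNReal.ofReal (σ ^ 2)⁻¹) = 1 := by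
    rw [← ENNReal.ofReal_mul (by positivity), ← ENNReal.ofReal_mul (by positivity),
      ← ENNReal.ofReal_one]
    refine congrArg ENNReal.ofReal ?_
    field_simp
  simp only [he, ENNReal.mul_rpow_of_nonneg (ENNReal.ofReal σ) _ (by norm_num : (0 : ℝ) ≤ 2),
    mul_assoc (ENNReal.ofReal σ ^ (2 : ℝ))]
  rw [lintegral_const_mul' _ _ (by finiteness), hcv]
  calc _ ≤ ENNReal.ofReal σ ^ (2 : ℝ) * (C * ∫⁻ v, ‖extend 0 1 h v‖ₑ ^ (2 : ℝ) *
          ENNReal.ofReal (prodDec m (shear a σ x) 1 v)) := mul_le_mul' le_rfl (hC h hh _)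
    _ = (ENNReal.ofReal (σ ^ 3) * (ENNReal.ofReal σ⁻¹ * ENNReal.ofReal (σ ^ 2)⁻¹)) *
          (ENNReal.ofReal σ ^ (2 : ℝ) * (C * ∫⁻ v, ‖extend 0 1 h v‖ₑ ^ (2 : ℝ) *
          ENNReal.ofReal (prodDec m (shear a σ x) 1 v))) := by rw [hone, one_mul]
    _ = _ := by ring

theorem prodDec_comm (m : ℕ) (x y : ℝ × ℝ) (R : ℝ) : prodDec m x R y = prodDec m y R x := by
  rw [prodDec, prodDec, ← neg_sub y.1, ← neg_sub y.2, neg_div, neg_div, dec_neg, dec_neg]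

theorem measurable_prodDec_shear (m : ℕ) (a σ : ℝ) : Measurable (Function.uncurry
    fun y x : ℝ × ℝ => ENNReal.ofReal (prodDec m (shear a σ x) 1 (shear a σ y))) := by
  simp only [Function.uncurry_def, prodDec, shear]; fun_prop

/-- The weight of the square with centre `z` and side length `σ⁻¹`, smeared out over the box dual to
the arc over `[a, a + σ]`. -/
def envelope (a σ : ℝ) (z y : ℝ × ℝ) : ℝ≥0∞ :=
  ENNReal.ofReal (σ ^ 5) * ∫⁻ x, ENNReal.ofReal (weight z σ⁻¹ x) *
    ENNReal.ofReal (prodDec 104 (shear a σ x) 1 (shear a σ y))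

theorem measurable_envelope (a : ℝ) {σ : ℝ} (hσ : 0 < σ) (z : ℝ × ℝ) :
    Measurable (envelope a σ z) := by
  refine Measurable.const_mul (Measurable.lintegral_prod_right' (f := fun p : (ℝ × ℝ) × (ℝ × ℝ) =>
    ENNReal.ofReal (weight z σ⁻¹ p.2) *
      ENNReal.ofReal (prodDec 104 (shear a σ p.2) 1 (shear a σ p.1))) ?_) _
  exact ((measurable_weight z (inv_pos.2 hσ)).comp measurable_snd).mul
    (measurable_prodDec_shear 104 a σ)

/-- The average of `‖extend a σ g‖ ^ 2` on a small square, with the weight replaced by its envelope. -/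
theorem exists_average_le_envelope : ∃ C : ℝ≥0, ∀ (a σ : ℝ) (g : ℝ → ℂ), 0 < σ →
    IntegrableOn g (Set.Icc a (a + σ)) → ∀ z,
    ENNReal.ofReal (σ⁻¹ ^ 2)⁻¹ * ∫⁻ x, ‖extend a σ g x‖ₑ ^ (2 : ℝ) * ENNReal.ofReal (weight z σ⁻¹ x) ≤
      C * ∫⁻ y, ‖extend a σ g y‖ₑ ^ (2 : ℝ) * envelope a σ z y := by
  obtain ⟨C, hC⟩ := exists_locally_constant 104
  refine ⟨C, fun a σ g hσ hg z => ?_⟩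
  have hU := measurable_prodDec_shear 104 a σ
  have hsw := lintegral_mul_lintegral_swap (μ := volume) (ν := volume)
    (measurable_enorm_rpow_extend hg 2) (measurable_weight z (inv_pos.2 hσ)) hU
  have h5 : ENNReal.ofReal (σ⁻¹ ^ 2)⁻¹ * ENNReal.ofReal (σ ^ 3) = ENNReal.ofReal (σ ^ 5) := by
    rw [← ENNReal.ofReal_mul (by positivity)]
    refine congrArg ENNReal.ofReal ?_
    field_simp
  calc _ ≤ ENNReal.ofReal (σ⁻¹ ^ 2)⁻¹ * ∫⁻ x, (C * ENNReal.ofReal (σ ^ 3)) *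
          (ENNReal.ofReal (weight z σ⁻¹ x) * ∫⁻ y, ‖extend a σ g y‖ₑ ^ (2 : ℝ) *
            ENNReal.ofReal (prodDec 104 (shear a σ x) 1 (shear a σ y))) := by
        refine mul_le_mul' le_rfl (lintegral_mono fun x => ?_)
        refine (mul_le_mul' (hC a σ g hσ hg x) le_rfl).trans (le_of_eq (by ring))
    _ = C * ∫⁻ y, (ENNReal.ofReal (σ⁻¹ ^ 2)⁻¹ * ENNReal.ofReal (σ ^ 3)) *
          (‖extend a σ g y‖ₑ ^ (2 : ℝ) * ∫⁻ x, ENNReal.ofReal (weight z σ⁻¹ x) *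
            ENNReal.ofReal (prodDec 104 (shear a σ x) 1 (shear a σ y))) := by
        rw [lintegral_const_mul' _ _ (by finiteness), lintegral_const_mul' _ _ (by finiteness), hsw]
        ring
    _ = _ := by
        rw [h5]
        refine congrArg _ (lintegral_congr fun y => ?_)
        rw [envelope]; ring

theorem exists_lintegral_envelope_le : ∃ C : ℝ≥0, ∀ (a σ : ℝ) (z : ℝ × ℝ), 0 < σ →
    ∫⁻ y, envelope a σ z y ≤ C := by
  obtain ⟨C₁, hC₁⟩ := exists_lintegral_prodDec_le
  obtain ⟨C₂, hC₂⟩ := exists_lintegral_weight_le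
  refine ⟨C₁ * C₂, fun a σ z hσ => ?_⟩
  have hU := measurable_prodDec_shear 104 a σ
  have hsw := lintegral_mul_lintegral_swap (μ := volume) (ν := volume) (Q := fun _ => 1)
    measurable_const (measurable_weight z (inv_pos.2 hσ)) hU
  simp only [one_mul] at hsw
  simp only [envelope]
  rw [lintegral_const_mul' _ _ (by finiteness), ← hsw]
  have hin : ∀ x, ∫⁻ y, ENNReal.ofReal (prodDec 104 (shear a σ x) 1 (shear a σ y)) ≤
      ENNReal.ofReal σ⁻¹ * ENNReal.ofReal (σ ^ 2)⁻¹ * C₁ := fun x => by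
    rw [lintegral_comp_shear a hσ (F := fun v => ENNReal.ofReal (prodDec 104 (shear a σ x) 1 v))
      (by fun_prop)]
    gcongr
    simpa using hC₁ 104 (by norm_num) (shear a σ x) 1 one_pos
  calc _ ≤ ENNReal.ofReal (σ ^ 5) * ∫⁻ x, ENNReal.ofReal (weight z σ⁻¹ x) *
          (ENNReal.ofReal σ⁻¹ * ENNReal.ofReal (σ ^ 2)⁻¹ * C₁) := by
        gcongr with x; exact hin x
    _ = ENNReal.ofReal (σ ^ 5) * ((∫⁻ x, ENNReal.ofReal (weight z σ⁻¹ x)) *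
          (ENNReal.ofReal σ⁻¹ * ENNReal.ofReal (σ ^ 2)⁻¹ * C₁)) := by
        rw [lintegral_mul_const _ (measurable_weight z (inv_pos.2 hσ))]
    _ ≤ ENNReal.ofReal (σ ^ 5) * ((C₂ * ENNReal.ofReal (σ⁻¹ ^ 2)) *
          (ENNReal.ofReal σ⁻¹ * ENNReal.ofReal (σ ^ 2)⁻¹ * C₁)) := by
        gcongr; exact hC₂ z _ (inv_pos.2 hσ)
    _ = (C₁ * C₂) * (ENNReal.ofReal (σ ^ 5) * ENNReal.ofReal (σ⁻¹ ^ 2) * ENNReal.ofReal σ⁻¹ *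
          ENNReal.ofReal (σ ^ 2)⁻¹) := by ring
    _ = (C₁ * C₂) * 1 := by
        rw [← ENNReal.ofReal_mul (by positivity), ← ENNReal.ofReal_mul (by positivity),
          ← ENNReal.ofReal_mul (by positivity), ← ENNReal.ofReal_one]
        refine congrArg _ (congrArg ENNReal.ofReal ?_)
        field_simp
    _ = _ := by push_cast; ring

/-- Trading decay at the small scale `σ⁻¹` for decay at the large scale `σ⁻²`. -/
theorem prodDec_mul_dec_le {a σ : ℝ} (ha : 0 ≤ a) (ha1 : a ≤ 1) (hσ : 0 < σ) (hσ1 : σ ≤ 1)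
    (m n : ℕ) (x y z : ℝ × ℝ) :
    prodDec (m + n) (shear a σ x) 1 (shear a σ y) * dec n (rad (x - z) / σ⁻¹) ≤
      4 ^ n * 2 ^ (n - 1) * dec n (rad (y - z) / (σ ^ 2)⁻¹) *
        (prodDec m (shear a σ x) 1 (shear a σ y) * (dec n (rad (x - z) / σ⁻¹) + σ ^ n)) := by
  obtain ⟨τ, hτ⟩ : ∃ τ, τ = rad (x - z) / σ⁻¹ := ⟨_, rfl⟩
  have hτ0 : 0 ≤ τ := by rw [hτ]; exact div_nonneg (rad_nonneg _) (inv_nonneg.2 hσ.le)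
  have hτσ : rad (x - z) / (σ ^ 2)⁻¹ = σ * τ := by
    rw [hτ, div_inv_eq_mul, div_inv_eq_mul]; ring
  obtain ⟨U, hU⟩ : ∃ U, U = 1 + rad (shear a σ x - shear a σ y) / 1 := ⟨_, rfl⟩
  have hU1 : 1 ≤ U := by
    rw [hU]; have := div_nonneg (rad_nonneg (shear a σ x - shear a σ y)) zero_le_one; linarith
  have h1 : U ^ n * prodDec (m + n) (shear a σ x) 1 (shear a σ y) ≤
      prodDec m (shear a σ x) 1 (shear a σ y) := by
    rw [prodDec_comm m, hU]; exact rad_pow_mul_prodDec_le m n _ _ one_pos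
  have h2 : 1 + rad (y - z) / (σ ^ 2)⁻¹ ≤ 4 * U * (1 + σ * τ) := by
    have i1 : rad (y - z) ≤ rad (x - y) + rad (x - z) := by
      have := rad_add_le (y - x) (x - z)
      rwa [sub_add_sub_cancel, ← rad_neg (y - x), neg_sub] at this
    have i2 := rad_unshear_le ha ha1 hσ hσ1 (shear a σ x - shear a σ y)
    rw [unshear_sub, unshear_shear a hσ.ne', unshear_shear a hσ.ne'] at i2
    have i3 : rad (x - y) / (σ ^ 2)⁻¹ ≤ 4 * (U - 1) := by
      rw [hU, add_sub_cancel_left, div_one, div_le_iff₀ (by positivity), ← div_eq_mul_inv,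
        mul_div_assoc]
      exact i2
    have i4 := div_le_div_of_nonneg_right i1 (by positivity : 0 ≤ (σ ^ 2)⁻¹)
    rw [add_div, hτσ] at i4
    nlinarith [mul_nonneg hσ.le hτ0]
  have h3 : (1 + σ * τ) ^ n * dec n τ ≤ 2 ^ (n - 1) * (dec n τ + σ ^ n) := by
    have i1 : (1 + σ * τ) * (1 + τ)⁻¹ ≤ (1 + τ)⁻¹ + σ := by
      rw [← div_eq_mul_inv, div_le_iff₀ (by positivity), add_mul, inv_mul_cancel₀ (by positivity)]
      nlinarith
    rw [dec, abs_of_nonneg hτ0, ← inv_pow, ← mul_pow]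
    exact (pow_le_pow_left₀ (by positivity) i1 n).trans (add_pow_le (by positivity) hσ.le n)
  rw [← hτ]
  have hV : 0 ≤ rad (y - z) / (σ ^ 2)⁻¹ := div_nonneg (rad_nonneg _) (by positivity)
  rw [dec.eq_def n (rad (y - z) / (σ ^ 2)⁻¹), abs_of_nonneg hV, mul_right_comm, ← div_eq_mul_inv,
    le_div_iff₀ (by positivity)]
  have hP := prodDec_nonneg (m + n) (shear a σ x) 1 (shear a σ y)
  have hP' := prodDec_nonneg m (shear a σ x) 1 (shear a σ y)
  have hdn := (dec_pos n τ).le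
  calc _ ≤ prodDec (m + n) (shear a σ x) 1 (shear a σ y) * dec n τ * (4 * U * (1 + σ * τ)) ^ n := by
        refine mul_le_mul_of_nonneg_left ?_ (mul_nonneg hP hdn)
        exact pow_le_pow_left₀ (by positivity) h2 n
    _ = 4 ^ n * (U ^ n * prodDec (m + n) (shear a σ x) 1 (shear a σ y)) *
          ((1 + σ * τ) ^ n * dec n τ) := by rw [mul_pow, mul_pow]; ring
    _ ≤ 4 ^ n * prodDec m (shear a σ x) 1 (shear a σ y) * (2 ^ (n - 1) * (dec n τ + σ ^ n)) := by
        gcongr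
    _ = _ := by ring

theorem abs_shear_sub_le {a σ : ℝ} (ha : 0 ≤ a) (ha1 : a ≤ 1) (hσ : 0 < σ) (x z : ℝ × ℝ) :
    |(shear a σ x).1 - (shear a σ z).1| ≤ 3 * (rad (x - z) / σ⁻¹) := by
  have h1 := abs_fst_le_rad (x - z)
  have h2 := abs_snd_le_rad (x - z)
  rw [show (shear a σ x).1 - (shear a σ z).1 = σ * ((x - z).1 + 2 * a * (x - z).2) by
    simp only [shear, Prod.fst_sub, Prod.snd_sub]; ring, abs_mul, abs_of_pos hσ, div_inv_eq_mul]
  have h3 : |(x - z).1 + 2 * a * (x - z).2| ≤ 3 * rad (x - z) := by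
    refine (abs_add_le _ _).trans ?_
    rw [abs_mul, abs_of_nonneg (by positivity : 0 ≤ 2 * a)]
    nlinarith [abs_nonneg (x - z).2]
  nlinarith

/-- The envelope decays at scale `σ⁻²`, and is concentrated on the strip of width `σ⁻¹` through `z` in the
direction normal to the arc over `[a, a + σ]`. The additional term `σ ^ 2` is due to the tail of the
weight. -/
theorem exists_envelope_le : ∃ C : ℝ≥0, ∀ (a σ : ℝ), 0 ≤ a → a ≤ 1 → 0 < σ → σ ≤ 1 →
    ∀ z y : ℝ × ℝ, envelope a σ z y ≤ C * (ENNReal.ofReal (dec 100 (rad (y - z) / (σ ^ 2)⁻¹)) *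
      ENNReal.ofReal (σ ^ 3 * (dec 4 ((shear a σ y).1 - (shear a σ z).1) + σ ^ 2))) := by
  obtain ⟨C₁, hC₁⟩ := exists_lintegral_prodDec_le
  obtain ⟨A, hA⟩ : ∃ A : ℝ, A = 4 ^ 100 * 2 ^ (100 - 1) := ⟨_, rfl⟩
  have hA0 : 0 ≤ A := by rw [hA]; positivity
  refine ⟨C₁ * (A * 81).toNNReal, fun a σ ha ha1 hσ hσ1 z y => ?_⟩
  have hP4 : Measurable fun x => ENNReal.ofReal (prodDec 4 (shear a σ x) 1 (shear a σ y)) :=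
    (measurable_prodDec_shear 4 a σ).of_uncurry_left
  have hr : Measurable fun x : ℝ × ℝ => ENNReal.ofReal (dec 100 (rad (x - z) / σ⁻¹)) := by fun_prop
  -- The term with the small-scale decay gives the strip, `hI2`; the term `σ ^ n` of
  -- `prodDec_mul_dec_le` gives the tail, `hI1`.
  have hI1 : ∫⁻ x, ENNReal.ofReal (prodDec 4 (shear a σ x) 1 (shear a σ y)) ≤
      ENNReal.ofReal σ⁻¹ * ENNReal.ofReal (σ ^ 2)⁻¹ * C₁ := by
    simp only [prodDec_comm 4 _ (shear a σ y)]
    rw [lintegral_comp_shear a hσ (F := fun v => ENNReal.ofReal (prodDec 4 (shear a σ y) 1 v))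
      (by fun_prop)]
    gcongr
    simpa using hC₁ 4 (by norm_num) (shear a σ y) 1 one_pos
  have hI2 : ∫⁻ x, ENNReal.ofReal (prodDec 4 (shear a σ x) 1 (shear a σ y)) *
      ENNReal.ofReal (dec 100 (rad (x - z) / σ⁻¹)) ≤
      ENNReal.ofReal (81 * dec 4 ((shear a σ y).1 - (shear a σ z).1)) *
        (C₁ * ENNReal.ofReal (σ⁻¹ ^ 2)) := by
    refine le_trans ?_ (mul_le_mul' le_rfl (hC₁ 48 (by norm_num) z σ⁻¹ (inv_pos.2 hσ)))
    rw [← lintegral_const_mul' _ _ ENNReal.ofReal_ne_top]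
    refine lintegral_mono fun x => ?_
    rw [← ENNReal.ofReal_mul (prodDec_nonneg _ _ _ _),
      ← ENNReal.ofReal_mul (mul_nonneg (by norm_num) (dec_pos _ _).le)]
    refine ENNReal.ofReal_le_ofReal ?_
    have hd : dec 96 (rad (x - z) / σ⁻¹) ≤ prodDec 48 z σ⁻¹ x :=
      dec_rad_le_mul (m := 48) (n := 48) (x - z) (inv_pos.2 hσ)
    refine le_trans ?_ (mul_le_mul_of_nonneg_left hd (mul_nonneg (by norm_num) (dec_pos _ _).le))
    have ht := abs_shear_sub_le ha ha1 hσ x z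
    have hτ : 0 ≤ rad (x - z) / σ⁻¹ := div_nonneg (rad_nonneg _) (inv_nonneg.2 hσ.le)
    generalize rad (x - z) / σ⁻¹ = τ at ht hτ ⊢
    have h1 := dec_shift 4 ((shear a σ y).1 - (shear a σ x).1) ((shear a σ x).1 - (shear a σ z).1)
    rw [sub_add_sub_cancel] at h1
    have h2 : prodDec 4 (shear a σ x) 1 (shear a σ y) ≤ dec 4 ((shear a σ y).1 - (shear a σ x).1) := by
      rw [prodDec, div_one]
      exact mul_le_of_le_one_right (dec_pos _ _).le (dec_le_one _ _)
    have h3 : (1 + |(shear a σ x).1 - (shear a σ z).1|) ^ 4 ≤ 81 * (1 + τ) ^ 4 := by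
      calc _ ≤ (3 * (1 + τ)) ^ 4 := by gcongr; linarith
        _ = _ := by ring
    have h4 : (1 + τ) ^ 4 * dec 100 τ = dec 96 τ := by
      rw [dec_add 96 4, dec.eq_def 4, abs_of_nonneg hτ, mul_left_comm, mul_inv_cancel₀ (by positivity),
        mul_one]
    have hd4 := (dec_pos 4 ((shear a σ y).1 - (shear a σ z).1)).le
    calc _ ≤ (81 * (1 + τ) ^ 4 * dec 4 ((shear a σ y).1 - (shear a σ z).1)) * dec 100 τ := by
          refine mul_le_mul_of_nonneg_right ?_ (dec_pos _ _).le
          exact h2.trans (h1.trans (mul_le_mul_of_nonneg_right h3 hd4))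
      _ = 81 * dec 4 ((shear a σ y).1 - (shear a σ z).1) * ((1 + τ) ^ 4 * dec 100 τ) := by ring
      _ = _ := by rw [h4]
  obtain ⟨d, hd⟩ : ∃ d, d = dec 100 (rad (y - z) / (σ ^ 2)⁻¹) := ⟨_, rfl⟩
  have hd0 : 0 ≤ d := by rw [hd]; exact (dec_pos _ _).le
  obtain ⟨d', hd'⟩ : ∃ d, d = dec 4 ((shear a σ y).1 - (shear a σ z).1) := ⟨_, rfl⟩
  have hd'0 : 0 ≤ d' := by rw [hd']; exact (dec_pos _ _).le
  rw [← hd'] at hI2 ⊢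
  rw [← hd]
  obtain ⟨S, hS⟩ : ∃ S, S = σ ^ 100 := ⟨_, rfl⟩
  have hS0 : 0 ≤ S := by rw [hS]; positivity
  have e3 : S ≤ σ ^ 3 := by rw [hS]; exact pow_le_pow_of_le_one hσ.le hσ1 (by norm_num)
  have hPr : Measurable fun x => ENNReal.ofReal (prodDec 4 (shear a σ x) 1 (shear a σ y)) *
      ENNReal.ofReal (dec 100 (rad (x - z) / σ⁻¹)) := hP4.mul hr
  calc envelope a σ z y ≤ ENNReal.ofReal (σ ^ 5) * ∫⁻ x, ENNReal.ofReal (A * d) *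
          (ENNReal.ofReal (prodDec 4 (shear a σ x) 1 (shear a σ y)) *
              ENNReal.ofReal (dec 100 (rad (x - z) / σ⁻¹)) +
            ENNReal.ofReal S *
              ENNReal.ofReal (prodDec 4 (shear a σ x) 1 (shear a σ y))) := by
        rw [envelope]
        refine mul_le_mul' le_rfl (lintegral_mono fun x => ?_)
        have h := prodDec_mul_dec_le ha ha1 hσ hσ1 4 100 x y z
        rw [← hA, ← hd, ← hS] at h
        have hp := prodDec_nonneg 4 (shear a σ x) 1 (shear a σ y)
        have hdp := (dec_pos 100 (rad (x - z) / σ⁻¹)).le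
        rw [← ENNReal.ofReal_mul hp, ← ENNReal.ofReal_mul hS0,
          ← ENNReal.ofReal_add (mul_nonneg hp hdp) (mul_nonneg hS0 hp),
          ← ENNReal.ofReal_mul (mul_nonneg hA0 hd0),
          ← ENNReal.ofReal_mul (weight_nonneg _ (inv_pos.2 hσ) _), weight_eq z (inv_pos.2 hσ)]
        refine ENNReal.ofReal_le_ofReal ?_
        rw [mul_comm]
        refine h.trans (le_of_eq ?_)
        ring
    _ ≤ ENNReal.ofReal (σ ^ 5) * (ENNReal.ofReal (A * d) *
          (ENNReal.ofReal (81 * d') * (C₁ * ENNReal.ofReal (σ⁻¹ ^ 2)) +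
            ENNReal.ofReal S * (ENNReal.ofReal σ⁻¹ * ENNReal.ofReal (σ ^ 2)⁻¹ * C₁))) := by
        rw [lintegral_const_mul' _ _ ENNReal.ofReal_ne_top, lintegral_add_left hPr,
          lintegral_const_mul' _ _ ENNReal.ofReal_ne_top]
        gcongr
    _ = C₁ * (ENNReal.ofReal (A * d) * ((ENNReal.ofReal (81 * d') * ENNReal.ofReal (σ ^ 5) *
          ENNReal.ofReal (σ⁻¹ ^ 2)) + (ENNReal.ofReal S * ENNReal.ofReal (σ ^ 5) *
          ENNReal.ofReal σ⁻¹ * ENNReal.ofReal (σ ^ 2)⁻¹))) := by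
        ring
    _ ≤ C₁ * (ENNReal.ofReal (A * d) * ENNReal.ofReal (81 * (σ ^ 3 * (d' + σ ^ 2)))) := by
        rw [← ENNReal.ofReal_mul (by positivity), ← ENNReal.ofReal_mul (by positivity),
          ← ENNReal.ofReal_mul (by positivity), ← ENNReal.ofReal_mul (by positivity),
          ← ENNReal.ofReal_mul (by positivity), ← ENNReal.ofReal_add (by positivity) (by positivity)]
        gcongr
        have e1 : 81 * d' * σ ^ 5 * σ⁻¹ ^ 2 = 81 * d' * σ ^ 3 := by field_simp
        have e2 : S * σ ^ 5 * σ⁻¹ * (σ ^ 2)⁻¹ = S * σ ^ 2 := by field_simp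
        have e4 : S * σ ^ 2 ≤ σ ^ 3 * σ ^ 2 := by gcongr
        have e5 : 0 ≤ σ ^ 3 * σ ^ 2 := by positivity
        rw [e1, e2]
        linarith
    _ = _ := by
        push_cast
        change _ = C₁ * ENNReal.ofReal (A * 81) * _
        rw [ENNReal.ofReal_mul hA0, ENNReal.ofReal_mul hA0, ENNReal.ofReal_mul (by norm_num)]
        generalize ENNReal.ofReal (σ ^ 3 * (d' + σ ^ 2)) = T
        ring

theorem cellCenter_mem_square {M : ℕ} {ℓ R : ℝ} (hℓ : 0 < ℓ) (hM : M * ℓ = R) (c : ℝ × ℝ) {i j : ℕ}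
    (hi : i < M) (hj : j < M) : cellCenter c R ℓ i j ∈ square c R := by
  have hi' : (i : ℝ) + 1 ≤ M := by exact_mod_cast hi
  have hj' : (j : ℝ) + 1 ≤ M := by exact_mod_cast hj
  have h1 : ((i : ℝ) + 1 / 2) * ℓ ≤ R := by rw [← hM]; gcongr; linarith
  have h2 : ((j : ℝ) + 1 / 2) * ℓ ≤ R := by rw [← hM]; gcongr; linarith
  have h3 : 0 ≤ ((i : ℝ) + 1 / 2) * ℓ := by positivity
  have h4 : 0 ≤ ((j : ℝ) + 1 / 2) * ℓ := by positivity
  exact ⟨⟨by simp only [cellCenter]; linarith, by simp only [cellCenter]; linarith⟩,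
    by simp only [cellCenter]; linarith, by simp only [cellCenter]; linarith⟩

/-- The transversality sum: the boxes dual to two separated short intervals meet few small squares
simultaneously. -/
theorem exists_transversal_sum_le : ∃ C : ℝ≥0, ∀ (M : ℕ) (σ a a' : ℝ), M * σ = 1 → 0 < σ → σ ≤ 1 →
    a ≠ a' → |a - a'| ≤ 1 → ∀ (z : ℝ × ℝ) (β β' : ℝ),
    ∑ p ∈ Finset.range M ×ˢ Finset.range M,
      ENNReal.ofReal (dec 4 (β - (shear a σ (cellCenter z (σ ^ 2)⁻¹ σ⁻¹ p.1 p.2)).1) + σ ^ 2) *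
      ENNReal.ofReal (dec 4 (β' - (shear a' σ (cellCenter z (σ ^ 2)⁻¹ σ⁻¹ p.1 p.2)).1) + σ ^ 2) ≤
      C * ENNReal.ofReal |a - a'|⁻¹ := by
  obtain ⟨C, hC⟩ := exists_sum_dec_le
  refine ⟨C * C + 3, fun M σ a a' hM hσ hσ1 hne hle z β β' => ?_⟩
  have hsub : a - a' ≠ 0 := sub_ne_zero.2 hne
  -- In units of `σ⁻¹` the position of the cell `(i, j)` across the strip for `a` is
  -- `i + 2 * a * j + γ`. The two strip conditions fix `i`, given `j`, and leave about `1 / |a - a'|`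
  -- values of `j`.
  have hsh : ∀ a, ∃ γ, ∀ i j : ℕ,
      (shear a σ (cellCenter z (σ ^ 2)⁻¹ σ⁻¹ i j)).1 = i + 2 * a * j + γ := fun a => by
    refine ⟨σ * (z.1 - (σ ^ 2)⁻¹ / 2 + 2 * a * (z.2 - (σ ^ 2)⁻¹ / 2)) + 1 / 2 + a, fun i j => ?_⟩
    simp only [shear, cellCenter]
    field_simp
    ring
  obtain ⟨γ, hγ⟩ := hsh a
  obtain ⟨γ', hγ'⟩ := hsh a'
  simp only [hγ, hγ']
  have hterm : ∀ p : ℕ × ℕ, ENNReal.ofReal (dec 4 (β - (p.1 + 2 * a * p.2 + γ)) + σ ^ 2) *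
      ENNReal.ofReal (dec 4 (β' - (p.1 + 2 * a' * p.2 + γ')) + σ ^ 2) ≤
      ENNReal.ofReal (dec 2 (-1 * p.1 + (β - 2 * a * p.2 - γ))) *
        ENNReal.ofReal (dec 2 (2 * (a - a') * p.2 + (β' - β + γ - γ'))) +
      ENNReal.ofReal (3 * σ ^ 2) := fun p => by
    obtain ⟨u, hu⟩ : ∃ u, u = β - (p.1 + 2 * a * p.2 + γ) := ⟨_, rfl⟩
    obtain ⟨u', hu'⟩ : ∃ u, u = β' - (p.1 + 2 * a' * p.2 + γ') := ⟨_, rfl⟩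
    rw [show -1 * (p.1 : ℝ) + (β - 2 * a * p.2 - γ) = u by rw [hu]; ring,
      show 2 * (a - a') * (p.2 : ℝ) + (β' - β + γ - γ') = u' - u by rw [hu, hu']; ring, ← hu, ← hu']
    have h1 := dec_pos 4 u
    have h2 := dec_pos 4 u'
    have h3 := dec_le_one 4 u
    have h4 := dec_le_one 4 u'
    rw [← ENNReal.ofReal_mul (by positivity), ← ENNReal.ofReal_mul (dec_pos _ _).le,
      ← ENNReal.ofReal_add (mul_nonneg (dec_pos _ _).le (dec_pos _ _).le) (by positivity)]
    refine ENNReal.ofReal_le_ofReal ?_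
    -- The difference `u' - u` depends on `j` only.
    have h5 : dec 4 u * dec 4 u' ≤ dec 2 u * dec 2 (u' - u) := by
      have i1 := dec_shift 2 u' (-u)
      rw [abs_neg, ← sub_eq_add_neg] at i1
      have i2 : dec 4 u' ≤ dec 2 u' := dec_anti_left (by norm_num) _
      have i3 : dec 2 u * (1 + |u|) ^ 2 = 1 := by
        rw [dec]; exact inv_mul_cancel₀ (by positivity)
      have i4 := (dec_pos 2 u).le
      calc _ = dec 2 u * (dec 2 u * dec 4 u') := by rw [dec_add 2 2 u]; ring
        _ ≤ dec 2 u * (dec 2 u * ((1 + |u|) ^ 2 * dec 2 (u' - u))) := by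
            gcongr; exact i2.trans i1
        _ = dec 2 u * ((dec 2 u * (1 + |u|) ^ 2) * dec 2 (u' - u)) := by ring
        _ = _ := by rw [i3, one_mul]
    have h6 : σ ^ 2 ≤ 1 := pow_le_one₀ hσ.le hσ1
    have h7 : 0 < σ ^ 2 := by positivity
    nlinarith
  -- The tails contribute `M ^ 2 * σ ^ 2 = 1`, which is harmless because `|a - a'|⁻¹ ≥ 1`.
  have hM2 : ((M * M : ℕ) : ℝ≥0∞) * ENNReal.ofReal (3 * σ ^ 2) = 3 := by
    rw [← ENNReal.ofReal_natCast, ← ENNReal.ofReal_mul (by positivity)]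
    have : ((M * M : ℕ) : ℝ) * (3 * σ ^ 2) = 3 := by
      push_cast
      calc _ = 3 * (M * σ) ^ 2 := by ring
        _ = 3 := by rw [hM]; ring
    rw [this]; norm_num
  have h1le : 1 ≤ ENNReal.ofReal |a - a'|⁻¹ := by
    rw [ENNReal.one_le_ofReal]; exact (one_le_inv₀ (abs_pos.2 hsub)).2 hle
  calc _ ≤ _ := Finset.sum_le_sum fun p _ => hterm p
    _ = (∑ j ∈ Finset.range M, (∑ i ∈ Finset.range M,
          ENNReal.ofReal (dec 2 (-1 * i + (β - 2 * a * j - γ)))) *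
            ENNReal.ofReal (dec 2 (2 * (a - a') * j + (β' - β + γ - γ')))) + 3 := by
        rw [Finset.sum_add_distrib, Finset.sum_product_right, Finset.sum_const, Finset.card_product,
          Finset.card_range, nsmul_eq_mul, hM2]
        simp only [Finset.sum_mul]
    _ ≤ (∑ j ∈ Finset.range M, C * ENNReal.ofReal (dec 2 (2 * (a - a') * j + (β' - β + γ - γ')))) +
          3 := by
        gcongr with j hj
        simpa using hC (-1) (by norm_num) (by norm_num) (β - 2 * a * j - γ) M
    _ ≤ C * (C * ENNReal.ofReal |2 * (a - a')|⁻¹) + 3 := by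
        rw [← Finset.mul_sum]
        gcongr
        refine hC _ (mul_ne_zero two_ne_zero hsub) ?_ _ M
        rw [abs_mul, abs_two]; linarith
    _ ≤ C * (C * ENNReal.ofReal |a - a'|⁻¹) + 3 * ENNReal.ofReal |a - a'|⁻¹ := by
        have : |a - a'| ≤ |2 * (a - a')| := by
          rw [abs_mul, abs_two]; linarith [abs_nonneg (a - a')]
        gcongr
        exact le_mul_of_one_le_right zero_le h1le
    _ = _ := by push_cast; ring

/-- A pointwise bound for a bilinear sum of weights bounds the sum of the products of the weighted
integrals. -/
theorem sum_lintegral_mul_lintegral_le {ι : Type*} (s : Finset ι) {f f' : ℝ × ℝ → ℝ≥0∞}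
    {d d' : ι → ℝ × ℝ → ℝ≥0∞} (hf : Measurable f) (hf' : Measurable f')
    (hd : ∀ i, Measurable (d i)) (hd' : ∀ i, Measurable (d' i)) {K : ℝ≥0∞}
    (hK : ∀ y y', ∑ i ∈ s, d i y * d' i y' ≤ K) :
    ∑ i ∈ s, (∫⁻ y, f y * d i y) * ∫⁻ y', f' y' * d' i y' ≤ K * ((∫⁻ y, f y) * ∫⁻ y', f' y') := by
  have hfd : ∀ i, Measurable fun y => f y * d i y := fun i => hf.mul (hd i)
  have hfd' : ∀ i, Measurable fun y => f' y * d' i y := fun i => hf'.mul (hd' i)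
  have e : ∀ i, (∫⁻ y, f y * d i y) * ∫⁻ y', f' y' * d' i y' =
      ∫⁻ y, ∫⁻ y', (f y * d i y) * (f' y' * d' i y') := fun i => by
    rw [← lintegral_mul_const _ (hfd i)]
    exact lintegral_congr fun y => (lintegral_const_mul _ (hfd' i)).symm
  have hm : ∀ i y, Measurable fun y' => (f y * d i y) * (f' y' * d' i y') := fun i y =>
    (hfd' i).const_mul _
  have hm2 : ∀ i, Measurable fun y => ∫⁻ y', (f y * d i y) * (f' y' * d' i y') := fun i =>
    Measurable.lintegral_prod_right' (f := fun p : (ℝ × ℝ) × (ℝ × ℝ) =>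
      (f p.1 * d i p.1) * (f' p.2 * d' i p.2))
      (((hfd i).comp measurable_fst).mul ((hfd' i).comp measurable_snd))
  simp only [e]
  rw [← lintegral_finsetSum' _ fun i _ => (hm2 i).aemeasurable]
  calc _ = ∫⁻ y, ∫⁻ y', (f y * f' y') * ∑ i ∈ s, d i y * d' i y' := by
        refine lintegral_congr fun y => ?_
        rw [← lintegral_finsetSum' _ fun i _ => (hm i y).aemeasurable]
        refine lintegral_congr fun y' => ?_
        rw [Finset.mul_sum]
        exact Finset.sum_congr rfl fun i _ => by ring
    _ ≤ ∫⁻ y, ∫⁻ y', (f y * K) * f' y' := by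
        refine lintegral_mono fun y => lintegral_mono fun y' => ?_
        refine (mul_le_mul' le_rfl (hK y y')).trans (le_of_eq (by ring))
    _ = _ := by
        simp only [lintegral_const_mul _ hf']
        rw [lintegral_mul_const _ (hf.mul_const K), lintegral_mul_const _ hf]
        ring

/-- Since the envelope has bounded mass, Jensen's inequality raises the average to the power `p / 2`. -/
theorem exists_average_rpow_le : ∃ C : ℝ≥0, ∀ (p : ℝ), 2 ≤ p → p ≤ 4 → ∀ (a σ : ℝ) (g : ℝ → ℂ),
    0 < σ → IntegrableOn g (Set.Icc a (a + σ)) → ∀ z,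
    (ENNReal.ofReal (σ⁻¹ ^ 2)⁻¹ *
        ∫⁻ x, ‖extend a σ g x‖ₑ ^ (2 : ℝ) * ENNReal.ofReal (weight z σ⁻¹ x)) ^ (p / 2) ≤
      C * ∫⁻ y, ‖extend a σ g y‖ₑ ^ p * envelope a σ z y := by
  obtain ⟨C₁, hC₁⟩ := exists_average_le_envelope
  obtain ⟨C₂, hC₂⟩ := exists_lintegral_envelope_le
  refine ⟨max C₁ 1 ^ 2 * max C₂ 1, fun p hp hp4 a σ g hσ hg z => ?_⟩
  have hJ := lintegral_mul_rpow_le (μ := volume) (p := p / 2) (by linarith)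
    (measurable_enorm_rpow_extend hg 2).aemeasurable (measurable_envelope a hσ z).aemeasurable
  simp only [← ENNReal.rpow_mul, mul_div_cancel₀ p (two_ne_zero' ℝ)] at hJ
  have h1 : (1 : ℝ≥0∞) ≤ (max C₁ 1 : ℝ≥0) := by exact_mod_cast le_max_right _ _
  have h2 : (1 : ℝ≥0∞) ≤ (max C₂ 1 : ℝ≥0) := by exact_mod_cast le_max_right _ _
  calc _ ≤ ((max C₁ 1 : ℝ≥0) * ∫⁻ y, ‖extend a σ g y‖ₑ ^ (2 : ℝ) * envelope a σ z y) ^ (p / 2) := by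
        refine ENNReal.rpow_le_rpow ((hC₁ a σ g hσ hg z).trans ?_) (by linarith)
        gcongr; exact le_max_left _ _
    _ ≤ ((max C₁ 1 : ℝ≥0) : ℝ≥0∞) ^ (p / 2) * (((max C₂ 1 : ℝ≥0) : ℝ≥0∞) ^ (p / 2 - 1) *
          ∫⁻ y, ‖extend a σ g y‖ₑ ^ p * envelope a σ z y) := by
        rw [ENNReal.mul_rpow_of_nonneg _ _ (by linarith)]
        refine mul_le_mul' le_rfl (hJ.trans (mul_le_mul' ?_ le_rfl))
        refine ENNReal.rpow_le_rpow ((hC₂ a σ z hσ).trans ?_) (by linarith)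
        exact_mod_cast le_max_left _ _
    _ ≤ ((max C₁ 1 : ℝ≥0) : ℝ≥0∞) ^ (2 : ℝ) * (((max C₂ 1 : ℝ≥0) : ℝ≥0∞) ^ (1 : ℝ) *
          ∫⁻ y, ‖extend a σ g y‖ₑ ^ p * envelope a σ z y) := by
        refine mul_le_mul' (ENNReal.rpow_le_rpow_of_exponent_le h1 (by linarith))
          (mul_le_mul' (ENNReal.rpow_le_rpow_of_exponent_le h2 (by linarith)) le_rfl)
    _ = _ := by
        rw [ENNReal.rpow_one, show (2 : ℝ) = (2 : ℕ) by norm_num, ENNReal.rpow_natCast]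
        push_cast; ring

/-- Ball inflation for a single pair of short intervals. -/
theorem exists_ball_inflation_pair : ∃ C : ℝ≥0, ∀ (M : ℕ) (σ a a' s q : ℝ) (g : ℝ → ℂ),
    M * σ = 1 → 0 < σ → σ ≤ 1 → 0 ≤ a → a ≤ 1 → 0 ≤ a' → a' ≤ 1 → a ≠ a' →
    2 ≤ s → s ≤ 4 → 2 ≤ q → q ≤ 4 →
    IntegrableOn g (Set.Icc a (a + σ)) → IntegrableOn g (Set.Icc a' (a' + σ)) → ∀ z : ℝ × ℝ,
    ∑ p ∈ Finset.range M ×ˢ Finset.range M,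
      (ENNReal.ofReal (σ⁻¹ ^ 2)⁻¹ * ∫⁻ x, ‖extend a σ g x‖ₑ ^ (2 : ℝ) *
        ENNReal.ofReal (weight (cellCenter z (σ ^ 2)⁻¹ σ⁻¹ p.1 p.2) σ⁻¹ x)) ^ (s / 2) *
      (ENNReal.ofReal (σ⁻¹ ^ 2)⁻¹ * ∫⁻ x, ‖extend a' σ g x‖ₑ ^ (2 : ℝ) *
        ENNReal.ofReal (weight (cellCenter z (σ ^ 2)⁻¹ σ⁻¹ p.1 p.2) σ⁻¹ x)) ^ (q / 2) ≤
      C * (ENNReal.ofReal |a - a'|⁻¹ * (ENNReal.ofReal (σ ^ 6) *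
        ((∫⁻ x, ‖extend a σ g x‖ₑ ^ s * ENNReal.ofReal (weight z (σ ^ 2)⁻¹ x)) *
          ∫⁻ x, ‖extend a' σ g x‖ₑ ^ q * ENNReal.ofReal (weight z (σ ^ 2)⁻¹ x)))) := by
  obtain ⟨C₁, hC₁⟩ := exists_average_rpow_le
  obtain ⟨C₂, hC₂⟩ := exists_envelope_le
  obtain ⟨C₃, hC₃⟩ := exists_transversal_sum_le
  obtain ⟨A, hA⟩ : ∃ A : ℝ, A = (1 + 1) ^ 100 := ⟨_, rfl⟩
  have hA0 : 0 ≤ A := by rw [hA]; positivity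
  refine ⟨(C₁ * (C₂ * A.toNNReal)) ^ 2 * C₃, fun M σ a a' s q g hM hσ hσ1 ha ha1 ha' ha'1 hne hs hs4
    hq hq4 hg hg' z => ?_⟩
  have hρ : 0 < (σ ^ 2)⁻¹ := by positivity
  have hMρ : M * σ⁻¹ = (σ ^ 2)⁻¹ := by
    refine eq_inv_of_mul_eq_one_left ?_
    calc _ = M * σ := by field_simp
      _ = 1 := hM
  let d : ℝ → ℕ × ℕ → ℝ × ℝ → ℝ≥0∞ := fun a p y => ENNReal.ofReal
    (dec 4 ((shear a σ y).1 - (shear a σ (cellCenter z (σ ^ 2)⁻¹ σ⁻¹ p.1 p.2)).1) + σ ^ 2)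
  have hdm : ∀ a p, Measurable (d a p) := fun a p => by simp only [d, shear]; fun_prop
  have hw := measurable_weight z hρ
  have hG : ∀ (t a : ℝ), 2 ≤ t → t ≤ 4 → 0 ≤ a → a ≤ 1 → IntegrableOn g (Set.Icc a (a + σ)) →
      ∀ p ∈ Finset.range M ×ˢ Finset.range M,
      (ENNReal.ofReal (σ⁻¹ ^ 2)⁻¹ * ∫⁻ x, ‖extend a σ g x‖ₑ ^ (2 : ℝ) *
        ENNReal.ofReal (weight (cellCenter z (σ ^ 2)⁻¹ σ⁻¹ p.1 p.2) σ⁻¹ x)) ^ (t / 2) ≤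
      (C₁ * (C₂ * A.toNNReal) : ℝ≥0) * ENNReal.ofReal (σ ^ 3) *
        ∫⁻ y, (‖extend a σ g y‖ₑ ^ t * ENNReal.ofReal (weight z (σ ^ 2)⁻¹ y)) * d a p y := by
    intro t a ht ht4 ha ha1 hg p hp
    rw [Finset.mem_product, Finset.mem_range, Finset.mem_range] at hp
    have hz := square_subset_ball hρ (cellCenter_mem_square (inv_pos.2 hσ) hMρ z hp.1 hp.2)
    obtain ⟨ζ, hζ⟩ : ∃ ζ, ζ = cellCenter z (σ ^ 2)⁻¹ σ⁻¹ p.1 p.2 := ⟨_, rfl⟩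
    simp only [d]
    rw [← hζ] at hz ⊢
    refine (hC₁ t ht ht4 a σ g hσ hg ζ).trans ?_
    rw [← lintegral_const_mul' _ _ (by finiteness), ← lintegral_const_mul' _ _ (by finiteness)]
    refine lintegral_mono fun y => ?_
    have hd : ENNReal.ofReal (dec 100 (rad (y - ζ) / (σ ^ 2)⁻¹)) ≤
        ENNReal.ofReal A * ENNReal.ofReal (weight z (σ ^ 2)⁻¹ y) := by
      rw [← ENNReal.ofReal_mul hA0, weight_eq z hρ]
      refine ENNReal.ofReal_le_ofReal ((dec_rad_shift 100 (y - ζ) (ζ - z) hρ).trans ?_)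
      rw [sub_add_sub_cancel, hA]
      have h0 := div_nonneg (rad_nonneg (ζ - z)) hρ.le
      refine mul_le_mul_of_nonneg_right (pow_le_pow_left₀ (by positivity) (by linarith) _)
        (dec_pos _ _).le
    calc _ ≤ C₁ * (‖extend a σ g y‖ₑ ^ t * (C₂ * ((ENNReal.ofReal A *
            ENNReal.ofReal (weight z (σ ^ 2)⁻¹ y)) *
            ENNReal.ofReal (σ ^ 3 * (dec 4 ((shear a σ y).1 - (shear a σ ζ).1) + σ ^ 2))))) := by
          gcongr
          refine (hC₂ a σ ha ha1 hσ hσ1 ζ y).trans ?_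
          gcongr
      _ = _ := by
          rw [ENNReal.ofReal_mul (by positivity)]
          push_cast
          change _ = C₁ * (C₂ * ENNReal.ofReal A) * _ * _
          ring
  have hsum := sum_lintegral_mul_lintegral_le (Finset.range M ×ˢ Finset.range M)
    (f := fun y => ‖extend a σ g y‖ₑ ^ s * ENNReal.ofReal (weight z (σ ^ 2)⁻¹ y))
    (f' := fun y => ‖extend a' σ g y‖ₑ ^ q * ENNReal.ofReal (weight z (σ ^ 2)⁻¹ y))
    ((measurable_enorm_rpow_extend hg s).mul hw) ((measurable_enorm_rpow_extend hg' q).mul hw)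
    (hdm a) (hdm a') (fun y y' => hC₃ M σ a a' hM hσ hσ1 hne
      (by rw [abs_le]; constructor <;> linarith) z _ _)
  calc _ ≤ ∑ p ∈ Finset.range M ×ˢ Finset.range M,
          ((C₁ * (C₂ * A.toNNReal) : ℝ≥0) * ENNReal.ofReal (σ ^ 3)) ^ 2 *
          ((∫⁻ y, (‖extend a σ g y‖ₑ ^ s * ENNReal.ofReal (weight z (σ ^ 2)⁻¹ y)) * d a p y) *
          ∫⁻ y, (‖extend a' σ g y‖ₑ ^ q * ENNReal.ofReal (weight z (σ ^ 2)⁻¹ y)) * d a' p y) := by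
        refine Finset.sum_le_sum fun p hp => ?_
        refine (mul_le_mul' (hG s a hs hs4 ha ha1 hg p hp)
          (hG q a' hq hq4 ha' ha'1 hg' p hp)).trans (le_of_eq (by ring))
    _ = ((C₁ * (C₂ * A.toNNReal) : ℝ≥0) * ENNReal.ofReal (σ ^ 3)) ^ 2 * ∑ p ∈ _, _ :=
        (Finset.mul_sum _ _ _).symm
    _ ≤ ((C₁ * (C₂ * A.toNNReal) : ℝ≥0) * ENNReal.ofReal (σ ^ 3)) ^ 2 * _ :=
        mul_le_mul' le_rfl hsum
    _ = _ := by
        have e6 : ENNReal.ofReal (σ ^ 6) = ENNReal.ofReal (σ ^ 3) ^ 2 := by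
          rw [← ENNReal.ofReal_pow (by positivity), ← pow_mul]
        rw [e6]
        generalize ENNReal.ofReal |a - a'|⁻¹ = X
        push_cast
        ring

/-! ### Square functions, ball inflation and interpolation -/

/-- The normalised weighted `p`-th moment of an extension on the square with centre `c` and side
length `R`. -/
def moment (p a ℓ : ℝ) (c : ℝ × ℝ) (R : ℝ) (g : ℝ → ℂ) : ℝ≥0∞ :=
  ENNReal.ofReal (R ^ 2)⁻¹ * ∫⁻ x, ‖extend a ℓ g x‖ₑ ^ p * ENNReal.ofReal (weight c R x)

theorem numCells_eq {N : ℕ} {L ℓ : ℝ} (hℓ : 0 < ℓ) (h : N * ℓ = L) : numCells L ℓ = N := by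
  rw [numCells, ← h, mul_div_cancel_right₀ _ hℓ.ne', Nat.floor_natCast]

theorem squareSum_two {N : ℕ} {L ℓ : ℝ} (hℓ : 0 < ℓ) (h : N * ℓ = L) (a : ℝ) (c : ℝ × ℝ) (R : ℝ)
    (g : ℝ → ℂ) :
    squareSum 2 a L ℓ c R g = ∑ k ∈ Finset.range N, moment 2 (a + k * ℓ) ℓ c R g := by
  rw [squareSum, numCells_eq hℓ h]
  refine Finset.sum_congr rfl fun k _ => ?_
  rw [weightedAvgNorm, ← ENNReal.rpow_natCast, ← ENNReal.rpow_mul]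
  norm_num [moment]

theorem squareSum_six {N : ℕ} {L ℓ : ℝ} (hℓ : 0 < ℓ) (h : N * ℓ = L) (a : ℝ) (c : ℝ × ℝ) (R : ℝ)
    (g : ℝ → ℂ) : squareSum 6 a L ℓ c R g =
      ∑ k ∈ Finset.range N, moment 6 (a + k * ℓ) ℓ c R g ^ (1 / 3 : ℝ) := by
  rw [squareSum, numCells_eq hℓ h]
  refine Finset.sum_congr rfl fun k _ => ?_
  rw [weightedAvgNorm, ← ENNReal.rpow_natCast, ← ENNReal.rpow_mul]
  norm_num [moment]

theorem sum_range_mul {β : Type*} [AddCommMonoid β] (f : ℕ → β) (L M : ℕ) :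
    ∑ i ∈ Finset.range (L * M), f i =
      ∑ k ∈ Finset.range L, ∑ j ∈ Finset.range M, f (k * M + j) := by
  induction L with
  | zero => simp
  | succ L ih => rw [Nat.succ_mul, Finset.sum_range_add, ih, Finset.sum_range_succ]

/-- Hölder's inequality between the second, `p`-th and sixth moments. -/
theorem moment_le {p a ℓ : ℝ} (hp : 2 ≤ p) (hp6 : p ≤ 6) {g : ℝ → ℂ}
    (hg : IntegrableOn g (Set.Icc a (a + ℓ))) (c : ℝ × ℝ) {R : ℝ} (hR : 0 < R) :
    moment p a ℓ c R g ≤ moment 2 a ℓ c R g ^ ((6 - p) / 4) * moment 6 a ℓ c R g ^ ((p - 2) / 4) := by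
  have hw := measurable_weight c hR
  have hθ : 0 ≤ (6 - p) / 4 := by linarith
  have hθ' : 0 ≤ (p - 2) / 4 := by linarith
  have hsum : (6 - p) / 4 + (p - 2) / 4 = 1 := by ring
  have hsplit : ∀ y : ℝ≥0∞, y ^ ((6 - p) / 4) * y ^ ((p - 2) / 4) = y := fun y => by
    rw [← ENNReal.rpow_add_of_nonneg _ _ hθ hθ', hsum, ENNReal.rpow_one]
  have h := ENNReal.lintegral_mul_norm_pow_le (μ := volume)
    ((measurable_enorm_rpow_extend hg 2).mul hw).aemeasurable
    ((measurable_enorm_rpow_extend hg 6).mul hw).aemeasurable hθ hθ' hsum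
  have e : ∀ x, (‖extend a ℓ g x‖ₑ ^ (2 : ℝ) * ENNReal.ofReal (weight c R x)) ^ ((6 - p) / 4) *
      (‖extend a ℓ g x‖ₑ ^ (6 : ℝ) * ENNReal.ofReal (weight c R x)) ^ ((p - 2) / 4) =
      ‖extend a ℓ g x‖ₑ ^ p * ENNReal.ofReal (weight c R x) := fun x => by
    rw [ENNReal.mul_rpow_of_nonneg _ _ hθ, ENNReal.mul_rpow_of_nonneg _ _ hθ', mul_mul_mul_comm,
      hsplit, ← ENNReal.rpow_mul, ← ENNReal.rpow_mul, ← ENNReal.rpow_add_of_nonneg _ _ (by positivity)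
      (by positivity)]
    congr 2
    ring
  simp only [Pi.mul_apply, e] at h
  rw [moment, moment, moment, ENNReal.mul_rpow_of_nonneg _ _ hθ, ENNReal.mul_rpow_of_nonneg _ _ hθ',
    mul_mul_mul_comm, hsplit]
  exact mul_le_mul' le_rfl h

/-- Interpolation of the square functions with respect to the second and sixth moments. -/
theorem sum_moment_le {p ℓ : ℝ} (hp : 2 ≤ p) (hp6 : p ≤ 6) {g : ℝ → ℂ} {ι : Type*} (s : Finset ι)
    (a : ι → ℝ) (hg : ∀ i ∈ s, IntegrableOn g (Set.Icc (a i) (a i + ℓ))) (c : ℝ × ℝ) {R : ℝ}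
    (hR : 0 < R) :
    (∑ i ∈ s, moment p (a i) ℓ c R g ^ (2 / p)) ^ (p / 2) ≤
      (∑ i ∈ s, moment 2 (a i) ℓ c R g) ^ ((6 - p) / 4) *
        (∑ i ∈ s, moment 6 (a i) ℓ c R g ^ (1 / 3 : ℝ)) ^ (3 * (p - 2) / 4) := by
  have hp0 : 0 < p := by linarith
  have hα : 0 ≤ (6 - p) / (2 * p) := div_nonneg (by linarith) (by linarith)
  have hβ : 0 ≤ 3 * (p - 2) / (2 * p) := div_nonneg (by linarith) (by linarith)
  have hαβ : (6 - p) / (2 * p) + 3 * (p - 2) / (2 * p) = 1 := by field_simp; ring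
  have h1 : ∑ i ∈ s, moment p (a i) ℓ c R g ^ (2 / p) ≤
      ∑ i ∈ s, moment 2 (a i) ℓ c R g ^ ((6 - p) / (2 * p)) *
        (moment 6 (a i) ℓ c R g ^ (1 / 3 : ℝ)) ^ (3 * (p - 2) / (2 * p)) := by
    refine Finset.sum_le_sum fun i hi => ?_
    refine (ENNReal.rpow_le_rpow (moment_le hp hp6 (hg i hi) c hR) (by positivity)).trans
      (le_of_eq ?_)
    rw [ENNReal.mul_rpow_of_nonneg _ _ (by positivity), ← ENNReal.rpow_mul, ← ENNReal.rpow_mul,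
      ← ENNReal.rpow_mul]
    congr 2 <;> field_simp <;> ring
  refine (ENNReal.rpow_le_rpow (h1.trans (sum_rpow_mul_rpow_le s _ _ hα hβ hαβ))
    (by positivity)).trans (le_of_eq ?_)
  rw [ENNReal.mul_rpow_of_nonneg _ _ (by positivity), ← ENNReal.rpow_mul, ← ENNReal.rpow_mul]
  congr 2 <;> field_simp <;> ring

/-- Ball inflation for square functions. -/
theorem exists_ball_inflation : ∃ C : ℝ≥0, ∀ (M L : ℕ) (σ ν e e' s q : ℝ) (g : ℝ → ℂ),
    M * σ = 1 → L * σ = ν → 0 < σ → 0 < ν → ν ≤ 1 → 0 ≤ e → e + ν ≤ 1 → 0 ≤ e' → e' + ν ≤ 1 →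
    Separated ν e e' ν → 2 ≤ s → s ≤ 4 → 2 ≤ q → q ≤ 4 → IntegrableOn g (Set.Icc 0 1) → ∀ z : ℝ × ℝ,
    ((M : ℝ≥0∞) ^ 2)⁻¹ * ∑ p ∈ Finset.range M ×ˢ Finset.range M,
      squareSum 2 e ν σ (cellCenter z (σ ^ 2)⁻¹ σ⁻¹ p.1 p.2) σ⁻¹ g ^ (s / 2) *
      squareSum 2 e' ν σ (cellCenter z (σ ^ 2)⁻¹ σ⁻¹ p.1 p.2) σ⁻¹ g ^ (q / 2) ≤
      C * (ENNReal.ofReal ν⁻¹ *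
        ((∑ k ∈ Finset.range L, moment s (e + k * σ) σ z (σ ^ 2)⁻¹ g ^ (2 / s)) ^ (s / 2) *
        (∑ k ∈ Finset.range L, moment q (e' + k * σ) σ z (σ ^ 2)⁻¹ g ^ (2 / q)) ^ (q / 2))) := by
  obtain ⟨C, hC⟩ := exists_ball_inflation_pair
  refine ⟨C, fun M L σ ν e e' s q g hM hL hσ hν hν1 he heν he' he'ν hsep hs hs4 hq hq4 hg z => ?_⟩
  simp only [squareSum_two hσ hL]
  have hM0 : 0 < M := by
    rcases Nat.eq_zero_or_pos M with h | h
    · rw [h] at hM; simp at hM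
    · exact h
  have hσ1 : σ ≤ 1 := by
    have : (1 : ℝ) ≤ M := by exact_mod_cast hM0
    nlinarith
  have hk : ∀ k ∈ Finset.range L, 0 ≤ k * σ ∧ k * σ + σ ≤ ν := fun k hk => by
    have : (k : ℝ) + 1 ≤ L := by exact_mod_cast Finset.mem_range.1 hk
    exact ⟨by positivity, by rw [← hL]; nlinarith⟩
  have hint : ∀ e : ℝ, 0 ≤ e → e + ν ≤ 1 → ∀ k ∈ Finset.range L,
      IntegrableOn g (Set.Icc (e + k * σ) (e + k * σ + σ)) := fun e he heν k hkL =>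
    hg.mono_set (Set.Icc_subset_Icc (by linarith [(hk k hkL).1]) (by linarith [(hk k hkL).2]))
  have hMσ : ((M : ℝ≥0∞) ^ 2)⁻¹ = ENNReal.ofReal (σ ^ 2) := by
    rw [show σ = (M : ℝ)⁻¹ from eq_inv_of_mul_eq_one_right hM, inv_pow,
      ENNReal.ofReal_inv_of_pos (by positivity), ENNReal.ofReal_pow (by positivity),
      ENNReal.ofReal_natCast]
  have hmom : ∀ p a, moment p a σ z (σ ^ 2)⁻¹ g = ENNReal.ofReal (σ ^ 4) *
      ∫⁻ x, ‖extend a σ g x‖ₑ ^ p * ENNReal.ofReal (weight z (σ ^ 2)⁻¹ x) := fun p a => by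
    rw [moment]
    congr 2
    field_simp
  rw [Finset.mul_sum]
  have hs0 : 0 ≤ s / 2 := by linarith
  have hq0 : 0 ≤ q / 2 := by linarith
  -- The exponents `2 / s` and `2 / q` undo the powers `s / 2` and `q / 2` in the bilinear estimate
  -- for single functions.
  have key := sum_mul_le_of_pairwise (Finset.range M ×ˢ Finset.range M) (Finset.range L)
    (Finset.range L)
    (fun k p => moment 2 (e + k * σ) σ (cellCenter z (σ ^ 2)⁻¹ σ⁻¹ p.1 p.2) σ⁻¹ g)
    (fun k p => moment 2 (e' + k * σ) σ (cellCenter z (σ ^ 2)⁻¹ σ⁻¹ p.1 p.2) σ⁻¹ g)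
    (fun k => moment s (e + k * σ) σ z (σ ^ 2)⁻¹ g ^ (2 / s))
    (fun k => moment q (e' + k * σ) σ z (σ ^ 2)⁻¹ g ^ (2 / q))
    (C * (ENNReal.ofReal ν⁻¹ * (ENNReal.ofReal (σ ^ 2))⁻¹)) (α := s / 2) (β := q / 2) (by linarith)
    (by linarith) ?_
  · rw [← Finset.mul_sum, hMσ]
    refine (mul_le_mul' le_rfl key).trans (le_of_eq ?_)
    have h1 : ENNReal.ofReal (σ ^ 2) * (ENNReal.ofReal (σ ^ 2))⁻¹ = 1 :=
      ENNReal.mul_inv_cancel (by rw [Ne, ENNReal.ofReal_eq_zero, not_le]; positivity)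
        ENNReal.ofReal_ne_top
    generalize (∑ k ∈ Finset.range L, moment s (e + k * σ) σ z (σ ^ 2)⁻¹ g ^ (2 / s)) ^ (s / 2) = X
    generalize (∑ k ∈ Finset.range L, moment q (e' + k * σ) σ z (σ ^ 2)⁻¹ g ^ (2 / q)) ^ (q / 2) = Y
    calc _ = (ENNReal.ofReal (σ ^ 2) * (ENNReal.ofReal (σ ^ 2))⁻¹) *
          (C * (ENNReal.ofReal ν⁻¹ * (X * Y))) := by ring
      _ = _ := by rw [h1, one_mul]
  · intro k hkL k' hkL'
    obtain ⟨i1, i2⟩ := hk k hkL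
    obtain ⟨j1, j2⟩ := hk k' hkL'
    have hd : ν ≤ |(e + k * σ) - (e' + k' * σ)| :=
      hsep _ ⟨by linarith, by linarith⟩ _ ⟨by linarith, by linarith⟩
    have hne : e + k * σ ≠ e' + k' * σ := fun h => by
      rw [h, sub_self, abs_zero] at hd; linarith
    have h := hC M σ (e + k * σ) (e' + k' * σ) s q g hM hσ hσ1 (by linarith) (by linarith)
      (by linarith) (by linarith) hne hs hs4 hq hq4 (hint e he heν k hkL) (hint e' he' he'ν k' hkL') z
    refine h.trans ?_
    have hinv : ENNReal.ofReal |(e + k * σ) - (e' + k' * σ)|⁻¹ ≤ ENNReal.ofReal ν⁻¹ :=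
      ENNReal.ofReal_le_ofReal (inv_anti₀ hν hd)
    rw [← ENNReal.rpow_mul, ← ENNReal.rpow_mul, show 2 / s * (s / 2) = 1 by field_simp,
      show 2 / q * (q / 2) = 1 by field_simp, ENNReal.rpow_one, ENNReal.rpow_one, hmom, hmom]
    have h6 : ENNReal.ofReal (σ ^ 6) = (ENNReal.ofReal (σ ^ 2))⁻¹ *
        (ENNReal.ofReal (σ ^ 4) * ENNReal.ofReal (σ ^ 4)) := by
      rw [← ENNReal.ofReal_inv_of_pos (by positivity), ← ENNReal.ofReal_mul (by positivity),
        ← ENNReal.ofReal_mul (by positivity)]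
      refine congrArg ENNReal.ofReal ?_
      field_simp
    rw [h6]
    calc _ ≤ C * (ENNReal.ofReal ν⁻¹ * ((ENNReal.ofReal (σ ^ 2))⁻¹ *
        (ENNReal.ofReal (σ ^ 4) * ENNReal.ofReal (σ ^ 4)) *
        ((∫⁻ x, ‖extend (e + k * σ) σ g x‖ₑ ^ s * ENNReal.ofReal (weight z (σ ^ 2)⁻¹ x)) *
          ∫⁻ x, ‖extend (e' + k' * σ) σ g x‖ₑ ^ q * ENNReal.ofReal (weight z (σ ^ 2)⁻¹ x)))) := by
          gcongr
      _ = _ := by ring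

/-- Orthogonality passes from intervals of length `σ` to intervals of length `σ²` on squares of side
length `σ⁻²`. -/
theorem exists_sum_moment_two_le : ∃ C : ℝ≥0, ∀ (M L : ℕ) (σ ν e : ℝ) (g : ℝ → ℂ),
    M * σ = 1 → L * σ = ν → 0 < σ → 0 ≤ e → e + ν ≤ 1 → IntegrableOn g (Set.Icc 0 1) → ∀ z : ℝ × ℝ,
    ∑ k ∈ Finset.range L, moment 2 (e + k * σ) σ z (σ ^ 2)⁻¹ g ≤
      C * squareSum 2 e ν (σ ^ 2) z (σ ^ 2)⁻¹ g := by
  obtain ⟨C, hC⟩ := exists_local_orthogonality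
  refine ⟨C, fun M L σ ν e g hM hL hσ he heν hg z => ?_⟩
  have hMσ : M * σ ^ 2 = σ := by rw [sq, ← mul_assoc, hM, one_mul]
  have hLM : ((L * M : ℕ) : ℝ) * σ ^ 2 = ν := by push_cast; rw [mul_assoc, hMσ, hL]
  rw [squareSum_two (by positivity) hLM, sum_range_mul, Finset.mul_sum]
  refine Finset.sum_le_sum fun k hkL => ?_
  have hkν : k * σ + σ ≤ ν := by
    have : (k : ℝ) + 1 ≤ L := by exact_mod_cast Finset.mem_range.1 hkL
    rw [← hL]; nlinarith
  have hk0 : 0 ≤ k * σ := by positivity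
  have h := hC (e + k * σ) (σ ^ 2) (σ ^ 2)⁻¹ (by positivity) (by positivity)
    (le_of_eq (inv_mul_cancel₀ (by positivity)).symm) M g
    (hg.mono_set (Set.Icc_subset_Icc (by linarith) (by rw [hMσ]; linarith))) z
  rw [hMσ] at h
  have e1 : ∀ j : ℕ, e + ((k * M + j : ℕ) : ℝ) * σ ^ 2 = e + k * σ + j * σ ^ 2 := fun j => by
    push_cast
    linear_combination (k : ℝ) * hMσ
  simp only [e1, moment]
  rw [← Finset.mul_sum, mul_left_comm]
  exact mul_le_mul' le_rfl h

/-! ### Averaging over a partition of a square -/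

/-- The weights of the squares of a partition add up to a multiple of the weight of the whole
square. -/
theorem exists_sum_weight_le : ∃ C : ℝ≥0, ∀ (Q : ℕ) (r R : ℝ), 0 < Q → 0 < r → Q * r = R →
    ∀ c x : ℝ × ℝ, ∑ p ∈ Finset.range Q ×ˢ Finset.range Q,
      ENNReal.ofReal (weight (cellCenter c R r p.1 p.2) r x) ≤ C * ENNReal.ofReal (weight c R x) := by
  obtain ⟨C, hC⟩ := exists_sum_dec_le
  obtain ⟨A, hA⟩ : ∃ A : ℝ, A = (1 + 1) ^ 100 := ⟨_, rfl⟩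
  obtain ⟨A', hA'⟩ : ∃ A : ℝ, A = 2 ^ (100 - 1) := ⟨_, rfl⟩
  have hA0 : 0 ≤ A := by rw [hA]; positivity
  have hA'0 : 0 ≤ A' := by rw [hA']; positivity
  refine ⟨(A' * A).toNNReal * (C * C + 1), fun Q r R hQ hr hR c x => ?_⟩
  have hQ1 : (1 : ℝ) ≤ Q := by exact_mod_cast hQ
  have hQ0 : (0 : ℝ) < Q := by linarith
  have hR0 : 0 < R := by rw [← hR]; positivity
  have hw0 := weight_nonneg c hR0 x
  obtain ⟨S, hS⟩ : ∃ S : ℝ, S = (Q : ℝ)⁻¹ ^ 100 := ⟨_, rfl⟩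
  have hS0 : 0 ≤ S := by rw [hS]; positivity
  have hSQ : S ≤ (Q : ℝ)⁻¹ ^ 2 := by
    rw [hS]; exact pow_le_pow_of_le_one (by positivity) (inv_le_one_of_one_le₀ hQ1) (by norm_num)
  have hterm : ∀ p ∈ Finset.range Q ×ˢ Finset.range Q,
      weight (cellCenter c R r p.1 p.2) r x ≤ A' * A * weight c R x *
        (prodDec 2 (cellCenter c R r p.1 p.2) r x + S) := fun p hp => by
    rw [Finset.mem_product, Finset.mem_range, Finset.mem_range] at hp
    have hz := square_subset_ball hR0 (cellCenter_mem_square hr hR c hp.1 hp.2)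
    obtain ⟨z, hz'⟩ : ∃ z, z = cellCenter c R r p.1 p.2 := ⟨_, rfl⟩
    rw [← hz'] at hz ⊢
    have h1 := dec_rad_shift 100 (x - z) (z - c) hR0
    rw [sub_add_sub_cancel, ← weight_eq c hR0] at h1
    have h0 := div_nonneg (rad_nonneg (z - c)) hR0.le
    have h2 : dec 100 (rad (x - z) / R) ≤ A * weight c R x := by
      refine h1.trans (mul_le_mul_of_nonneg_right ?_ hw0)
      rw [hA]
      exact pow_le_pow_left₀ (by positivity) (by linarith) _
    have h3 : dec 100 (rad (x - z) / r) ≤ prodDec 2 z r x := by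
      refine (dec_rad_le_mul (m := 50) (n := 50) (x - z) hr).trans ?_
      exact mul_le_mul (dec_anti_left (by norm_num) _) (dec_anti_left (by norm_num) _)
        (dec_pos _ _).le (dec_pos _ _).le
    have ht : rad (x - z) / R = (Q : ℝ)⁻¹ * (rad (x - z) / r) := by
      rw [← hR]; field_simp
    have ht0 := div_nonneg (rad_nonneg (x - z)) hr.le
    rw [ht] at h2
    rw [weight_eq z hr]
    generalize rad (x - z) / r = t at h2 h3 ht0 ⊢
    -- For `t ≤ Q` the first factor on the right is bounded below. For `t ≥ Q` the left-hand side is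
    -- about `Q ^ (-100)` times that factor, which is summable over the `Q ^ 2` squares.
    have h4 : dec 100 t ≤ dec 100 ((Q : ℝ)⁻¹ * t) * (A' * (dec 100 t + S)) := by
      have i1 : (1 + (Q : ℝ)⁻¹ * t) * (1 + t)⁻¹ ≤ (1 + t)⁻¹ + (Q : ℝ)⁻¹ := by
        rw [← div_eq_mul_inv, div_le_iff₀ (by positivity), add_mul, inv_mul_cancel₀ (by positivity)]
        nlinarith [inv_pos.2 hQ0]
      have i2 : ((1 + (Q : ℝ)⁻¹ * t) * (1 + t)⁻¹) ^ 100 ≤ A' * (dec 100 t + S) := by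
        rw [dec, abs_of_nonneg ht0, ← inv_pow, hA', hS]
        exact (pow_le_pow_left₀ (by positivity) i1 _).trans
          (add_pow_le (by positivity) (by positivity) _)
      have i3 : dec 100 t = dec 100 ((Q : ℝ)⁻¹ * t) * ((1 + (Q : ℝ)⁻¹ * t) * (1 + t)⁻¹) ^ 100 := by
        rw [dec, dec, abs_of_nonneg ht0, abs_of_nonneg (by positivity), mul_pow, ← mul_assoc,
          inv_mul_cancel₀ (by positivity), one_mul, inv_pow]
      nth_rewrite 1 [i3]
      exact mul_le_mul_of_nonneg_left i2 (dec_pos _ _).le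
    calc _ ≤ _ := h4
      _ ≤ (A * weight c R x) * (A' * (prodDec 2 z r x + S)) := by
          have := (dec_pos 100 t).le
          have := mul_nonneg hA0 hw0
          exact mul_le_mul h2 (mul_le_mul_of_nonneg_left (by linarith) hA'0)
            (mul_nonneg hA'0 (by linarith)) this
      _ = _ := by ring
  have hprod : ∑ p ∈ Finset.range Q ×ˢ Finset.range Q,
      ENNReal.ofReal (prodDec 2 (cellCenter c R r p.1 p.2) r x) ≤ C * C := by
    have e : ∀ i j : ℕ, ENNReal.ofReal (prodDec 2 (cellCenter c R r i j) r x) =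
        ENNReal.ofReal (dec 2 (-1 * i + ((x.1 - c.1 + R / 2) / r - 1 / 2))) *
        ENNReal.ofReal (dec 2 (-1 * j + ((x.2 - c.2 + R / 2) / r - 1 / 2))) := fun i j => by
      rw [← ENNReal.ofReal_mul (dec_pos _ _).le, prodDec, cellCenter]
      congr 3 <;> field_simp <;> ring
    rw [Finset.sum_product]
    simp only [e]
    rw [← Finset.sum_mul_sum]
    have h := fun γ => hC (-1) (by norm_num) (by norm_num) γ Q
    simp only [abs_neg, abs_one, inv_one, ENNReal.ofReal_one, mul_one] at h
    exact mul_le_mul' (h _) (h _)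
  calc _ ≤ ∑ p ∈ Finset.range Q ×ˢ Finset.range Q, ENNReal.ofReal (A' * A * weight c R x) *
          (ENNReal.ofReal (prodDec 2 (cellCenter c R r p.1 p.2) r x) + ENNReal.ofReal S) := by
        refine Finset.sum_le_sum fun p hp => ?_
        rw [← ENNReal.ofReal_add (prodDec_nonneg _ _ _ _) hS0, ← ENNReal.ofReal_mul (by positivity)]
        exact ENNReal.ofReal_le_ofReal (hterm p hp)
    _ ≤ ENNReal.ofReal (A' * A * weight c R x) * (C * C + 1) := by
        rw [← Finset.mul_sum, Finset.sum_add_distrib]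
        gcongr
        rw [Finset.sum_const, Finset.card_product, Finset.card_range, nsmul_eq_mul,
          ← ENNReal.ofReal_natCast, ← ENNReal.ofReal_mul (by positivity), ENNReal.ofReal_le_one]
        push_cast
        calc (Q : ℝ) * Q * S ≤ Q * Q * (Q : ℝ)⁻¹ ^ 2 := by gcongr
          _ = 1 := by field_simp
    _ = _ := by
        rw [ENNReal.ofReal_mul (mul_nonneg hA'0 hA0)]
        push_cast
        change _ = ENNReal.ofReal (A' * A) * _ * _
        ring

theorem avgCells_eq {Q : ℕ} {R ℓ : ℝ} (hℓ : 0 < ℓ) (h : Q * ℓ = R) (c : ℝ × ℝ)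
    (F : ℝ × ℝ → ℝ≥0∞) : avgCells c R ℓ F = ((Q : ℝ≥0∞) ^ 2)⁻¹ *
      ∑ p ∈ Finset.range Q ×ˢ Finset.range Q, F (cellCenter c R ℓ p.1 p.2) := by
  rw [avgCells, numCells_eq hℓ h, Finset.sum_product]

/-- The cells of the cells of a partition are the cells of the finer partition. -/
theorem cellCenter_cellCenter {M : ℕ} {ρ r : ℝ} (h : M * ρ = r) (c : ℝ × ℝ) (R : ℝ)
    (i j i' j' : ℕ) : cellCenter (cellCenter c R r i j) r ρ i' j' =
      cellCenter c R ρ (i * M + i') (j * M + j') := by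
  ext <;> simp only [cellCenter] <;> push_cast <;> rw [← h] <;> ring

/-- Averaging over a partition is averaging over a refinement of a coarser partition. -/
theorem avgCells_refine {M Q : ℕ} {ρ r R : ℝ} (hM : 0 < M) (hρ : 0 < ρ) (hr : M * ρ = r)
    (hR : Q * r = R) (c : ℝ × ℝ) (F : ℝ × ℝ → ℝ≥0∞) :
    avgCells c R ρ F = avgCells c R r fun z => avgCells z r ρ F := by
  have hr0 : 0 < r := by rw [← hr]; positivity
  have hQM : ((Q * M : ℕ) : ℝ) * ρ = R := by push_cast; rw [mul_assoc, hr, hR]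
  have hc : (((Q * M : ℕ) : ℝ≥0∞) ^ 2)⁻¹ = ((Q : ℝ≥0∞) ^ 2)⁻¹ * ((M : ℝ≥0∞) ^ 2)⁻¹ := by
    rw [← ENNReal.mul_inv (by simp) (by simp), ← mul_pow]
    push_cast
    rfl
  simp only [avgCells, numCells_eq hρ hQM, numCells_eq hr0 hR, numCells_eq hρ hr,
    cellCenter_cellCenter hr, hc, ← Finset.mul_sum]
  rw [mul_assoc]
  congr 2
  rw [sum_range_mul _ Q]
  refine Finset.sum_congr rfl fun i _ => ?_
  rw [Finset.sum_comm (s := Finset.range Q)]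
  exact Finset.sum_congr rfl fun i' _ => sum_range_mul _ Q M

/-- Hölder's inequality for averages. -/
theorem mul_sum_rpow_mul_rpow_le {ι : Type*} (κ : ℝ≥0∞) (s : Finset ι) (f g : ι → ℝ≥0∞) {p q : ℝ}
    (hp : 0 ≤ p) (hq : 0 ≤ q) (hpq : p + q = 1) :
    κ * ∑ i ∈ s, f i ^ p * g i ^ q ≤ (κ * ∑ i ∈ s, f i) ^ p * (κ * ∑ i ∈ s, g i) ^ q := by
  rw [ENNReal.mul_rpow_of_nonneg _ _ hp, ENNReal.mul_rpow_of_nonneg _ _ hq, mul_mul_mul_comm,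
    ← ENNReal.rpow_add_of_nonneg _ _ hp hq, hpq, ENNReal.rpow_one]
  exact mul_le_mul' le_rfl (sum_rpow_mul_rpow_le s f g hp hq hpq)

/-- The average of the cubed sixth-moment square function over the small squares is controlled by
rescaled linear decoupling. -/
theorem exists_average_cube_le : ∃ C : ℝ≥0, ∀ (Q L N : ℕ) (σ δ ν e : ℝ) (g : ℝ → ℂ),
    0 < Q → 0 < N → Q * (σ ^ 2)⁻¹ = (δ ^ 2)⁻¹ → L * σ = ν → N * δ = σ → 0 < δ → σ ≤ 1 → ν ≤ 1 →
    0 ≤ e → e + ν ≤ 1 → IntegrableOn g (Set.Icc 0 1) → ∀ c : ℝ × ℝ,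
    ((Q : ℝ≥0∞) ^ 2)⁻¹ * ∑ p ∈ Finset.range Q ×ˢ Finset.range Q,
      (∑ k ∈ Finset.range L, moment 6 (e + k * σ) σ
        (cellCenter c (δ ^ 2)⁻¹ (σ ^ 2)⁻¹ p.1 p.2) (σ ^ 2)⁻¹ g ^ (1 / 3 : ℝ)) ^ (3 : ℝ) ≤
      C * (linearConst (1 / (N : ℝ)) ^ (6 : ℝ) *
        squareSum 6 e ν δ c (δ ^ 2)⁻¹ g ^ (3 : ℝ)) := by
  obtain ⟨C₁, hC₁⟩ := exists_sum_weight_le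
  obtain ⟨C₂, hC₂⟩ := exists_rescaled_decoupling
  refine ⟨C₁ * C₂, fun Q L N σ δ ν e g hQ hN hQR hL hNδ hδ hσ1 hν1 he heν hg c => ?_⟩
  have hσ : 0 < σ := by rw [← hNδ]; positivity
  have hr : 0 < (σ ^ 2)⁻¹ := by positivity
  have hR : 0 < (δ ^ 2)⁻¹ := by positivity
  have hLN : ((L * N : ℕ) : ℝ) * δ = ν := by push_cast; rw [mul_assoc, hNδ, hL]
  obtain ⟨D, hD⟩ : ∃ D, D = linearConst (1 / (N : ℝ)) ^ (6 : ℝ) := ⟨_, rfl⟩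
  obtain ⟨κ, hκ⟩ : ∃ κ, κ = ((Q : ℝ≥0∞) ^ 2)⁻¹ := ⟨_, rfl⟩
  have hκr : κ * ENNReal.ofReal ((σ ^ 2)⁻¹ ^ 2)⁻¹ = ENNReal.ofReal ((δ ^ 2)⁻¹ ^ 2)⁻¹ := by
    rw [hκ, ← ENNReal.ofReal_natCast, ← ENNReal.ofReal_pow (by positivity),
      ← ENNReal.ofReal_inv_of_pos (by positivity), ← ENNReal.ofReal_mul (by positivity), ← hQR,
      mul_pow, mul_inv]
  have hk : ∀ k ∈ Finset.range L, 0 ≤ k * σ ∧ k * σ + σ ≤ ν := fun k hk => by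
    have : (k : ℝ) + 1 ≤ L := by exact_mod_cast Finset.mem_range.1 hk
    exact ⟨by positivity, by rw [← hL]; nlinarith⟩
  have hint : ∀ k ∈ Finset.range L, IntegrableOn g (Set.Icc (e + k * σ) (e + k * σ + σ)) :=
    fun k hkL => hg.mono_set (Set.Icc_subset_Icc (by linarith [(hk k hkL).1])
      (by linarith [(hk k hkL).2]))
  have h1 : ∀ k ∈ Finset.range L, κ * ∑ p ∈ Finset.range Q ×ˢ Finset.range Q,
      moment 6 (e + k * σ) σ (cellCenter c (δ ^ 2)⁻¹ (σ ^ 2)⁻¹ p.1 p.2) (σ ^ 2)⁻¹ g ≤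
      C₁ * moment 6 (e + k * σ) σ c (δ ^ 2)⁻¹ g := fun k hkL => by
    have hm : ∀ p ∈ Finset.range Q ×ˢ Finset.range Q, AEMeasurable (fun x =>
        ‖extend (e + k * σ) σ g x‖ₑ ^ (6 : ℝ) * ENNReal.ofReal
          (weight (cellCenter c (δ ^ 2)⁻¹ (σ ^ 2)⁻¹ p.1 p.2) (σ ^ 2)⁻¹ x)) := fun p _ =>
      ((measurable_enorm_rpow_extend (hint k hkL) 6).mul (measurable_weight _ hr)).aemeasurable
    simp only [moment]
    rw [← Finset.mul_sum, ← mul_assoc, hκr, mul_left_comm, ← lintegral_finsetSum' _ hm,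
      ← lintegral_const_mul' _ _ ENNReal.coe_ne_top]
    refine mul_le_mul' le_rfl (lintegral_mono fun x => ?_)
    rw [← Finset.mul_sum, mul_left_comm]
    exact mul_le_mul' le_rfl (hC₁ Q _ _ hQ hr hQR c x)
  have h2 : ∀ k ∈ Finset.range L, moment 6 (e + k * σ) σ c (δ ^ 2)⁻¹ g ≤ C₂ * (D *
      (∑ j ∈ Finset.range N, moment 6 (e + k * σ + j * δ) δ c (δ ^ 2)⁻¹ g ^ (1 / 3 : ℝ)) ^ (3 : ℝ)) :=
    fun k hkL => by
    have h := hC₂ N (e + k * σ) σ δ (δ ^ 2)⁻¹ g hN (by linarith [(hk k hkL).1])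
      (by linarith [(hk k hkL).2]) hσ hσ1 hNδ (inv_mul_cancel₀ (by positivity)) (hint k hkL) c
    rw [← hD] at h
    simp only [moment, ENNReal.mul_rpow_of_nonneg (ENNReal.ofReal ((δ ^ 2)⁻¹ ^ 2)⁻¹) _
      (by norm_num : (0 : ℝ) ≤ 1 / 3)]
    rw [← Finset.mul_sum, ENNReal.mul_rpow_of_nonneg _ _ (by norm_num : (0 : ℝ) ≤ 3), rpow_cubeRoot]
    refine (mul_le_mul' le_rfl h).trans (le_of_eq ?_)
    generalize ENNReal.ofReal ((δ ^ 2)⁻¹ ^ 2)⁻¹ = X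
    ring
  rw [← hκ, ← hD, squareSum_six hδ hLN, sum_range_mul]
  have e1 : ∀ k j : ℕ, e + ((k * N + j : ℕ) : ℝ) * δ = e + k * σ + j * δ := fun k j => by
    push_cast
    linear_combination (k : ℝ) * hNδ
  simp only [e1]
  calc _ = ∑ p ∈ Finset.range Q ×ˢ Finset.range Q, (∑ k ∈ Finset.range L, (κ * moment 6 (e + k * σ) σ
        (cellCenter c (δ ^ 2)⁻¹ (σ ^ 2)⁻¹ p.1 p.2) (σ ^ 2)⁻¹ g) ^ (1 / 3 : ℝ)) ^ (3 : ℝ) := by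
        rw [Finset.mul_sum]
        refine Finset.sum_congr rfl fun p _ => ?_
        simp only [ENNReal.mul_rpow_of_nonneg κ _ (by norm_num : (0 : ℝ) ≤ 1 / 3)]
        rw [← Finset.mul_sum, ENNReal.mul_rpow_of_nonneg _ _ (by norm_num : (0 : ℝ) ≤ 3),
          rpow_cubeRoot]
    _ ≤ (∑ k ∈ Finset.range L, (κ * ∑ p ∈ Finset.range Q ×ˢ Finset.range Q, moment 6 (e + k * σ) σ
        (cellCenter c (δ ^ 2)⁻¹ (σ ^ 2)⁻¹ p.1 p.2) (σ ^ 2)⁻¹ g) ^ (1 / 3 : ℝ)) ^ (3 : ℝ) := by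
        refine (sum_sum_rpow_le _ _ _ (by norm_num)).trans (le_of_eq ?_)
        simp only [rpow_cubeRoot, Finset.mul_sum]
    _ ≤ (∑ k ∈ Finset.range L, (C₁ * (C₂ * (D * (∑ j ∈ Finset.range N,
          moment 6 (e + k * σ + j * δ) δ c (δ ^ 2)⁻¹ g ^ (1 / 3 : ℝ)) ^ (3 : ℝ)))) ^ (1 / 3 : ℝ)) ^
            (3 : ℝ) := by
        refine ENNReal.rpow_le_rpow (Finset.sum_le_sum fun k hkL =>
          ENNReal.rpow_le_rpow ?_ (by norm_num)) (by norm_num)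
        exact (h1 k hkL).trans (mul_le_mul' le_rfl (h2 k hkL))
    _ = (∑ k ∈ Finset.range L, (C₁ * C₂ * D) ^ (1 / 3 : ℝ) * ∑ j ∈ Finset.range N,
          moment 6 (e + k * σ + j * δ) δ c (δ ^ 2)⁻¹ g ^ (1 / 3 : ℝ)) ^ (3 : ℝ) := by
        refine congrArg (· ^ (3 : ℝ)) (Finset.sum_congr rfl fun k _ => ?_)
        rw [← mul_assoc, ← mul_assoc, ENNReal.mul_rpow_of_nonneg _ _ (by norm_num : (0 : ℝ) ≤ 1 / 3),
          ← ENNReal.rpow_mul _ (3 : ℝ)]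
        norm_num
    _ = _ := by
        rw [← Finset.mul_sum, ENNReal.mul_rpow_of_nonneg _ _ (by norm_num : (0 : ℝ) ≤ 3),
          rpow_cubeRoot]
        push_cast; ring

/-! ### Passing to the next scale -/

/-- The bookkeeping of exponents: with `X` and `X'` the `L²` square functions, `Z` and `Z'` the `L⁶`
square functions, the interpolated product becomes a geometric mean in which the exponents of the
two intervals are exchanged in the first factor. -/
theorem rpow_mul_rpow_le_of_le_mul {s : ℝ} (hs : 2 ≤ s) (hs3 : s ≤ 3) {X X' Y Y' Z Z' K : ℝ≥0∞}
    (hK : 1 ≤ K) (hX : X ≤ K * Y) (hX' : X' ≤ K * Y') :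
    X ^ ((6 - s) / 4) * Z ^ (3 * (s - 2) / 4) *
        (X' ^ ((6 - (6 - s)) / 4) * Z' ^ (3 * (6 - s - 2) / 4)) ≤
      K * K * ((Y ^ ((6 - s) / 2) * Y' ^ (s / 2)) ^ (1 / 2 : ℝ) *
        ((Z ^ (3 : ℝ)) ^ ((s - 2) / 2) * (Z' ^ (3 : ℝ)) ^ ((4 - s) / 2)) ^ (1 / 2 : ℝ)) := by
  have key : ∀ {X Y : ℝ≥0∞} {p : ℝ}, 0 ≤ p → p ≤ 1 → X ≤ K * Y → X ^ p ≤ K * Y ^ p :=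
    fun hp hp1 h => by
      refine (ENNReal.rpow_le_rpow h hp).trans ?_
      rw [ENNReal.mul_rpow_of_nonneg _ _ hp]
      refine mul_le_mul' ?_ le_rfl
      simpa using ENNReal.rpow_le_rpow_of_exponent_le hK hp1
  have h1 := key (p := (6 - s) / 4) (by linarith) (by linarith) hX
  have h2 := key (p := (6 - (6 - s)) / 4) (by linarith) (by linarith) hX'
  refine (mul_le_mul' (mul_le_mul' h1 le_rfl) (mul_le_mul' h2 le_rfl)).trans (le_of_eq ?_)
  rw [ENNReal.mul_rpow_of_nonneg _ _ (by norm_num : (0 : ℝ) ≤ 1 / 2),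
    ENNReal.mul_rpow_of_nonneg _ _ (by norm_num : (0 : ℝ) ≤ 1 / 2)]
  simp only [← ENNReal.rpow_mul]
  rw [show (6 - s) / 2 * (1 / 2) = (6 - s) / 4 by ring,
    show s / 2 * (1 / 2) = (6 - (6 - s)) / 4 by ring,
    show 3 * ((s - 2) / 2) * (1 / 2) = 3 * (s - 2) / 4 by ring,
    show 3 * ((4 - s) / 2) * (1 / 2) = 3 * (6 - s - 2) / 4 by ring]
  ring

/-- Ball inflation, interpolation and orthogonality on one square of side length `σ⁻²`. -/
theorem exists_local_step : ∃ C : ℝ≥0, ∀ (M L : ℕ) (σ ν e e' s : ℝ) (g : ℝ → ℂ),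
    M * σ = 1 → L * σ = ν → 0 < σ → 0 < ν → ν ≤ 1 → 0 ≤ e → e + ν ≤ 1 → 0 ≤ e' → e' + ν ≤ 1 →
    Separated ν e e' ν → 2 ≤ s → s ≤ 3 → IntegrableOn g (Set.Icc 0 1) → ∀ z : ℝ × ℝ,
    avgCells z (σ ^ 2)⁻¹ σ⁻¹ (fun y => squareSum 2 e ν σ y σ⁻¹ g ^ (s / 2) *
      squareSum 2 e' ν σ y σ⁻¹ g ^ ((6 - s) / 2)) ≤
    C * (ENNReal.ofReal ν⁻¹ *
      ((squareSum 2 e ν (σ ^ 2) z (σ ^ 2)⁻¹ g ^ ((6 - s) / 2) *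
        squareSum 2 e' ν (σ ^ 2) z (σ ^ 2)⁻¹ g ^ (s / 2)) ^ (1 / 2 : ℝ) *
      (((∑ k ∈ Finset.range L, moment 6 (e + k * σ) σ z (σ ^ 2)⁻¹ g ^ (1 / 3 : ℝ)) ^ (3 : ℝ)) ^
          ((s - 2) / 2) *
        ((∑ k ∈ Finset.range L, moment 6 (e' + k * σ) σ z (σ ^ 2)⁻¹ g ^ (1 / 3 : ℝ)) ^ (3 : ℝ)) ^
          ((4 - s) / 2)) ^ (1 / 2 : ℝ))) := by
  obtain ⟨C₁, hC₁⟩ := exists_ball_inflation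
  obtain ⟨C₂, hC₂⟩ := exists_sum_moment_two_le
  refine ⟨C₁ * ((C₂ + 1) * (C₂ + 1)),
    fun M L σ ν e e' s g hM hL hσ hν hν1 he heν he' he'ν hsep hs hs3 hg z => ?_⟩
  have hMσ : M * σ⁻¹ = (σ ^ 2)⁻¹ := by
    rw [eq_inv_of_mul_eq_one_left hM]
    field_simp
  have hR : 0 < (σ ^ 2)⁻¹ := by positivity
  have hint : ∀ e : ℝ, 0 ≤ e → e + ν ≤ 1 → ∀ k ∈ Finset.range L,
      IntegrableOn g (Set.Icc (e + k * σ) (e + k * σ + σ)) := fun e he heν k hkL => by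
    have h1 : (k : ℝ) + 1 ≤ L := by exact_mod_cast Finset.mem_range.1 hkL
    have h2 : 0 ≤ k * σ := by positivity
    exact hg.mono_set (Set.Icc_subset_Icc (by linarith) (by rw [← hL] at heν; nlinarith))
  have h := hC₁ M L σ ν e e' s (6 - s) g hM hL hσ hν hν1 he heν he' he'ν hsep hs (by linarith)
    (by linarith) (by linarith) hg z
  rw [avgCells_eq (by positivity) hMσ]
  refine h.trans ?_
  have hX := sum_moment_le hs (by linarith) (Finset.range L) (fun k => e + k * σ) (hint e he heν) z hR
  have hX' := sum_moment_le (p := 6 - s) (by linarith) (by linarith) (Finset.range L)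
    (fun k => e' + k * σ) (hint e' he' he'ν) z hR
  have hY := hC₂ M L σ ν e g hM hL hσ he heν hg z
  have hY' := hC₂ M L σ ν e' g hM hL hσ he' he'ν hg z
  have hK : (1 : ℝ≥0∞) ≤ C₂ + 1 := le_add_self
  have hK' : (C₂ : ℝ≥0∞) ≤ C₂ + 1 := le_self_add
  refine (mul_le_mul' le_rfl (mul_le_mul' le_rfl ((mul_le_mul' hX hX').trans
    (rpow_mul_rpow_le_of_le_mul hs hs3 hK (hY.trans (mul_le_mul' hK' le_rfl))
      (hY'.trans (mul_le_mul' hK' le_rfl)))))).trans (le_of_eq ?_)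
  push_cast
  generalize ENNReal.ofReal ν⁻¹ = a
  ring

/-- One square at a time, the average at scale `σ⁻¹` is controlled by the geometric mean of the
average at scale `σ⁻²`, with the roles of the two intervals exchanged, and of a quantity to which
rescaled linear decoupling applies. -/
theorem exists_bilinear_step : ∃ C : ℝ≥0, ∀ (M L N Q : ℕ) (σ δ ν e e' s : ℝ) (g : ℝ → ℂ)
    (c : ℝ × ℝ) (T : ℝ≥0∞), 0 < Q → 0 < N → M * σ = 1 → L * σ = ν → N * δ = σ →
    Q * (σ ^ 2)⁻¹ = (δ ^ 2)⁻¹ → 0 < σ → 0 < δ → 0 < ν → ν ≤ 1 → 0 ≤ e → e + ν ≤ 1 → 0 ≤ e' →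
    e' + ν ≤ 1 → Separated ν e e' ν → 2 ≤ s → s ≤ 3 → IntegrableOn g (Set.Icc 0 1) →
    avgCells c (δ ^ 2)⁻¹ (σ ^ 2)⁻¹ (fun z => squareSum 2 e' ν (σ ^ 2) z (σ ^ 2)⁻¹ g ^ (s / 2) *
        squareSum 2 e ν (σ ^ 2) z (σ ^ 2)⁻¹ g ^ ((6 - s) / 2)) ≤
      T * (squareSum 6 e' ν δ c (δ ^ 2)⁻¹ g ^ (s / 2) *
        squareSum 6 e ν δ c (δ ^ 2)⁻¹ g ^ ((6 - s) / 2)) →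
    avgCells c (δ ^ 2)⁻¹ σ⁻¹ (fun y => squareSum 2 e ν σ y σ⁻¹ g ^ (s / 2) *
        squareSum 2 e' ν σ y σ⁻¹ g ^ ((6 - s) / 2)) ≤
      C * (ENNReal.ofReal ν⁻¹ * (T ^ (1 / 2 : ℝ) *
        (linearConst (1 / (N : ℝ)) ^ (6 : ℝ)) ^ (1 / 2 : ℝ))) *
        (squareSum 6 e ν δ c (δ ^ 2)⁻¹ g ^ (s / 2) *
          squareSum 6 e' ν δ c (δ ^ 2)⁻¹ g ^ ((6 - s) / 2)) := by
  obtain ⟨C₁, hC₁⟩ := exists_local_step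
  obtain ⟨C₂, hC₂⟩ := exists_average_cube_le
  refine ⟨C₁ * C₂ ^ (1 / 2 : ℝ), fun M L N Q σ δ ν e e' s g c T hQ hN hM hL hN' hQ' hσ hδ hν hν1 he
    heν he' he'ν hsep hs hs3 hg hT => ?_⟩
  have hM0 : 0 < M := by
    rcases Nat.eq_zero_or_pos M with h | h
    · rw [h] at hM; simp at hM
    · exact h
  have hσ1 : σ ≤ 1 := by
    have : (1 : ℝ) ≤ M := by exact_mod_cast hM0
    nlinarith
  have hMσ : M * σ⁻¹ = (σ ^ 2)⁻¹ := by
    rw [eq_inv_of_mul_eq_one_left hM]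
    field_simp
  have hr : 0 < (σ ^ 2)⁻¹ := by positivity
  have hA := hC₂ Q L N σ δ ν e g hQ hN hQ' hL hN' hδ hσ1 hν1 he heν hg c
  have hA' := hC₂ Q L N σ δ ν e' g hQ hN hQ' hL hN' hδ hσ1 hν1 he' he'ν hg c
  have hloc := hC₁ M L σ ν e e' s g hM hL hσ hν hν1 he heν he' he'ν hsep hs hs3 hg
  rw [avgCells_refine hM0 (inv_pos.2 hσ) hMσ hQ', avgCells_eq hr hQ']
  rw [avgCells_eq hr hQ'] at hT
  obtain ⟨κ, hκ⟩ : ∃ κ, κ = ((Q : ℝ≥0∞) ^ 2)⁻¹ := ⟨_, rfl⟩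
  obtain ⟨D, hD⟩ : ∃ D, D = linearConst (1 / (N : ℝ)) ^ (6 : ℝ) := ⟨_, rfl⟩
  rw [← hκ, ← hD] at hA hA'
  rw [← hκ] at hT ⊢
  rw [← hD]
  have h2 : (0 : ℝ) ≤ 1 / 2 := by norm_num
  have hs1 : 0 ≤ (s - 2) / 2 := by linarith
  have hs2 : 0 ≤ (4 - s) / 2 := by linarith
  refine (mul_le_mul' le_rfl (Finset.sum_le_sum fun p _ => hloc _)).trans ?_
  rw [← Finset.mul_sum, ← Finset.mul_sum, mul_left_comm, mul_left_comm κ]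
  refine (mul_le_mul' le_rfl (mul_le_mul' le_rfl
    (mul_sum_rpow_mul_rpow_le κ _ _ _ h2 h2 (by norm_num)))).trans ?_
  have hV := (mul_sum_rpow_mul_rpow_le κ (Finset.range Q ×ˢ Finset.range Q) _ _ hs1 hs2 (by ring)).trans
    (mul_le_mul' (ENNReal.rpow_le_rpow hA hs1) (ENNReal.rpow_le_rpow hA' hs2))
  simp only [mul_comm (squareSum 2 e ν _ _ _ _ ^ (_ : ℝ))]
  refine (mul_le_mul' le_rfl (mul_le_mul' le_rfl
    (mul_le_mul' (ENNReal.rpow_le_rpow hT h2) (ENNReal.rpow_le_rpow hV h2)))).trans (le_of_eq ?_)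
  generalize squareSum 6 e ν δ c (δ ^ 2)⁻¹ g = S
  generalize squareSum 6 e' ν δ c (δ ^ 2)⁻¹ g = S'
  generalize ENNReal.ofReal ν⁻¹ = a
  have hsplit : ∀ E : ℝ≥0∞, E ^ ((s - 2) / 2) * E ^ ((4 - s) / 2) = E := fun E => by
    rw [← ENNReal.rpow_add_of_nonneg _ _ hs1 hs2, show (s - 2) / 2 + (4 - s) / 2 = 1 by ring,
      ENNReal.rpow_one]
  -- The exponents `(s - 2) / 2` and `(4 - s) / 2` add up to `1`, so the constants come out whole.
  have hV' : (C₂ * (D * S ^ (3 : ℝ))) ^ ((s - 2) / 2) * (C₂ * (D * S' ^ (3 : ℝ))) ^ ((4 - s) / 2) =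
      C₂ * D * (S ^ (3 * ((s - 2) / 2)) * S' ^ (3 * ((4 - s) / 2))) := by
    rw [← mul_assoc, ← mul_assoc, ENNReal.mul_rpow_of_nonneg _ _ hs1,
      ENNReal.mul_rpow_of_nonneg _ _ hs2, mul_mul_mul_comm, hsplit, ← ENNReal.rpow_mul,
      ← ENNReal.rpow_mul]
  rw [hV']
  simp only [ENNReal.mul_rpow_of_nonneg _ _ h2, ← ENNReal.rpow_mul]
  have e1 : S ^ (s / 2) = S ^ ((6 - s) / 2 * (1 / 2)) * S ^ (3 * ((s - 2) / 2) * (1 / 2)) := by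
    rw [← ENNReal.rpow_add_of_nonneg _ _ (by linarith) (by linarith)]
    congr 1; ring
  have e2 : S' ^ ((6 - s) / 2) = S' ^ (s / 2 * (1 / 2)) * S' ^ (3 * ((4 - s) / 2) * (1 / 2)) := by
    rw [← ENNReal.rpow_add_of_nonneg _ _ (by linarith) (by linarith)]
    congr 1; ring
  rw [e1, e2, ENNReal.coe_mul, ← ENNReal.coe_rpow_of_nonneg _ h2]
  ring

/-! ### The bilinear constants -/

theorem squareSum_ne_top {p : ℝ} (hp : 0 ≤ p) (a L ℓ : ℝ) (c : ℝ × ℝ) {R : ℝ} (hR : 0 < R)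
    (g : ℝ → ℂ) : squareSum p a L ℓ c R g ≠ ∞ :=
  ENNReal.sum_ne_top.2 fun _ _ => ENNReal.pow_ne_top (ENNReal.rpow_ne_top_of_nonneg (by positivity)
    (ENNReal.mul_ne_top ENNReal.ofReal_ne_top (lintegral_extend_ne_top c hR hp)))

theorem Separated.symm {r a a' ℓ : ℝ} (h : Separated r a a' ℓ) : Separated r a' a ℓ :=
  fun x hx y hy => abs_sub_comm y x ▸ h y hy x hx

/-- A finite infimum defining the bilinear constant is attained. -/
theorem bilinearConst_spec {s : ℝ} (hs : 0 ≤ s) (hs6 : s ≤ 6) {b : ℕ} {δ ν : ℝ} (hδ : 0 < δ)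
    (h : bilinearConst s b δ ν ≠ ∞) {g : ℝ → ℂ} (hg : IntegrableOn g (Set.Icc 0 1)) (c : ℝ × ℝ)
    {m m' : ℕ} (hm : m < numCells 1 ν) (hm' : m' < numCells 1 ν)
    (hsep : Separated ν (m * ν) (m' * ν) ν) :
    avgCells c (δ ^ 2)⁻¹ (ν ^ b)⁻¹ (fun z =>
        squareSum 2 (m * ν) ν (ν ^ b) z (ν ^ b)⁻¹ g ^ (s / 2) *
        squareSum 2 (m' * ν) ν (ν ^ b) z (ν ^ b)⁻¹ g ^ ((6 - s) / 2)) ≤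
      bilinearConst s b δ ν ^ 6 * (squareSum 6 (m * ν) ν δ c (δ ^ 2)⁻¹ g ^ (s / 2) *
        squareSum 6 (m' * ν) ν δ c (δ ^ 2)⁻¹ g ^ ((6 - s) / 2)) := by
  obtain ⟨S, hS⟩ : ∃ S : Set ℝ≥0∞, S = {A : ℝ≥0∞ | ∀ (g : ℝ → ℂ), IntegrableOn g (Set.Icc 0 1) →
      ∀ c : ℝ × ℝ, ∀ m < numCells 1 ν, ∀ m' < numCells 1 ν, Separated ν (m * ν) (m' * ν) ν →
        avgCells c (δ ^ 2)⁻¹ (ν ^ b)⁻¹ (fun z =>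
            squareSum 2 (m * ν) ν (ν ^ b) z (ν ^ b)⁻¹ g ^ (s / 2) *
            squareSum 2 (m' * ν) ν (ν ^ b) z (ν ^ b)⁻¹ g ^ ((6 - s) / 2)) ≤
          A ^ 6 * (squareSum 6 (m * ν) ν δ c (δ ^ 2)⁻¹ g ^ (s / 2) *
            squareSum 6 (m' * ν) ν δ c (δ ^ 2)⁻¹ g ^ ((6 - s) / 2))} := ⟨_, rfl⟩
  have hSM : bilinearConst s b δ ν = sInf S := by rw [bilinearConst, hS]
  have hne : S.Nonempty := by
    rw [Set.nonempty_iff_ne_empty]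
    rintro h0
    rw [hSM, h0, sInf_empty] at h
    exact h rfl
  have hcl : IsClosed S := by
    rw [hS]
    simp only [Set.ofPred_forall]
    refine isClosed_iInter fun g => isClosed_iInter fun _ => isClosed_iInter fun c =>
      isClosed_iInter fun m => isClosed_iInter fun _ => isClosed_iInter fun m' =>
      isClosed_iInter fun _ => isClosed_iInter fun _ => ?_
    refine isClosed_le continuous_const ((ENNReal.continuous_mul_const ?_).comp
      (ENNReal.continuous_pow 6))
    exact ENNReal.mul_ne_top
      (ENNReal.rpow_ne_top_of_nonneg (by linarith)
        (squareSum_ne_top (by norm_num) _ _ _ _ (by positivity) _))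
      (ENNReal.rpow_ne_top_of_nonneg (by linarith)
        (squareSum_ne_top (by norm_num) _ _ _ _ (by positivity) _))
  have hmem := hcl.sInf_mem hne
  rw [← hSM] at hmem
  obtain ⟨A, hA⟩ : ∃ A, A = bilinearConst s b δ ν := ⟨_, rfl⟩
  rw [← hA] at hmem ⊢
  rw [hS] at hmem
  exact hmem g hg c m hm m' hm' hsep

/-- The quotient `δ / ν ^ b` is again the inverse of a positive integer. -/
theorem ratio_eq_one_div {b n d n₀ : ℕ} (hn : 0 < n) (hd : 0 < d)
    (h : (1 / (n : ℝ)) ^ (2 * b) * (1 / (d : ℝ))⁻¹ = n₀) :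
    0 < n₀ ∧ 1 / (d : ℝ) / (1 / (n : ℝ)) ^ b = 1 / ((n₀ * n ^ b : ℕ) : ℝ) := by
  have h0 : 0 < (n₀ : ℝ) := by rw [← h]; positivity
  have hn' : (n : ℝ) ^ b ≠ 0 := by positivity
  refine ⟨by exact_mod_cast h0, ?_⟩
  rw [one_div (d : ℝ), inv_inv, two_mul, pow_add, one_div, inv_pow] at h
  push_cast
  rw [← h, one_div (n : ℝ), inv_pow]
  field_simp

/-- The passage from scale `b` to scale `2b`, with the exact power of `ν` and an absolute
constant. -/
theorem exists_bilinearConst_le : ∃ C : ℝ≥0, ∀ (s : ℝ) (b n d n₀ : ℕ), 2 ≤ s → s ≤ 3 → 1 ≤ b →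
    0 < n → 0 < d → (1 / (n : ℝ)) ^ (2 * b) * (1 / (d : ℝ))⁻¹ = n₀ → ∀ A : ℝ≥0∞,
    bilinearConst s (2 * b) (1 / d) (1 / n) ≠ ∞ →
    C * (ENNReal.ofReal (1 / (n : ℝ))⁻¹ *
      ((bilinearConst s (2 * b) (1 / d) (1 / n) ^ 6) ^ (1 / 2 : ℝ) *
      (linearConst (1 / d / (1 / n) ^ b) ^ (6 : ℝ)) ^ (1 / 2 : ℝ))) ≤ A ^ 6 →
    bilinearConst s b (1 / d) (1 / n) ≤ A := by
  obtain ⟨C, hC⟩ := exists_bilinear_step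
  refine ⟨C, fun s b n d n₀ hs hs3 hb hn hd hn₀ A hfin hA => sInf_le ?_⟩
  obtain ⟨ν, hν⟩ : ∃ ν : ℝ, ν = 1 / n := ⟨_, rfl⟩
  obtain ⟨δ, hδ⟩ : ∃ δ : ℝ, δ = 1 / d := ⟨_, rfl⟩
  obtain ⟨σ, hσ⟩ : ∃ σ : ℝ, σ = ν ^ b := ⟨_, rfl⟩
  have hν0 : 0 < ν := by rw [hν]; positivity
  have hδ0 : 0 < δ := by rw [hδ]; positivity
  have hσ0 : 0 < σ := by rw [hσ]; positivity
  have hν1 : ν ≤ 1 := by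
    rw [hν, div_le_one (by positivity)]; exact_mod_cast hn
  have hnν : n * ν = 1 := by rw [hν]; field_simp
  have hdδ : d * δ = 1 := by rw [hδ]; field_simp
  have hcells : numCells 1 ν = n := numCells_eq hν0 hnν
  have hσ2 : ν ^ (2 * b) = σ ^ 2 := by rw [hσ]; ring
  obtain ⟨hn₀0, hD⟩ := ratio_eq_one_div hn hd hn₀
  rw [← hν, ← hδ, hσ2] at hn₀
  rw [← hν, ← hδ] at hfin hA hD ⊢
  have hM : ((n ^ b : ℕ) : ℝ) * σ = 1 := by
    rw [hσ, Nat.cast_pow, ← mul_pow, hnν, one_pow]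
  have hL : ((n ^ (b - 1) : ℕ) : ℝ) * σ = ν := by
    obtain ⟨b, rfl⟩ := Nat.exists_eq_add_of_le' hb
    rw [hσ, Nat.cast_pow, Nat.add_sub_cancel, pow_succ, ← mul_assoc, ← mul_pow, hnν, one_pow, one_mul]
  have hσδ : σ ^ 2 = n₀ * δ := by
    rw [← hn₀]; field_simp
  have hN : ((n₀ * n ^ b : ℕ) : ℝ) * δ = σ := by
    push_cast at hM ⊢
    linear_combination σ * hM - (n : ℝ) ^ b * hσδ
  have hN0 : 0 < n₀ * n ^ b := by positivity
  have hQ : ((n₀ * d : ℕ) : ℝ) * (σ ^ 2)⁻¹ = (δ ^ 2)⁻¹ := by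
    have : (d : ℝ) = δ⁻¹ := eq_inv_of_mul_eq_one_left hdδ
    have hn₀' : (n₀ : ℝ) ≠ 0 := by positivity
    rw [hσδ, Nat.cast_mul, this]
    field_simp
  have hcell : ∀ m < n, 0 ≤ m * ν ∧ m * ν + ν ≤ 1 := fun m hm => by
    have : (m : ℝ) + 1 ≤ n := by exact_mod_cast hm
    exact ⟨by positivity, by nlinarith⟩
  intro g hg c m hm m' hm' hsep
  -- The bound for `2 * b` is used with the two intervals interchanged.
  have hT := bilinearConst_spec (by linarith) (by linarith) hδ0 hfin hg c hm' hm hsep.symm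
  rw [hcells] at hm hm'
  rw [hσ2] at hT
  have h := hC _ _ _ _ σ δ ν (m * ν) (m' * ν) s g c _ (by positivity) hN0 hM hL hN hQ hσ0 hδ0 hν0 hν1
    (hcell m hm).1 (hcell m hm).2 (hcell m' hm').1 (hcell m' hm').2 hsep hs hs3 hg hT
  rw [hD] at hA
  rw [← hσ]
  exact h.trans (mul_le_mul' hA le_rfl)

end

end ParabolaDecoupling

theorem lemma5p4 (ε : ℝ) (hε : 0 < ε) :
    ∃ C : ℝ, 0 < C ∧
      ∀ (s : ℝ), 2 ≤ s → s ≤ 3 → ∀ (b : ℕ), 1 ≤ b → ∀ (δ ν : ℝ),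
        ParabolaDecoupling.IsUnitFraction δ → ParabolaDecoupling.IsUnitFraction ν → ν < 1 / 100 →
        (∃ n : ℕ, ν ^ (2 * b) * δ⁻¹ = (n : ℝ)) →
        ParabolaDecoupling.bilinearConst s b δ ν ≤
          ENNReal.ofReal (C * ν ^ (-(1 / 6 : ℝ) * (1 + (b : ℝ) * ε))) *
            ParabolaDecoupling.bilinearConst s (2 * b) δ ν ^ (1 / 2 : ℝ) *
            ParabolaDecoupling.linearConst (δ / ν ^ b) ^ (1 / 2 : ℝ) := by
  obtain ⟨K, hK⟩ := ParabolaDecoupling.exists_bilinearConst_le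
  obtain ⟨K', hK'⟩ := ParabolaDecoupling.exists_one_le_linearConst
  have hC1 : (1 : ℝ) ≤ K + 1 := by linarith [K.coe_nonneg]
  refine ⟨K + 1, by linarith, ?_⟩
  rintro s hs hs3 b hb _ _ ⟨d, hd, rfl⟩ ⟨n, hn, rfl⟩ - ⟨n₀, hn₀⟩
  have hn1 : (1 : ℝ) ≤ n := by exact_mod_cast hn
  have hν0 : 0 < 1 / (n : ℝ) := by positivity
  have hν1 : 1 / (n : ℝ) ≤ 1 := by rw [div_le_one (by positivity)]; exact hn1
  have hpos : 0 < ((K : ℝ) + 1) * (1 / (n : ℝ)) ^ (-(1 / 6 : ℝ) * (1 + (b : ℝ) * ε)) := by positivity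
  have hpow : ((K : ℝ) + 1) * (1 / (n : ℝ))⁻¹ ≤
      (((K : ℝ) + 1) * (1 / (n : ℝ)) ^ (-(1 / 6 : ℝ) * (1 + (b : ℝ) * ε))) ^ 6 := by
    rw [mul_pow, ← Real.rpow_natCast ((1 / (n : ℝ)) ^ _), ← Real.rpow_mul hν0.le,
      ← Real.rpow_neg_one (1 / (n : ℝ))]
    refine mul_le_mul (le_self_pow₀ hC1 (by norm_num))
      (Real.rpow_le_rpow_of_exponent_ge hν0 hν1 ?_) (by positivity) (by positivity)
    have : 0 ≤ b * ε := by positivity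
    push_cast
    linarith
  obtain ⟨hn₀0, hN⟩ := ParabolaDecoupling.ratio_eq_one_div hn hd hn₀
  -- If the bilinear constant on the right is infinite, the bound is trivial only because the other
  -- factors do not vanish.
  have hD0 : ParabolaDecoupling.linearConst (1 / (d : ℝ) / (1 / (n : ℝ)) ^ b) ≠ 0 := fun h => by
    have := hK' (n₀ * n ^ b) (by positivity)
    rw [← hN, h, ENNReal.zero_rpow_of_pos (by norm_num), mul_zero] at this
    exact absurd this (by simp)
  by_cases hfin : ParabolaDecoupling.bilinearConst s (2 * b) (1 / d) (1 / n) = ∞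
  · rw [hfin, ENNReal.top_rpow_of_pos (by norm_num), ENNReal.mul_top, ENNReal.top_mul]
    · exact le_top
    · exact (ENNReal.rpow_pos_of_nonneg (pos_iff_ne_zero.2 hD0) (by norm_num)).ne'
    · rwa [Ne, ENNReal.ofReal_eq_zero, not_le]
  refine hK s b n d n₀ hs hs3 hb hn hd hn₀ _ hfin ?_
  rw [mul_pow, mul_pow, mul_assoc, ← ENNReal.ofReal_pow hpos.le, ← mul_assoc]
  refine mul_le_mul' ((le_trans ?_ (ENNReal.ofReal_le_ofReal hpow))) (le_of_eq ?_)
  · rw [ENNReal.ofReal_mul (by positivity)]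
    refine mul_le_mul' ?_ le_rfl
    rw [ENNReal.ofReal_add K.coe_nonneg zero_le_one, ENNReal.ofReal_coe_nnreal]
    exact le_self_add
  · simp only [← ENNReal.rpow_natCast, ← ENNReal.rpow_mul]
    norm_num
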